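/- Let $N=\mathbb Z^n$ with $n\ge 2$. Let $(\Gamma,h)$ be a tropical curve in $N_{\mathbb R}$: $\Gamma$ is a connected finite weighted graph with bounded and unbounded edges, all of whose vertices are 2- or 3-valent, $h$ maps vertices to points with rational coordinates, contracts each bounded edge to a point or embeds it as a segment with primitive integral direction, embeds each unbounded edge as a half line with primitive integral direction, and satisfies the balancing condition at every vertex (contracted edges contributing $0$). Assume that $h$ contracts no loop of $\Gamma$. Let $g=\dim H_1(\Gamma;\mathbb Q)$ be its genus. Let $\mathscr P$ be a finite rational polyhedral decomposition of $N_{\mathbb R}$ into polyhedra with vertices, such that $h$ maps the vertices of $\Gamma$ to vertices of $\mathscr P$ and each non-contracted edge onto a 1-dimensional cell of $\mathscr P$ (2-valent vertices are added to $\Gamma$ where needed). Let $t\colon\mathfrak X\to\mathbb C$ be the associated toric degeneration: $\mathfrak X$ is the toric variety of the fan in $N_{\mathbb R}\times\mathbb R$ formed by the faces of the closed cones $C(\Xi)$ over $\Xi\times\{1\}$, $\Xi\in\mathscr P$, and $t$ is given by the projection $N\times\mathbb Z\to\mathbb Z$. Let $X_0=t^{-1}(0)=\bigcup_v X_v$ be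 its central fibre, with components $X_v$ indexed by the vertices $v$ of $\mathscr P$, and let $\Theta_{\mathfrak X/\mathbb C}$ be the logarithmic tangent sheaf of $\mathfrak X$ (with its toric log structure) relative to $\mathbb C$ (with the log structure given by $0\in\mathbb C$). Let $\varphi_0\colon C_0\to X_0$ be a pre-log curve of type $(\Gamma,h)$. That is, $\varphi_0$ is a stable map from a connected nodal curve such that: over each $X_v$ it is torically transverse (generically mapped to the open orbit of $X_v$, and avoiding the toric strata of $X_v$ of codimension $\ge 2$); every point mapped to the singular locus of $X_0$ is a node, whose two branches are mapped to different components of $X_0$ with equal intersection multiplicities with the double locus; the components of $C_0$ are copies of $\mathbb P^1$ which correspond to the connected components of the fibres of $h$ over the vertices of $h(\Gamma)$, the component of a connected component of $h^{-1}(v)$ being mapped non-constantly to $X_v$; the nodes correspond to the non-contracted bounded edges, compatibly with incidence; and the points of a component which are mapped to the toric boundary of $X_v$ correspond bijectively to the flags of non-contracted edges $E$ at the vertices of the corresponding connected component of $h^{-1}(v)$, the point of such a flag being mapped to the toric divisor of $h(E)$ with intersection multiplicity the weight of $E$. Then $$\dim_{\mathbb C} H^1(C_0,\varphi_0^*\Theta_{\mathfrak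 X/\mathbb C})=ng .$$ Moreover, the dualizing sheaf $\omega_{C_0}$ of $C_0$ satisfies $\dim_{\mathbb C}H^0(C_0,\omega_{C_0})=g$. -/

import Mathlib

noncomputable section

open Filter Topology TopologicalSpace CategoryTheory
open scoped TensorProduct

namespace TropDeg

/-! ## Reduced complex varieties as spaces with functions

A reduced scheme of finite type over `ℂ` is encoded by its set of closed points with the Zariski
topology, together with the local rings of germs of regular functions. -/

instance germAlgebra {α : Type} (l : Filter α) : Algebra ℂ (l.Germ ℂ) :=
  Algebra.ofModule
    (by intro c f g
        induction f using Filter.Germ.inductionOn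
        induction g using Filter.Germ.inductionOn
        exact congrArg _ (funext fun _ => mul_assoc _ _ _))
    (by intro c f g
        induction f using Filter.Germ.inductionOn
        induction g using Filter.Germ.inductionOn
        exact congrArg _ (funext fun _ => mul_left_comm _ _ _))

/-- A space with functions: to each point `x` the local `ℂ`-algebra of germs at `x` of regular
functions. -/
class HasRegularGerms (X : Type) [TopologicalSpace X] where
  stalk : (x : X) → Subalgebra ℂ ((𝓝 x).Germ ℂ)

/-- The local ring `𝒪_{X,x}`. -/
abbrev Stalk {X : Type} [TopologicalSpace X] [HasRegularGerms X] (x : X) :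
    Subalgebra ℂ ((𝓝 x).Germ ℂ) := HasRegularGerms.stalk x

/-- `f` is a regular function on `U` (its values outside `U` are irrelevant for open `U`). -/
def IsRegularOn {X : Type} [TopologicalSpace X] [HasRegularGerms X] (f : X → ℂ) (U : Set X) :
    Prop :=
  ∀ x ∈ U, (f : (𝓝 x).Germ ℂ) ∈ Stalk x

/-- Morphisms: continuous maps which pull back regular germs to regular germs. -/
structure Mor (X Y : Type) [TopologicalSpace X] [TopologicalSpace Y] [HasRegularGerms X]
    [HasRegularGerms Y] where
  toFun : X → Y
  cont : Continuous toFun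
  regular : ∀ x, ∀ g ∈ Stalk (toFun x), g.compTendsto toFun (cont.tendsto x) ∈ Stalk x

/-- The ring homomorphism `𝒪_{Y,φ(x)} → 𝒪_{X,x}` of a morphism `φ`. -/
def Mor.comap {X Y : Type} [TopologicalSpace X] [TopologicalSpace Y] [HasRegularGerms X]
    [HasRegularGerms Y] (φ : Mor X Y) (x : X) : Stalk (φ.toFun x) →+* Stalk x where
  toFun g := ⟨g.1.compTendsto φ.toFun (φ.cont.tendsto x), φ.regular x g.1 g.2⟩
  map_one' := rfl
  map_zero' := rfl
  map_mul' := by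
    rintro ⟨f, hf⟩ ⟨g, hg⟩
    apply Subtype.ext
    induction f using Filter.Germ.inductionOn
    induction g using Filter.Germ.inductionOn
    rfl
  map_add' := by
    rintro ⟨f, hf⟩ ⟨g, hg⟩
    apply Subtype.ext
    induction f using Filter.Germ.inductionOn
    induction g using Filter.Germ.inductionOn
    rfl

/-! ## Nodal curves with rational components -/

/-- The complex projective line with its Zariski topology. -/
abbrev P1 : Type := CofiniteTopology (OnePoint ℂ)

/-- The standard local coordinate of `ℙ¹` centred at `p`: `s ↦ a + s` if `p = a ∈ ℂ`, and
`s ↦ 1 / s` if `p = ∞`. -/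
def coord (p : P1) (s : ℂ) : P1 :=
  CofiniteTopology.of <|
    (CofiniteTopology.of.symm p).elim
      (if s = 0 then OnePoint.infty else ((s⁻¹ : ℂ) : OnePoint ℂ))
      (fun a => ((a + s : ℂ) : OnePoint ℂ))

/-- `f` is regular at `p`: near `p` it is a quotient of polynomials in the coordinate at `p`. -/
def IsRegularAt (f : P1 → ℂ) (p : P1) : Prop :=
  ∃ A B : Polynomial ℂ, B.eval 0 ≠ 0 ∧ f p = A.eval 0 / B.eval 0 ∧
    ∀ᶠ s in cofinite, f (coord p s) = A.eval s / B.eval s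

/-- `f` is regular at `p` and vanishes there to order exactly `w`. -/
def HasOrderAt (f : P1 → ℂ) (p : P1) (w : ℕ) : Prop :=
  ∃ A B : Polynomial ℂ, A.eval 0 ≠ 0 ∧ B.eval 0 ≠ 0 ∧ f p = 0 ^ w * A.eval 0 / B.eval 0 ∧
    ∀ᶠ s in cofinite, f (coord p s) = s ^ w * A.eval s / B.eval s

lemma eventually_eval_ne {B : Polynomial ℂ} (hB : B.eval 0 ≠ 0) :
    ∀ᶠ s in cofinite, B.eval s ≠ 0 := by
  have hB0 : B ≠ 0 := by rintro rfl; simp at hB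
  have := Polynomial.finite_setOfPred_isRoot hB0
  rw [Filter.eventually_cofinite]
  simpa [Polynomial.IsRoot] using this

lemma IsRegularAt.add {f g : P1 → ℂ} {p : P1} (hf : IsRegularAt f p) (hg : IsRegularAt g p) :
    IsRegularAt (f + g) p := by
  obtain ⟨A, B, hB, h0, h⟩ := hf
  obtain ⟨A', B', hB', h0', h'⟩ := hg
  refine ⟨A * B' + B * A', B * B', by simp [hB, hB'], ?_, ?_⟩
  · simp [h0, h0', div_add_div _ _ hB hB']
  · filter_upwards [h, h', eventually_eval_ne hB, eventually_eval_ne hB'] with s h1 h2 h3 h4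
    simp [h1, h2, div_add_div _ _ h3 h4]

lemma IsRegularAt.mul {f g : P1 → ℂ} {p : P1} (hf : IsRegularAt f p) (hg : IsRegularAt g p) :
    IsRegularAt (f * g) p := by
  obtain ⟨A, B, hB, h0, h⟩ := hf
  obtain ⟨A', B', hB', h0', h'⟩ := hg
  refine ⟨A * A', B * B', by simp [hB, hB'], ?_, ?_⟩
  · simp [h0, h0', div_mul_div_comm]
  · filter_upwards [h, h'] with s h1 h2
    simp [h1, h2, div_mul_div_comm]

/-- A connected projective nodal curve whose components have normalization `ℙ¹`: finitely many
copies of `ℙ¹`, glued transversally along finitely many pairs of points. The two branches of the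
node `ν` are `branch ν false` and `branch ν true`. -/
structure NodalCurve where
  Comp : Type
  Node : Type
  [finComp : Fintype Comp]
  [finNode : Fintype Node]
  branch : Node → Bool → (Σ _ : Comp, P1)
  branch_injective : Function.Injective fun x : Node × Bool => branch x.1 x.2
  nonempty : Nonempty Comp
  connected : ∀ i j : Comp,
    Relation.EqvGen (fun a b => ∃ ν, (branch ν false).1 = a ∧ (branch ν true).1 = b) i j

attribute [instance] NodalCurve.finComp NodalCurve.finNode

namespace NodalCurve

variable (C : NodalCurve)

/-- The points of the nodal curve. -/
def Point : Type :=
  Quot fun a b : (Σ _ : C.Comp, P1) => ∃ ν, a = C.branch ν false ∧ b = C.branch ν true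

/-- The Zariski topology (the quotient topology). -/
instance : TopologicalSpace C.Point := inferInstanceAs (TopologicalSpace (Quot _))

/-- The map `ℙ¹ → C` which normalizes the component `i`. -/
def pt (i : C.Comp) (p : P1) : C.Point := Quot.mk _ ⟨i, p⟩

/-- The regular germs are the functions on `C` whose pull back to the normalization is regular;
at a node this is `{(f', f'') | f' (P) = f'' (P)}`. -/
instance : HasRegularGerms C.Point where
  stalk c :=
    { carrier := {g | ∃ f : C.Point → ℂ, (f : (𝓝 c).Germ ℂ) = g ∧
        ∀ i p, C.pt i p = c → IsRegularAt (fun q => f (C.pt i q)) p}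
      mul_mem' := by
        rintro _ _ ⟨f, rfl, hf⟩ ⟨g, rfl, hg⟩
        exact ⟨f * g, rfl, fun i p h => (hf i p h).mul (hg i p h)⟩
      add_mem' := by
        rintro _ _ ⟨f, rfl, hf⟩ ⟨g, rfl, hg⟩
        exact ⟨f + g, rfl, fun i p h => (hf i p h).add (hg i p h)⟩
      algebraMap_mem' := fun r =>
        ⟨fun _ => r, by
          rw [Algebra.algebraMap_eq_smul_one]
          exact congrArg _ (funext fun _ => (mul_one r).symm),
          fun i p _ => ⟨Polynomial.C r, 1, by simp, by simp, by simp⟩⟩ }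

/-! ### The dualizing sheaf

A section of the dualizing sheaf consists of rational 1-forms on the components which are regular
away from the nodes and have at most simple poles with opposite residues at the two branches of
each node. -/

/-- The coefficient of the rational 1-form `η dz` in the coordinate `s` at `p`: it is `η (a + s)`
at `p = a`, and `- η (1 / s) / s ^ 2` at `p = ∞`. -/
def formCoeff (η : RatFunc ℂ) (p : P1) (s : ℂ) : ℂ :=
  (CofiniteTopology.of.symm p).elim
    (-(η.eval (RingHom.id ℂ) s⁻¹) / s ^ 2) (fun a => η.eval (RingHom.id ℂ) (a + s))

/-- `η dz` has at most a simple pole at `p`, with residue `r`. -/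
def HasResidue (η : RatFunc ℂ) (p : P1) (r : ℂ) : Prop :=
  ∃ A B : Polynomial ℂ, B.eval 0 ≠ 0 ∧ A.eval 0 / B.eval 0 = r ∧
    ∀ᶠ s in cofinite, s * formCoeff η p s = A.eval s / B.eval s

lemma eventually_denom (η : RatFunc ℂ) :
    ∀ᶠ z in cofinite, Polynomial.eval₂ (RingHom.id ℂ) z η.denom ≠ 0 := by
  have := Polynomial.finite_setOfPred_isRoot (RatFunc.denom_ne_zero η)
  rw [Filter.eventually_cofinite]
  simpa [Polynomial.IsRoot, Polynomial.eval₂_id] using this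

lemma formCoeff_add (η θ : RatFunc ℂ) (p : P1) :
    ∀ᶠ s in cofinite, formCoeff (η + θ) p s = formCoeff η p s + formCoeff θ p s := by
  have key : ∀ᶠ z in cofinite, (η + θ).eval (RingHom.id ℂ) z
      = η.eval (RingHom.id ℂ) z + θ.eval (RingHom.id ℂ) z := by
    filter_upwards [eventually_denom η, eventually_denom θ] with z h1 h2
    exact RatFunc.eval_add _ _ h1 h2
  unfold formCoeff
  induction CofiniteTopology.of.symm p using OnePoint.rec with
  | infty =>
    have h := (inv_injective (G := ℂ)).tendsto_cofinite.eventually key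
    filter_upwards [h] with s hs
    simp only [OnePoint.elim_infty, hs]
    ring
  | coe a =>
    exact (add_right_injective a).tendsto_cofinite.eventually key

lemma formCoeff_smul (c : ℂ) (η : RatFunc ℂ) (p : P1) :
    ∀ᶠ s in cofinite, formCoeff (c • η) p s = c * formCoeff η p s := by
  have key : ∀ᶠ z in cofinite, (c • η).eval (RingHom.id ℂ) z
      = c * η.eval (RingHom.id ℂ) z := by
    filter_upwards [eventually_denom η] with z h1
    rw [RatFunc.smul_eq_C_mul, RatFunc.eval_mul _ _ (by simp) h1]
    simp
  unfold formCoeff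
  induction CofiniteTopology.of.symm p using OnePoint.rec with
  | infty =>
    have h := (inv_injective (G := ℂ)).tendsto_cofinite.eventually key
    filter_upwards [h] with s hs
    simp only [OnePoint.elim_infty, hs]
    ring
  | coe a =>
    exact (add_right_injective a).tendsto_cofinite.eventually key

lemma HasResidue.add {η θ : RatFunc ℂ} {p : P1} {r t : ℂ} (hη : HasResidue η p r)
    (hθ : HasResidue θ p t) : HasResidue (η + θ) p (r + t) := by
  obtain ⟨A, B, hB, h0, h⟩ := hη
  obtain ⟨A', B', hB', h0', h'⟩ := hθ
  refine ⟨A * B' + B * A', B * B', by simp [hB, hB'], ?_, ?_⟩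
  · simp [← h0, ← h0', div_add_div _ _ hB hB']
  · filter_upwards [h, h', eventually_eval_ne hB, eventually_eval_ne hB', formCoeff_add η θ p]
      with s h1 h2 h3 h4 h5
    rw [h5, mul_add, h1, h2, div_add_div _ _ h3 h4]
    simp

lemma HasResidue.smul {η : RatFunc ℂ} {p : P1} {r : ℂ} (c : ℂ) (hη : HasResidue η p r) :
    HasResidue (c • η) p (c * r) := by
  obtain ⟨A, B, hB, h0, h⟩ := hη
  refine ⟨Polynomial.C c * A, B, hB, ?_, ?_⟩
  · simp [← h0, mul_div_assoc]
  · filter_upwards [h, formCoeff_smul c η p] with s h1 h2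
    rw [h2, mul_left_comm, h1]
    simp [mul_div_assoc]

lemma hasResidue_zero (p : P1) : HasResidue 0 p 0 := by
  refine ⟨0, 1, by simp, by simp, ?_⟩
  refine Eventually.of_forall fun s => ?_
  unfold formCoeff
  induction CofiniteTopology.of.symm p using OnePoint.rec <;> simp

/-- `H⁰(C, ω_C)`. A rational 1-form with at most a simple pole and residue `0` at a point is regular
there. -/
def dualizingSections : Submodule ℂ (C.Comp → RatFunc ℂ) where
  carrier := {η |
    (∀ i p, (∀ ν b, C.branch ν b ≠ ⟨i, p⟩) → HasResidue (η i) p 0) ∧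
    ∀ ν, ∃ r, HasResidue (η (C.branch ν false).1) (C.branch ν false).2 r ∧
      HasResidue (η (C.branch ν true).1) (C.branch ν true).2 (-r)}
  add_mem' := by
    rintro η θ ⟨h1, h2⟩ ⟨h1', h2'⟩
    refine ⟨fun i p h => by simpa using (h1 i p h).add (h1' i p h), fun ν => ?_⟩
    obtain ⟨r, hr, hr'⟩ := h2 ν
    obtain ⟨t, ht, ht'⟩ := h2' ν
    refine ⟨r + t, hr.add ht, ?_⟩
    rw [neg_add]
    exact hr'.add ht'
  zero_mem' := ⟨fun i p _ => hasResidue_zero p,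
    fun ν => ⟨0, hasResidue_zero _, by simpa using hasResidue_zero _⟩⟩
  smul_mem' := by
    rintro c η ⟨h1, h2⟩
    refine ⟨fun i p h => by simpa using (h1 i p h).smul c, fun ν => ?_⟩
    obtain ⟨r, hr, hr'⟩ := h2 ν
    refine ⟨c * r, hr.smul c, ?_⟩
    rw [← mul_neg]
    exact hr'.smul c

end NodalCurve

/-! ## Tropical curves in `N_ℝ`, `N = ℤⁿ` -/

/-- A connected weighted finite graph with bounded edges `E` (edge `e` joins `ends e false` and
`ends e true`) and unbounded edges `L`. -/
structure WGraph where
  V : Type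
  E : Type
  L : Type
  [finV : Fintype V]
  [finE : Fintype E]
  [finL : Fintype L]
  ends : E → Bool → V
  base : L → V
  wE : E → ℕ
  wL : L → ℕ
  wE_pos : ∀ e, 0 < wE e
  wL_pos : ∀ l, 0 < wL l
  nonempty : Nonempty V
  connected : ∀ a b : V,
    Relation.EqvGen (fun a b => ∃ e, ends e false = a ∧ ends e true = b) a b

attribute [instance] WGraph.finV WGraph.finE WGraph.finL

namespace WGraph

variable (Γ : WGraph)

/-- Flags; `Sum.inl (e, b)` is the bounded edge `e` with its end `b`. -/
abbrev Flag : Type := (Γ.E × Bool) ⊕ Γ.L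

/-- The vertex of a flag. -/
def vertex : Γ.Flag → Γ.V := Sum.elim (fun x => Γ.ends x.1 x.2) Γ.base

/-- The weight of the edge of a flag. -/
def weight : Γ.Flag → ℕ := Sum.elim (fun x => Γ.wE x.1) Γ.wL

/-- The number of flags at a vertex. -/
def valence (v : Γ.V) : ℕ := Nat.card {f : Γ.Flag // Γ.vertex f = v}

open Classical in
/-- The boundary map `C₁(Γ; ℚ) → C₀(Γ; ℚ)`; unbounded edges do not contribute to the homology. -/
def boundary : (Γ.E → ℚ) →ₗ[ℚ] (Γ.V → ℚ) where
  toFun c v := ∑ e, c e * ((if Γ.ends e true = v then 1 else 0) -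
    (if Γ.ends e false = v then 1 else 0))
  map_add' c d := by
    funext v
    simp only [Pi.add_apply, add_mul, Finset.sum_add_distrib]
  map_smul' r c := by
    funext v
    simp only [Pi.smul_apply, smul_eq_mul, mul_assoc, Finset.mul_sum, RingHom.id_apply]

/-- The genus, that is the first Betti number `dim H₁(Γ; ℚ)`. -/
def genus : ℕ := Module.finrank ℚ (LinearMap.ker Γ.boundary)

end WGraph

/-- Primitive integral vectors. -/
def IsPrimitive {n : ℕ} (u : Fin n → ℤ) : Prop :=
  ∀ (k : ℤ) (u' : Fin n → ℤ), u = k • u' → IsUnit k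

/-- The image in `N_ℝ` of a lattice vector. -/
def toReal {n : ℕ} (u : Fin n → ℤ) : Fin n → ℝ := fun i => (u i : ℝ)

/-- A (parametrized) tropical curve `h : Γ → N_ℝ`, given by the positions `pos` of the vertices and
the directions of the edges: a bounded edge is either contracted (and then has direction zero) or
embedded as a segment with primitive direction `dirE e` from `ends e false` to `ends e true`, and
an unbounded edge is embedded as a half line with primitive direction `dirL l`. -/
structure TropicalCurve (n : ℕ) extends WGraph where
  pos : V → Fin n → ℝ
  dirE : E → Fin n → ℤ
  dirL : L → Fin n → ℤ
  pos_rational : ∀ v i, ∃ q : ℚ, pos v i = (q : ℝ)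
  dirE_spec : ∀ e, (pos (ends e false) = pos (ends e true) ∧ dirE e = 0) ∨
    (IsPrimitive (dirE e) ∧ ∃ r : ℝ, 0 < r ∧
      pos (ends e true) = pos (ends e false) + r • toReal (dirE e))
  dirL_primitive : ∀ l, IsPrimitive (dirL l)
  balanced : open Classical in ∀ v,
    ∑ f : toWGraph.Flag, (if toWGraph.vertex f = v then
      (toWGraph.weight f : ℤ) • Sum.elim (fun x => if x.2 then -dirE x.1 else dirE x.1) dirL f
      else 0) = 0

namespace TropicalCurve

variable {n : ℕ} (T : TropicalCurve n)

/-- The bounded edge `e` is contracted by `h`. -/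
def Contracted (e : T.E) : Prop := T.pos (T.ends e false) = T.pos (T.ends e true)

/-- The bounded edges which are not contracted. -/
abbrev EdgeNC : Type := {e : T.E // ¬ T.Contracted e}

/-- `Γ` is 3-valent, 2-valent vertices being allowed (1-valent vertices are the removed points at
infinity), and `h` contracts no loop of `Γ`: no nonzero cycle is supported on contracted edges. -/
structure Admissible : Prop where
  threeValent : ∀ v, T.valence v = 2 ∨ T.valence v = 3
  noContractedLoop : ∀ c ∈ LinearMap.ker T.boundary, (∀ e, c e ≠ 0 → T.Contracted e) → c = 0

/-- The vertices of the graph obtained from `Γ` by contracting the contracted edges, that is the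
connected components of the sets `h⁻¹(v)`, `v` a vertex of `h(Γ)`. -/
def Cluster : Type :=
  Quot fun a b : T.V => ∃ e, T.Contracted e ∧ T.ends e false = a ∧ T.ends e true = b

/-- The cluster of a vertex. -/
def cluster (v : T.V) : T.Cluster := Quot.mk _ v

/-- Flags of edges which are not contracted. -/
abbrev FlagNC : Type := (T.EdgeNC × Bool) ⊕ T.L

/-- The vertex of a flag. -/
def vertexNC : T.FlagNC → T.V := Sum.elim (fun x => T.ends x.1.1 x.2) T.base

/-- The weight of a flag. -/
def weightNC : T.FlagNC → ℕ := Sum.elim (fun x => T.wE x.1.1) T.wL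

/-- The image `h(E)` of the edge of a flag. -/
def image : T.FlagNC → Set (Fin n → ℝ) :=
  Sum.elim (fun x => segment ℝ (T.pos (T.ends x.1.1 false)) (T.pos (T.ends x.1.1 true)))
    (fun l => {x | ∃ t : ℝ, 0 ≤ t ∧ x = T.pos (T.base l) + t • toReal (T.dirL l)})

end TropicalCurve

/-! ## Polyhedral decompositions and the associated toric degenerations -/

/-- A rational polyhedral decomposition of `N_ℝ`: a finite set of nonempty rational polyhedra
having at least one vertex, closed under passage to (nonempty) faces, meeting along common faces,
and covering `N_ℝ`. -/
structure PolyDecomp (n : ℕ) where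
  cells : Set (Set (Fin n → ℝ))
  finite : cells.Finite
  polyhedral : ∀ Ξ ∈ cells, ∃ A B : Finset (Fin n → ℚ), A.Nonempty ∧
    Ξ = {x | ∃ a ∈ convexHull ℝ ((fun q : Fin n → ℚ => fun i => (q i : ℝ)) '' (A : Set (Fin n → ℚ))),
      ∃ b : (Fin n → ℚ) → ℝ, (∀ q, 0 ≤ b q) ∧ x = a + ∑ q ∈ B, b q • fun i => (q i : ℝ)}
  vertex : ∀ Ξ ∈ cells, ∃ v, IsExposed ℝ Ξ {v}
  face : ∀ Ξ ∈ cells, ∀ F : Set (Fin n → ℝ), F.Nonempty → IsExposed ℝ Ξ F → F ∈ cells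
  inter : ∀ Ξ ∈ cells, ∀ Ξ' ∈ cells, IsExposed ℝ Ξ (Ξ ∩ Ξ') ∧ IsExposed ℝ Ξ' (Ξ ∩ Ξ')
  cover : ⋃₀ cells = Set.univ

/-- The character lattice `M × ℤ` of the degeneration, dual to `N × ℤ`. -/
abbrev Char (n : ℕ) : Type := (Fin n → ℤ) × ℤ

/-- The pairing of `M × ℤ` with `N_ℝ × ℝ`. -/
def pairing {n : ℕ} (m : Char n) (x : (Fin n → ℝ) × ℝ) : ℝ := ∑ i, (m.1 i : ℝ) * x.1 i + m.2 * x.2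

lemma pairing_add {n : ℕ} (m m' : Char n) (x : (Fin n → ℝ) × ℝ) :
    pairing (m + m') x = pairing m x + pairing m' x := by
  simp only [pairing, Prod.fst_add, Prod.snd_add, Pi.add_apply, Int.cast_add, add_mul,
    Finset.sum_add_distrib]
  ring

lemma pairing_zero {n : ℕ} (x : (Fin n → ℝ) × ℝ) : pairing (0 : Char n) x = 0 := by
  simp [pairing]

lemma pairing_neg {n : ℕ} (m : Char n) (x : (Fin n → ℝ) × ℝ) :
    pairing (-m) x = -pairing m x := by
  have := pairing_add m (-m) x
  rw [add_neg_cancel, pairing_zero] at this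
  linarith

/-- The monoid `σ^∨ ∩ (M × ℤ)`. -/
def dualMonoid {n : ℕ} (σ : Set ((Fin n → ℝ) × ℝ)) : AddSubmonoid (Char n) where
  carrier := {m | ∀ x ∈ σ, 0 ≤ pairing m x}
  add_mem' ha hb x hx := by rw [pairing_add]; exact add_nonneg (ha x hx) (hb x hx)
  zero_mem' x _ := by rw [pairing_zero]

/-- The group `σ^⊥ ∩ (M × ℤ)`. -/
def perp {n : ℕ} (σ : Set ((Fin n → ℝ) × ℝ)) : AddSubgroup (Char n) where
  carrier := {m | ∀ x ∈ σ, pairing m x = 0}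
  add_mem' ha hb x hx := by rw [pairing_add, ha x hx, hb x hx, add_zero]
  zero_mem' x _ := pairing_zero x
  neg_mem' ha x hx := by rw [pairing_neg, ha x hx, neg_zero]

/-- The cone `C(Ξ)`, the closure of the cone over `Ξ × {1}`. -/
def coneOver {n : ℕ} (Ξ : Set (Fin n → ℝ)) : Set ((Fin n → ℝ) × ℝ) :=
  closure {y | ∃ a : ℝ, 0 ≤ a ∧ ∃ x ∈ Ξ, y = (a • x, a)}

namespace PolyDecomp

variable {n : ℕ} (P : PolyDecomp n)

/-- The fan in `N_ℝ × ℝ` of the degeneration: all faces of the cones `C(Ξ)`. -/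
def fan : Set (Set ((Fin n → ℝ) × ℝ)) :=
  {τ | ∃ Ξ ∈ P.cells, τ.Nonempty ∧ IsExposed ℝ (coneOver Ξ) τ}

/-- The closed points of the toric variety `𝔛` of the fan, as the disjoint union of the torus orbits
`Hom(τ^⊥ ∩ (M × ℤ), ℂˣ)`. -/
structure Total where
  cone : Set ((Fin n → ℝ) × ℝ)
  mem : cone ∈ P.fan
  char : Multiplicative (perp cone) →* ℂˣ

namespace Total

variable {P}

open Classical in
/-- The value at `x` of the monomial `χ^m` (for `m ∈ σ^∨`, where `x` lies in the chart of `σ`). -/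
def monomial (m : Char n) (x : P.Total) : ℂ :=
  if h : m ∈ perp x.cone then (x.char (Multiplicative.ofAdd ⟨m, h⟩) : ℂ) else 0

lemma monomial_zero (x : P.Total) : monomial 0 x = 1 := by
  rw [monomial, dif_pos (perp x.cone).zero_mem]
  exact congrArg Units.val (map_one x.char)

lemma monomial_add {x : P.Total} {m m' : Char n} (hm : m ∈ dualMonoid x.cone)
    (hm' : m' ∈ dualMonoid x.cone) : monomial (m + m') x = monomial m x * monomial m' x := by
  by_cases h : m ∈ perp x.cone
  · by_cases h' : m' ∈ perp x.cone
    · rw [monomial, monomial, monomial, dif_pos h, dif_pos h', dif_pos (add_mem h h'),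
        ← Units.val_mul, ← map_mul]
      rfl
    · rw [monomial, monomial, monomial, dif_neg h', dif_neg, mul_zero]
      intro h2
      exact h' (by simpa using sub_mem h2 h)
  · rw [monomial, monomial, dif_neg h, dif_neg, zero_mul]
    intro h2
    apply h
    intro y hy
    have h1 := h2 y hy
    rw [pairing_add] at h1
    have := hm y hy
    have := hm' y hy
    linarith

/-- The affine chart `U_σ`: the union of the orbits of the faces of `σ`. -/
def chart (σ : Set ((Fin n → ℝ) × ℝ)) : Set P.Total := {x | IsExposed ℝ σ x.cone}

lemma cone_subset {σ : Set ((Fin n → ℝ) × ℝ)} {x : P.Total} (hx : x ∈ chart σ) : x.cone ⊆ σ :=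
  IsExposed.subset hx

/-- Evaluation at a point of `U_σ`, as a homomorphism on the coordinate ring
`ℂ[σ^∨ ∩ (M × ℤ)]`. -/
def evalHom {σ : Set ((Fin n → ℝ) × ℝ)} {x : P.Total} (hx : x ∈ chart σ) :
    AddMonoidAlgebra ℂ (dualMonoid σ) →ₐ[ℂ] ℂ :=
  AddMonoidAlgebra.lift ℂ ℂ (dualMonoid σ)
    { toFun := fun m => monomial (m.toAdd : Char n) x
      map_one' := monomial_zero x
      map_mul' := fun m m' => monomial_add
        (fun y hy => m.toAdd.2 y (cone_subset hx hy))
        (fun y hy => m'.toAdd.2 y (cone_subset hx hy)) }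

open Classical in
/-- The function on `U_σ` given by an element of its coordinate ring (extended by zero). -/
def evalFun {σ : Set ((Fin n → ℝ) × ℝ)} (f : AddMonoidAlgebra ℂ (dualMonoid σ)) (x : P.Total) : ℂ :=
  if hx : x ∈ chart σ then evalHom hx f else 0

/-- The Zariski topology, generated by the principal open subsets of the affine charts. -/
instance : TopologicalSpace P.Total :=
  generateFrom {U | ∃ σ ∈ P.fan, ∃ f : AddMonoidAlgebra ℂ (dualMonoid σ),
    U = {x | x ∈ chart σ ∧ evalFun f x ≠ 0}}

lemma mem_chart_self (x : P.Total) : x ∈ chart x.cone := IsExposed.refl x.cone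

lemma nhds_principal {x : P.Total} {f : AddMonoidAlgebra ℂ (dualMonoid x.cone)}
    (hf : evalFun f x ≠ 0) : ∀ᶠ y in 𝓝 x, y ∈ chart x.cone ∧ evalFun f y ≠ 0 :=
  IsOpen.mem_nhds (isOpen_generateFrom_of_mem ⟨x.cone, x.mem, f, rfl⟩) ⟨mem_chart_self x, hf⟩

lemma evalFun_mul {σ : Set ((Fin n → ℝ) × ℝ)} {y : P.Total} (hy : y ∈ chart σ)
    (f g : AddMonoidAlgebra ℂ (dualMonoid σ)) :
    evalFun (f * g) y = evalFun f y * evalFun g y := by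
  simp [evalFun, hy]

lemma evalFun_add {σ : Set ((Fin n → ℝ) × ℝ)} {y : P.Total} (hy : y ∈ chart σ)
    (f g : AddMonoidAlgebra ℂ (dualMonoid σ)) :
    evalFun (f + g) y = evalFun f y + evalFun g y := by
  simp [evalFun, hy]

/-- The local ring at `x`: quotients of elements of the coordinate ring of the smallest chart
around `x` whose denominator does not vanish at `x`. -/
instance : HasRegularGerms P.Total where
  stalk x :=
    { carrier := {g | ∃ f h : AddMonoidAlgebra ℂ (dualMonoid x.cone), evalFun h x ≠ 0 ∧
        g = ((fun y => evalFun f y / evalFun h y : P.Total → ℂ) : (𝓝 x).Germ ℂ)}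
      mul_mem' := by
        rintro _ _ ⟨f, h, hh, rfl⟩ ⟨f', h', hh', rfl⟩
        refine ⟨f * f', h * h', ?_, ?_⟩
        · rw [evalFun_mul (mem_chart_self x)]
          exact mul_ne_zero hh hh'
        · apply Filter.Germ.coe_eq.mpr
          filter_upwards [nhds_principal hh] with y hy
          simp only [evalFun_mul hy.1, div_mul_div_comm]
      add_mem' := by
        rintro _ _ ⟨f, h, hh, rfl⟩ ⟨f', h', hh', rfl⟩
        refine ⟨f * h' + h * f', h * h', ?_, ?_⟩
        · rw [evalFun_mul (mem_chart_self x)]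
          exact mul_ne_zero hh hh'
        · apply Filter.Germ.coe_eq.mpr
          filter_upwards [nhds_principal hh, nhds_principal hh'] with y hy hy'
          simp only [evalFun_mul hy.1, evalFun_add hy.1, div_add_div _ _ hy.2 hy'.2]
      algebraMap_mem' := by
        intro r
        refine ⟨algebraMap ℂ _ r, 1, ?_, ?_⟩
        · simp [evalFun, mem_chart_self x]
        · rw [Algebra.algebraMap_eq_smul_one]
          apply Filter.Germ.coe_eq.mpr
          have h1 : evalFun (1 : AddMonoidAlgebra ℂ (dualMonoid x.cone)) x ≠ 0 := by
            simp [evalFun, mem_chart_self x]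
          filter_upwards [nhds_principal h1] with y hy
          simp only [evalFun, hy.1, dite_true, AlgHom.commutes, map_one]
          simp }

/-- The function `t : 𝔛 → ℂ`, the monomial of the projection `N × ℤ → ℤ`. -/
def t : P.Total → ℂ := monomial (0, 1)

/-! ### The logarithmic tangent sheaf of `𝔛` relative to `ℂ` -/

/-- The stalk at `x` of the toric log structure of `𝔛`: products of monomials and units. -/
def logStructure (x : P.Total) : Set (Stalk x) :=
  {f | ∃ m ∈ dualMonoid x.cone, ∃ u : (Stalk x)ˣ,
    (f : (𝓝 x).Germ ℂ) = ((monomial m : P.Total → ℂ) : (𝓝 x).Germ ℂ) * ((u : Stalk x) : (𝓝 x).Germ ℂ)}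

/-- The stalk at `x` of the sheaf of logarithmic derivations of `𝔛` relative to the base `ℂ` with the
log structure defined by `t`. A logarithmic derivation is a derivation `D` with a map
`δ` from the log structure to the structure sheaf such that `D f = f * δ f`; here `δ` is determined
by `D` because the elements of the log structure are not zero divisors. Being relative to the base
means `D t = 0`. -/
def logTangentStalk (x : P.Total) : Submodule (Stalk x) (Derivation ℂ (Stalk x) (Stalk x)) where
  carrier := {D | (∀ f ∈ logStructure x, f ∣ D f) ∧
    ∀ f : Stalk x, (f : (𝓝 x).Germ ℂ) = ((t : P.Total → ℂ) : (𝓝 x).Germ ℂ) → D f = 0}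
  add_mem' := by
    rintro D D' ⟨h1, h2⟩ ⟨h1', h2'⟩
    exact ⟨fun f hf => dvd_add (h1 f hf) (h1' f hf), fun f hf => by simp [h2 f hf, h2' f hf]⟩
  zero_mem' := ⟨fun f _ => dvd_zero f, fun _ _ => rfl⟩
  smul_mem' := by
    rintro r D ⟨h1, h2⟩
    exact ⟨fun f hf => Dvd.dvd.mul_left (h1 f hf) r, fun f hf => by simp [h2 f hf]⟩

/-- `θ` is a section over `U` of the relative logarithmic tangent sheaf `Θ_{𝔛/ℂ}`, that is a
logarithmic derivation of the structure sheaf restricted to `U`. -/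
def IsLogField (U : Opens P.Total) (θ : (x : U) → logTangentStalk x.1) : Prop :=
  ∀ (V : Opens P.Total) (hV : V ≤ U) (f : P.Total → ℂ) (hf : IsRegularOn f (V : Set P.Total)),
    ∃ g : P.Total → ℂ, IsRegularOn g (V : Set P.Total) ∧
      ∀ (x : P.Total) (hx : x ∈ V),
        (((θ ⟨x, hV hx⟩).1 ⟨(f : (𝓝 x).Germ ℂ), hf x hx⟩ : Stalk x) : (𝓝 x).Germ ℂ) = g

/-! ### Strata of the central fibre -/

/-- The closure of the orbit of the cone `τ`. -/
def orbitClosure (τ : Set ((Fin n → ℝ) × ℝ)) : Set P.Total := {x | τ ⊆ x.cone}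

/-- The component `X_v` of the central fibre. -/
def component (v : Fin n → ℝ) : Set P.Total := orbitClosure (coneOver {v})

/-- The open orbit of `X_v`. -/
def interiorComponent (v : Fin n → ℝ) : Set P.Total := {x | x.cone = coneOver {v}}

end Total

/-- The vertices of the decomposition. -/
def vertices : Set (Fin n → ℝ) := {v | {v} ∈ P.cells}

/-- `h(Γ)` lies in the 1-skeleton of `P`, and the vertices of `Γ` are exactly the points (up to
contracted edges) which are mapped to vertices of `P`: vertices are mapped to vertices, and the
edges which are not contracted are mapped to 1-dimensional cells. -/
structure Respects (T : TropicalCurve n) : Prop where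
  vertex : ∀ v, T.pos v ∈ P.vertices
  edge : ∀ f, T.image f ∈ P.cells

end PolyDecomp

/-! ## Pull back of the logarithmic tangent sheaf and its cohomology -/

section Pullback

variable {n : ℕ} {P : PolyDecomp n} {C : NodalCurve} (φ : Mor C.Point P.Total)

/-- The local ring `𝒪_{C,c}`, viewed as an algebra over `𝒪_{𝔛,φ(c)}`. -/
def StalkAlong (_ : Mor C.Point P.Total) (c : C.Point) : Type := Stalk c

instance (c : C.Point) : CommRing (StalkAlong φ c) := inferInstanceAs (CommRing (Stalk c))

instance (c : C.Point) : Algebra (Stalk (φ.toFun c)) (StalkAlong φ c) :=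
  RingHom.toAlgebra (S := StalkAlong φ c) (φ.comap c)

/-- The stalk `𝒪_{C,c} ⊗ (Θ_{𝔛/ℂ})_{φ(c)}` over `𝒪_{𝔛,φ(c)}` of `φ^*Θ_{𝔛/ℂ}`. -/
def PullStalk (c : C.Point) : Type :=
  StalkAlong φ c ⊗[Stalk (φ.toFun c)] PolyDecomp.Total.logTangentStalk (φ.toFun c)

instance (c : C.Point) : AddCommGroup (PullStalk φ c) :=
  inferInstanceAs (AddCommGroup
    (StalkAlong φ c ⊗[Stalk (φ.toFun c)] PolyDecomp.Total.logTangentStalk (φ.toFun c)))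

instance (c : C.Point) : Module (StalkAlong φ c) (PullStalk φ c) :=
  inferInstanceAs (Module (StalkAlong φ c)
    (StalkAlong φ c ⊗[Stalk (φ.toFun c)] PolyDecomp.Total.logTangentStalk (φ.toFun c)))

/-- The pure tensor `f ⊗ θ`. -/
def tensor (c : C.Point) (f : StalkAlong φ c)
    (θ : PolyDecomp.Total.logTangentStalk (φ.toFun c)) : PullStalk φ c :=
  f ⊗ₜ[Stalk (φ.toFun c)] θ

/-- The germ at `c` of the function `f` on `C`. -/
def germAlong (W : Opens C.Point) (f : C.Point → ℂ) (hf : IsRegularOn f (W : Set C.Point)) (c : W) :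
    StalkAlong φ c.1 :=
  (⟨(f : (𝓝 c.1).Germ ℂ), hf c.1 c.2⟩ : Stalk c.1)

/-- The constant function `a` in `𝒪_{C,c}`. -/
def constAlong (a : ℂ) (c : C.Point) : StalkAlong φ c := algebraMap ℂ (Stalk c) a

/-- `s` is on `W` a finite sum of tensors `f ⊗ φ^{-1}θ` with regular functions `f` on `W` and
sections `θ` of `Θ_{𝔛/ℂ}` over a neighbourhood of `φ(W)`. -/
def IsPreSection (W : Opens C.Point) (s : (c : W) → PullStalk φ c.1) : Prop :=
  ∃ (U : Opens P.Total) (hU : ∀ c ∈ W, φ.toFun c ∈ U) (ι : Type) (_ : Fintype ι)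
    (f : ι → C.Point → ℂ) (hf : ∀ j, IsRegularOn (f j) (W : Set C.Point))
    (θ : ι → (x : U) → PolyDecomp.Total.logTangentStalk x.1),
    (∀ j, PolyDecomp.Total.IsLogField U (θ j)) ∧
    ∀ c : W, s c = ∑ j, tensor φ c.1 (germAlong φ W (f j) (hf j) c)
      (θ j ⟨φ.toFun c.1, hU c.1 c.2⟩)

/-- The sections of the sheaf `φ^*Θ_{𝔛/ℂ}`, the sheaf associated to the presheaf
`𝒪_C ⊗ φ^{-1}Θ_{𝔛/ℂ}`. -/
def IsSection (W : Opens C.Point) (s : (c : W) → PullStalk φ c.1) : Prop :=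
  ∀ c : W, ∃ (W' : Opens C.Point) (hW' : W' ≤ W), c.1 ∈ W' ∧
    IsPreSection φ W' fun x => s ⟨x.1, hW' x.2⟩

lemma IsPreSection.restrict {W W' : Opens C.Point} (h : W' ≤ W) {s : (c : W) → PullStalk φ c.1}
    (hs : IsPreSection φ W s) : IsPreSection φ W' fun x => s ⟨x.1, h x.2⟩ := by
  obtain ⟨U, hU, ι, hι, f, hf, θ, hθ, e⟩ := hs
  exact ⟨U, fun c hc => hU c (h hc), ι, hι, f, fun j x hx => hf j x (h hx), θ, hθ,
    fun c => e ⟨c.1, h c.2⟩⟩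

lemma IsPreSection.add {W : Opens C.Point} {s s' : (c : W) → PullStalk φ c.1}
    (hs : IsPreSection φ W s) (hs' : IsPreSection φ W s') : IsPreSection φ W (s + s') := by
  obtain ⟨U, hU, ι, hι, f, hf, θ, hθ, e⟩ := hs
  obtain ⟨U', hU', ι', hι', f', hf', θ', hθ', e'⟩ := hs'
  refine ⟨U ⊓ U', fun c hc => ⟨hU c hc, hU' c hc⟩, ι ⊕ ι', inferInstance, Sum.elim f f',
    fun j => by cases j with
      | inl j => exact hf j
      | inr j => exact hf' j,
    fun j x => Sum.elim (fun j => θ j ⟨x.1, x.2.1⟩) (fun j => θ' j ⟨x.1, x.2.2⟩) j, ?_, ?_⟩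
  · rintro (j | j) V hV g hg
    · exact hθ j V (hV.trans inf_le_left) g hg
    · exact hθ' j V (hV.trans inf_le_right) g hg
  · intro c
    rw [Fintype.sum_sum_type, Pi.add_apply, e c, e' c]
    rfl

lemma isRegularOn_const_mul {W : Opens C.Point} {f : C.Point → ℂ} (a : ℂ)
    (hf : IsRegularOn f (W : Set C.Point)) :
    IsRegularOn (fun x => a * f x) (W : Set C.Point) := fun x hx =>
  (Stalk x).smul_mem (hf x hx) a

lemma IsPreSection.smul {W : Opens C.Point} {s : (c : W) → PullStalk φ c.1} (a : ℂ)
    (hs : IsPreSection φ W s) : IsPreSection φ W fun c => constAlong φ a c.1 • s c := by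
  obtain ⟨U, hU, ι, hι, f, hf, θ, hθ, e⟩ := hs
  refine ⟨U, hU, ι, hι, fun j x => a * f j x, fun j => isRegularOn_const_mul a (hf j), θ, hθ, ?_⟩
  intro c
  change constAlong φ a c.1 • s c = _
  rw [e c, Finset.smul_sum]
  refine Finset.sum_congr rfl fun j _ => ?_
  refine (TensorProduct.smul_tmul' _ _ _).trans ?_
  change tensor φ c.1 _ _ = tensor φ c.1 _ _
  congr 1
  apply Subtype.ext
  change (algebraMap ℂ ((𝓝 c.1).Germ ℂ) a) * ((f j : (𝓝 c.1).Germ ℂ)) = _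
  rw [← Algebra.smul_def]
  rfl

lemma constAlong_add (a b : ℂ) (c : C.Point) :
    constAlong φ (a + b) c = constAlong φ a c + constAlong φ b c :=
  map_add (algebraMap ℂ (Stalk c)) a b

lemma constAlong_mul (a b : ℂ) (c : C.Point) :
    constAlong φ (a * b) c = constAlong φ a c * constAlong φ b c :=
  map_mul (algebraMap ℂ (Stalk c)) a b

lemma constAlong_one (c : C.Point) : constAlong φ 1 c = 1 := map_one (algebraMap ℂ (Stalk c))

lemma IsSection.smul {W : Opens C.Point} {s : (c : W) → PullStalk φ c.1} (a : ℂ)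
    (hs : IsSection φ W s) : IsSection φ W fun c => constAlong φ a c.1 • s c := fun c => by
  obtain ⟨W', h, hc, h'⟩ := hs c
  exact ⟨W', h, hc, h'.smul φ a⟩

/-- The group of sections of `φ^*Θ_{𝔛/ℂ}` over `W`. -/
def sections (W : Opens C.Point) : AddSubgroup ((c : W) → PullStalk φ c.1) where
  carrier := {s | IsSection φ W s}
  add_mem' := by
    intro s s' hs hs' c
    obtain ⟨W₁, h₁, hc₁, e₁⟩ := hs c
    obtain ⟨W₂, h₂, hc₂, e₂⟩ := hs' c
    exact ⟨W₁ ⊓ W₂, inf_le_left.trans h₁, ⟨hc₁, hc₂⟩,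
      (e₁.restrict φ inf_le_left).add φ (e₂.restrict φ inf_le_right)⟩
  zero_mem' := fun c => ⟨W, le_rfl, c.2, ⊤, fun _ _ => trivial, Empty, inferInstance,
    fun j => j.elim, fun j => j.elim, fun j => j.elim, fun j => j.elim, fun _ => by simp⟩
  neg_mem' := by
    intro s hs
    have h := IsSection.smul φ (-1) hs
    have e : (fun c : W => constAlong φ (-1) c.1 • s c) = -s := by
      funext c
      have h1 : constAlong φ (-1) c.1 = -1 := by
        rw [← constAlong_one φ c.1]
        exact map_neg (algebraMap ℂ (Stalk c.1)) 1
      rw [h1, neg_one_smul, Pi.neg_apply]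
    rw [e] at h
    exact h

/-- The locality of the condition `IsSection`. -/
def sectionPredicate : TopCat.LocalPredicate (X := TopCat.of C.Point) (fun c => PullStalk φ c) where
  pred {W} s := IsSection φ W s
  res {W W'} i s hs c := by
    obtain ⟨W₁, h₁, hc₁, e₁⟩ := hs ⟨c.1, i.le c.2⟩
    exact ⟨W ⊓ W₁, inf_le_left, ⟨c.2, hc₁⟩, e₁.restrict φ inf_le_right⟩
  locality {W} s hs c := by
    obtain ⟨W₁, hc₁, i, e₁⟩ := hs c
    obtain ⟨W₂, h₂, hc₂, e₂⟩ := e₁ ⟨c.1, hc₁⟩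
    exact ⟨W₂, h₂.trans i.le, hc₂, e₂⟩

/-- The presheaf of sections of `φ^*Θ_{𝔛/ℂ}`. -/
def pullbackPresheaf : TopCat.Presheaf AddCommGrpCat.{0} (TopCat.of C.Point) where
  obj W := AddCommGrpCat.of (sections φ W.unop)
  map i := AddCommGrpCat.ofHom
    { toFun := fun s => ⟨fun c => s.1 ⟨c.1, i.unop.le c.2⟩, (sectionPredicate φ).res i.unop s.1 s.2⟩
      map_zero' := rfl
      map_add' := fun _ _ => rfl }
  map_id _ := rfl
  map_comp _ _ := rfl

lemma pullbackPresheaf_isSheaf : (pullbackPresheaf φ).IsSheaf := by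
  rw [TopCat.Presheaf.isSheaf_iff_isSheaf_comp (forget AddCommGrpCat.{0})]
  exact TopCat.subpresheafToTypes.isSheaf (sectionPredicate φ)

/-- The sheaf `φ^*Θ_{𝔛/ℂ}` on `C`. -/
def pullbackSheaf : Sheaf (Opens.grothendieckTopology C.Point) AddCommGrpCat.{0} :=
  ⟨pullbackPresheaf φ, pullbackPresheaf_isSheaf φ⟩

/-- Multiplication by the complex number `a` on the sheaf `φ^*Θ_{𝔛/ℂ}`. -/
def scalar (a : ℂ) : pullbackSheaf φ ⟶ pullbackSheaf φ :=
  ⟨{ app := fun _ => AddCommGrpCat.ofHom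
      { toFun := fun s => ⟨fun c => constAlong φ a c.1 • s.1 c, IsSection.smul φ a s.2⟩
        map_zero' := Subtype.ext (funext fun _ => smul_zero _)
        map_add' := fun _ _ => Subtype.ext (funext fun _ => smul_add _ _ _) }
     naturality := fun _ _ _ => rfl }⟩

/-- `H^1(C, φ^*Θ_{𝔛/ℂ})`. -/
def PullbackH1 : Type := Sheaf.H (pullbackSheaf φ) 1

instance : AddCommGroup (PullbackH1 φ) := inferInstanceAs (AddCommGroup (Sheaf.H (pullbackSheaf φ) 1))

lemma scalar_add (a b : ℂ) : scalar φ (a + b) = scalar φ a + scalar φ b := by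
  apply Sheaf.hom_ext
  ext W s
  apply Subtype.ext
  funext c
  change constAlong φ (a + b) c.1 • s.1 c = constAlong φ a c.1 • s.1 c + constAlong φ b c.1 • s.1 c
  rw [constAlong_add, add_smul]

lemma scalar_mul (a b : ℂ) : scalar φ (a * b) = scalar φ b ≫ scalar φ a := by
  apply Sheaf.hom_ext
  ext W s
  apply Subtype.ext
  funext c
  change constAlong φ (a * b) c.1 • s.1 c = constAlong φ a c.1 • constAlong φ b c.1 • s.1 c
  rw [constAlong_mul, mul_smul]

lemma scalar_one : scalar φ 1 = 𝟙 _ := by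
  apply Sheaf.hom_ext
  ext W s
  apply Subtype.ext
  funext c
  change constAlong φ 1 c.1 • s.1 c = s.1 c
  rw [constAlong_one, one_smul]

/-- The complex vector space structure of `H^1(C, φ^*Θ_{𝔛/ℂ})`, induced by functoriality from the
one of the sheaf. -/
instance : Module ℂ (PullbackH1 φ) where
  smul a x := Sheaf.H.map (scalar φ a) 1 x
  smul_add a x y := map_add (Sheaf.H.map (scalar φ a) 1) x y
  smul_zero a := map_zero (Sheaf.H.map (scalar φ a) 1)
  add_smul a b x := by
    change Sheaf.H.map (scalar φ (a + b)) 1 x = _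
    rw [scalar_add]
    exact Sheaf.H.map_add_apply _ _ x
  zero_smul x := by
    have h : Sheaf.H.map (scalar φ (0 + 0)) 1 x
        = Sheaf.H.map (scalar φ 0) 1 x + Sheaf.H.map (scalar φ 0) 1 x := by
      rw [scalar_add]
      exact Sheaf.H.map_add_apply _ _ x
    rw [add_zero] at h
    exact left_eq_add.mp h
  mul_smul a b x := by
    change Sheaf.H.map (scalar φ (a * b)) 1 x = _
    rw [scalar_mul]
    exact Sheaf.H.map_comp_apply _ _ x
  one_smul x := by
    change Sheaf.H.map (scalar φ 1) 1 x = _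
    rw [scalar_one]
    exact Sheaf.H.map_id_apply x

end Pullback

/-! ## Pre-log curves -/

section PreLog

open PolyDecomp Total

variable {n : ℕ} {P : PolyDecomp n} {C : NodalCurve} (φ : Mor C.Point P.Total)

/-- `χ^m` is a local equation, in `X_v`, of the toric divisor which is the closure of the orbit of the
2-dimensional cone `τ ⊇ C({v})`: the element `m` generates the monoid `τ^∨ ∩ C({v})^⊥` modulo its
units `τ^⊥`. -/
def IsLocalEquation (v : Fin n → ℝ) (τ : Set ((Fin n → ℝ) × ℝ)) (m : Char n) : Prop :=
  m ∈ dualMonoid τ ∧ m ∈ perp (coneOver {v}) ∧ m ∉ perp τ ∧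
    ∀ m' ∈ dualMonoid τ, m' ∈ perp (coneOver {v}) → ∃ k : ℕ, m' - k • m ∈ perp τ

/-- At the point `p`, the restriction of `φ` to the component `i` (which is mapped to `X_v`) has
intersection multiplicity `w` with the toric divisor of `X_v` given by the cone `τ`. -/
def HasContact (i : C.Comp) (p : P1) (v : Fin n → ℝ) (τ : Set ((Fin n → ℝ) × ℝ)) (w : ℕ) : Prop :=
  ∃ m, IsLocalEquation v τ m ∧ HasOrderAt (fun q => monomial m (φ.toFun (C.pt i q))) p w

/-- The component `i` is mapped to `X_v`. -/
def MapsTo (i : C.Comp) (v : Fin n → ℝ) : Prop := ∀ p, φ.toFun (C.pt i p) ∈ component v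

/-- The map `φ` is constant on the component `i`. -/
def ConstantOn (i : C.Comp) : Prop := ∀ p q, φ.toFun (C.pt i p) = φ.toFun (C.pt i q)

/-- Pre-log curves `φ : C → X_0`. -/
structure IsPreLog : Prop where
  /-- The image lies in the central fibre. -/
  central : ∀ c, t (φ.toFun c) = 0
  /-- The map is stable: components on which it is constant have at least three branches of
  nodes. -/
  stable : ∀ i, ConstantOn φ i → 3 ≤ Nat.card {x : C.Node × Bool // (C.branch x.1 x.2).1 = i}
  /-- The restriction over `X_v` is generically mapped to the open orbit. -/
  dense : ∀ v ∈ P.vertices, φ.toFun ⁻¹' component v ⊆ closure (φ.toFun ⁻¹' interiorComponent v)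
  /-- The restriction over `X_v` avoids the toric strata of `X_v` of codimension at least two. -/
  transverse : ∀ v ∈ P.vertices, ∀ c, φ.toFun c ∈ component v →
    Module.finrank ℝ (Submodule.span ℝ (φ.toFun c).cone) ≤ 2
  /-- A point which is mapped to the singular locus of `X_0` (the points on at least two
  components) is a node; its branches are mapped to different components of `X_0`, with equal
  intersection multiplicities with the double locus. -/
  node : ∀ c, (∃ v ∈ P.vertices, ∃ v' ∈ P.vertices, v ≠ v' ∧ φ.toFun c ∈ component v ∧
      φ.toFun c ∈ component v') →
    ∃ ν, C.pt (C.branch ν false).1 (C.branch ν false).2 = c ∧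
      ∃ v ∈ P.vertices, ∃ v' ∈ P.vertices, v ≠ v' ∧
        MapsTo φ (C.branch ν false).1 v ∧ MapsTo φ (C.branch ν true).1 v' ∧
        ∃ w, HasContact φ (C.branch ν false).1 (C.branch ν false).2 v (φ.toFun c).cone w ∧
          HasContact φ (C.branch ν true).1 (C.branch ν true).2 v' (φ.toFun c).cone w

/-- The pre-log curve `φ` is of type `(Γ, h)`. The components of `C` correspond to the connected
components of the fibres of `h` over the vertices of `h(Γ)`, the nodes correspond to the bounded
edges which are not contracted, and `mark` gives the points of intersection with the toric divisors
of the components of `X_0`, which are indexed by the flags of edges which are not contracted. -/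
def IsOfType (T : TropicalCurve n) : Prop :=
  ∃ (comp : T.Cluster ≃ C.Comp) (node : T.EdgeNC ≃ C.Node) (swap : T.EdgeNC → Bool)
    (mark : T.FlagNC → P1),
    (∀ (e : T.EdgeNC) (b : Bool), C.branch (node e) (xor (swap e) b) =
      ⟨comp (T.cluster (T.ends e.1 b)), mark (Sum.inl (e, b))⟩) ∧
    (Function.Injective fun f : T.FlagNC => (comp (T.cluster (T.vertexNC f)), mark f)) ∧
    (∀ v : T.V, MapsTo φ (comp (T.cluster v)) (T.pos v) ∧
      ¬ ConstantOn φ (comp (T.cluster v)) ∧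
      ∀ p, φ.toFun (C.pt (comp (T.cluster v)) p) ∉ interiorComponent (T.pos v) →
        ∃ f, T.cluster (T.vertexNC f) = T.cluster v ∧ mark f = p) ∧
    ∀ f : T.FlagNC,
      φ.toFun (C.pt (comp (T.cluster (T.vertexNC f))) (mark f)) ∈
        orbitClosure (coneOver (T.image f)) ∧
      HasContact φ (comp (T.cluster (T.vertexNC f))) (mark f) (T.pos (T.vertexNC f))
        (coneOver (T.image f)) (T.weightNC f)

end PreLog

end TropDeg
end

noncomputable section

open Filter Topology TopologicalSpace CategoryTheory
open scoped TensorProduct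

/-! ### Short exact sequences of sheaves and lifting of sections -/

namespace TropDeg

/-! The sheaf `Θ` of relative logarithmic vector fields is free of rank `n`. A logarithmic
derivation `D` at a point is determined by the quotients `D χ^m / χ^m`, which are additive in `m`.
They extend from the monoid of regular monomials to the whole character lattice `M × ℤ`, and they
vanish on the character of `t`. So `D` amounts to `n` regular germs, its coefficients with respect
to the fields `χ^m ↦ m_j χ^m` (`exists_coordField_sum`, `logBasis`). The pull back along any
morphism `φ` therefore behaves like `n` copies of `𝒪_C`.

For such a sheaf the normalization sequence `0 → φ^*Θ → (functions on the normalization)ⁿ → ⊕_nodes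
ℂⁿ → 0` is exact (`normalizationSequence_shortExact`). The middle term has no first cohomology: by
partial fractions a regular function on `U ∩ V` in `ℙ¹` is a difference of regular functions on `U`
and on `V` (`exists_sub_of_isRegularAt`). On a compact space this makes global sections lift along
epimorphisms (`surjective_of_splitsOverlaps`), which kills `H¹` after embedding in an injective
sheaf (`subsingleton_H_one`). A global regular function on the normalization is constant on each
component, so `H¹(φ^*Θ)` is the cokernel of the coboundary map of the dual graph with coefficients
`ℂⁿ` (`ker_nodeConnecting`). The dual graph is connected, and the dimension is `n (#nodes -
#components + 1)`.

A section of `ω_C` is determined by its residues, because a form on `ℙ¹` with at most one simple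
pole is zero. By the residue theorem on `ℙ¹`, residues can be prescribed exactly when they sum to
zero on each component, that is when they form a cycle of the dual graph (`cyclesEquiv`). This gives
the dimension `#nodes - #components + 1`, without recourse to Serre duality.

Finally the dual graph is `Γ` with its contracted edges collapsed. These edges form a forest, so
collapsing them preserves the Euler characteristic, and `#nodes - #components + 1 = g`
(`Admissible.genus_add_card`). -/

open Opposite in
/-- A complex of abelian sheaves `F → G → H` which is exact on sections in the sense
`0 → F(U) → G(U) → H(U)`, and for which `G → H` is locally surjective, is short exact. -/
lemma shortExact_of_sections {X : TopCat.{0}} {S : ShortComplex (TopCat.Sheaf AddCommGrpCat.{0} X)}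
    (hinj : ∀ U : Opens X, Function.Injective (S.f.hom.app (op U)))
    (hker : ∀ (U : Opens X) (s : S.X₂.obj.obj (op U)), S.g.hom.app (op U) s = 0 →
      ∃ r, S.f.hom.app (op U) r = s)
    (hsurj : TopCat.Presheaf.IsLocallySurjective S.g.hom) : S.ShortExact where
  exact := by
    -- Exactness is tested on morphisms `A ⟶ X₂` killed by `g`. The lift of each section is unique
    -- by injectivity, hence additive and natural, so the lift exists on `A` itself without
    -- refinement.
    rw [ShortComplex.exact_iff_exact_up_to_refinements]
    intro A x hx
    have h0 : ∀ (U : (Opens X)ᵒᵖ) (a : A.obj.obj U), ∃ r, S.f.hom.app U r = x.hom.app U a := by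
      intro U a
      refine hker U.unop _ ?_
      have := congrArg (fun z : A ⟶ S.X₃ => z.hom.app U a) hx
      exact this
    choose r hr using h0
    have hr0 : ∀ U, r U 0 = 0 := fun U => hinj U.unop <| by
      rw [map_zero]
      exact (hr U 0).trans (map_zero _)
    have hradd : ∀ U a b, r U (a + b) = r U a + r U b := fun U a b => hinj U.unop <| by
      rw [map_add]
      exact (hr U (a + b)).trans ((map_add _ a b).trans (congrArg₂ _ (hr U a) (hr U b)).symm)
    have hrnat : ∀ U V (i : U ⟶ V) a, r V (A.obj.map i a) = S.X₁.obj.map i (r U a) :=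
      fun U V i a => hinj V.unop <| by
        refine (hr V _).trans ?_
        refine (NatTrans.naturality_apply x.hom i a).trans ?_
        refine (congrArg (S.X₂.obj.map i) (hr U a).symm).trans ?_
        exact (NatTrans.naturality_apply S.f.hom i (r U a)).symm
    let l : A ⟶ S.X₁ := ⟨⟨fun U => AddCommGrpCat.ofHom ⟨⟨r U, hr0 U⟩, hradd U⟩, fun U V i => by
      ext a
      exact hrnat U V i a⟩⟩
    refine ⟨A, 𝟙 A, inferInstance, l, (Category.id_comp x).trans ?_⟩
    apply Sheaf.hom_ext
    ext U a
    exact (hr U a).symm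
  mono_f := by
    have : ∀ U, Mono (S.f.hom.app U) := fun U =>
      (AddCommGrpCat.mono_iff_injective _).mpr (hinj U.unop)
    have : Mono S.f.hom := NatTrans.mono_of_mono_app _
    exact (sheafToPresheaf _ _).mono_of_mono_map this
  epi_g := (TopCat.Sheaf.isLocallySurjective_iff_epi S.g).mp hsurj

/-- Every section of `F` over `U ⊓ V` is the difference of sections over `U` and `V`. -/
def SplitsOverlaps {X : TopCat.{0}} (F : TopCat.Sheaf AddCommGrpCat.{0} X) : Prop :=
  ∀ (U V : Opens X) (s : F.obj.obj (.op (U ⊓ V))),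
    ∃ (a : F.obj.obj (.op U)) (b : F.obj.obj (.op V)),
      s = F.obj.map (homOfLE inf_le_left).op a - F.obj.map (homOfLE inf_le_right).op b

-- Over `U ⊓ V` the two lifts differ by a section of the kernel. Splitting it as `a - b` and
-- subtracting `a` from one lift and `b` from the other makes them agree there, so that they glue.
open Opposite in
lemma lift_sup {X : TopCat.{0}} {S : ShortComplex (TopCat.Sheaf AddCommGrpCat.{0} X)}
    (hS : S.ShortExact) (hF : SplitsOverlaps S.X₁) (s : S.X₃.obj.obj (op ⊤)) (U V : Opens X)
    (hU : ∃ r, S.g.hom.app (op U) r = S.X₃.obj.map (homOfLE le_top).op s)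
    (hV : ∃ r, S.g.hom.app (op V) r = S.X₃.obj.map (homOfLE le_top).op s) :
    ∃ r, S.g.hom.app (op (U ⊔ V)) r = S.X₃.obj.map (homOfLE le_top).op s := by
  obtain ⟨r, hr⟩ := hU
  obtain ⟨q, hq⟩ := hV
  have hcomp : ∀ (W : Opens X) (x : S.X₁.obj.obj (op W)),
      S.g.hom.app (op W) (S.f.hom.app (op W) x) = 0 := fun W x =>
    congrArg (fun z : S.X₁ ⟶ S.X₃ => z.hom.app (op W) x) S.zero
  have hres : ∀ (F : TopCat.Sheaf AddCommGrpCat.{0} X) {W W' W'' : Opens X} (i : W' ⟶ W)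
      (j : W'' ⟶ W') (x : F.obj.obj (op W)),
      F.obj.map j.op (F.obj.map i.op x) = F.obj.map (j ≫ i).op x := by
    intro F W W' W'' i j x
    rw [op_comp, Functor.map_comp_apply]
  obtain ⟨d, hd⟩ := TopCat.Sheaf.sections_exact_of_left_exact hS.exact hS.mono_f
    (U := U ⊓ V) (S.X₂.obj.map (homOfLE inf_le_left).op r -
      S.X₂.obj.map (homOfLE inf_le_right).op q) (by
      rw [map_sub, NatTrans.naturality_apply, NatTrans.naturality_apply, hr, hq, hres, hres]
      exact sub_self _)
  obtain ⟨a, b, hab⟩ := hF U V d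
  let f : Bool → Opens X := fun t => if t then U else V
  let sf : (i : Bool) → S.X₂.obj.obj (op (f i))
    | true => r - S.f.hom.app (op U) a
    | false => q - S.f.hom.app (op V) b
  have key : S.X₂.obj.map (homOfLE (inf_le_left : U ⊓ V ≤ U)).op (r - S.f.hom.app (op U) a) =
      S.X₂.obj.map (homOfLE (inf_le_right : U ⊓ V ≤ V)).op (q - S.f.hom.app (op V) b) := by
    rw [hab, map_sub, NatTrans.naturality_apply, NatTrans.naturality_apply] at hd
    rw [map_sub, map_sub]
    rw [sub_eq_sub_iff_sub_eq_sub]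
    exact hd.symm
  have hcompat : TopCat.Presheaf.IsCompatible S.X₂.obj f sf := by
    intro i j
    match i, j with
    | true, true => rfl
    | false, false => rfl
    | true, false => exact key
    | false, true =>
      have h2 := congrArg (S.X₂.obj.map (homOfLE (le_of_eq (inf_comm V U))).op) key
      rw [hres, hres] at h2
      exact h2.symm
  have hsup : U ⊔ V ≤ iSup f := sup_le (le_iSup f true) (le_iSup f false)
  obtain ⟨z, hz, -⟩ := S.X₂.existsUnique_gluing' f (U ⊔ V)
    (fun i => homOfLE (by cases i; exacts [le_sup_right, le_sup_left])) hsup sf hcompat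
  refine ⟨z, ?_⟩
  refine S.X₃.eq_of_locally_eq₂ (homOfLE (le_sup_left : U ≤ U ⊔ V))
    (homOfLE (le_sup_right : V ≤ U ⊔ V)) le_rfl _ _ ?_ ?_
  · rw [← NatTrans.naturality_apply, hres]
    erw [hz true]
    change S.g.hom.app (op U) (r - S.f.hom.app (op U) a) = _
    rw [map_sub, hcomp, sub_zero, hr]
    rfl
  · rw [← NatTrans.naturality_apply, hres]
    erw [hz false]
    change S.g.hom.app (op V) (q - S.f.hom.app (op V) b) = _
    rw [map_sub, hcomp, sub_zero, hq]
    rfl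

open Opposite in
/-- On a compact space, global sections lift along an epimorphism whose kernel splits overlaps. -/
lemma surjective_of_splitsOverlaps {X : TopCat.{0}} [CompactSpace X]
    {S : ShortComplex (TopCat.Sheaf AddCommGrpCat.{0} X)}
    (hS : S.ShortExact) (hF : SplitsOverlaps S.X₁) :
    Function.Surjective (S.g.hom.app (op ⊤)) := by
  intro s
  have hloc := (TopCat.Presheaf.isLocallySurjective_iff S.g.hom).mp
    ((TopCat.Sheaf.isLocallySurjective_iff_epi S.g).mpr hS.epi_g) ⊤ s
  -- Lifts exist locally because `g` is an epimorphism; compactness reduces the claim to unions of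
  -- two open sets.
  obtain ⟨U, hU, r, hr⟩ := (isCompact_univ (X := X)).induction_on
    (p := fun A => ∃ U : Opens X, A ⊆ U ∧
      ∃ r, S.g.hom.app (op U) r = S.X₃.obj.map (homOfLE le_top).op s)
    (by
      refine ⟨⊥, fun x hx => hx.elim, 0, ?_⟩
      refine S.X₃.eq_of_locally_eq' (fun i : Empty => i.elim) ⊥ (fun i => i.elim) bot_le _ _
        (fun i => i.elim))
    (fun A B hAB ⟨U, hU, h⟩ => ⟨U, hAB.trans hU, h⟩)
    (fun A B ⟨U, hU, h⟩ ⟨V, hV, h'⟩ => ⟨U ⊔ V, Set.union_subset_union hU hV,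
      lift_sup hS hF s U V h h'⟩)
    (by
      intro x _
      obtain ⟨V, hV, ⟨r, hr⟩, hx⟩ := hloc x trivial
      exact ⟨V, mem_nhdsWithin_of_mem_nhds (V.isOpen.mem_nhds hx), V, le_rfl, r, hr⟩)
  obtain rfl : U = ⊤ := top_unique (fun x _ => hU trivial)
  refine ⟨r, hr.trans ?_⟩
  have : (homOfLE (le_top : (⊤ : Opens X) ≤ ⊤)).op = 𝟙 _ := rfl
  rw [this, S.X₃.obj.map_id]
  rfl

/-! ### The connecting homomorphism and vanishing of the first cohomology -/

section Cohomology

open Opposite Abelian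

variable {X : TopCat.{0}}

variable {S : ShortComplex (Sheaf (Opens.grothendieckTopology X) AddCommGrpCat.{0})}

/-- The connecting homomorphism `H(⊤) → H¹(F)` of a short exact sequence `0 → F → G → H → 0`. -/
def connecting (hS : S.ShortExact) : S.X₃.obj.obj (op ⊤) →+ Sheaf.H S.X₁ 1 where
  toFun s :=
    ((Sheaf.H.equiv₀ S.X₃ (T := (⊤ : Opens X)) Limits.isTerminalTop).symm s).comp hS.extClass
      (zero_add 1)
  map_zero' := by rw [map_zero, Ext.zero_comp]
  map_add' s s' := by rw [map_add, Ext.add_comp]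

lemma connecting_apply (hS : S.ShortExact) (s : S.X₃.obj.obj (op ⊤)) :
    connecting hS s = ((Sheaf.H.equiv₀ S.X₃ (T := (⊤ : Opens X)) Limits.isTerminalTop).symm s).comp
      hS.extClass (zero_add 1) := rfl

/-- Exactness of the long Ext sequence at `H⁰` of the third term, where `Sheaf.H.equiv₀` identifies
`H⁰` with global sections. -/
lemma connecting_eq_zero_iff (hS : S.ShortExact) (s : S.X₃.obj.obj (op ⊤)) :
    connecting hS s = 0 ↔ ∃ r, S.g.hom.app (op ⊤) r = s := by
  constructor
  · intro h
    obtain ⟨x, hx⟩ := Ext.covariant_sequence_exact₃ _ hS _ (zero_add 1) h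
    refine ⟨Sheaf.H.equiv₀ S.X₂ Limits.isTerminalTop x, ?_⟩
    rw [Sheaf.H.equiv₀_naturality, Sheaf.H.map_apply]
    erw [hx]
    simp
  · rintro ⟨r, rfl⟩
    rw [connecting_apply, ← Sheaf.H.equiv₀_symm_naturality, Sheaf.H.map_apply]
    rw [Ext.comp_assoc_of_second_deg_zero, hS.comp_extClass, Ext.comp_zero]

lemma connecting_surjective (hS : S.ShortExact) (h : Subsingleton (Sheaf.H S.X₂ 1)) :
    Function.Surjective (connecting hS) := by
  intro x
  obtain ⟨y, hy⟩ := Ext.covariant_sequence_exact₁ _ hS x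
    (Subsingleton.elim (α := Sheaf.H S.X₂ 1) _ _) (zero_add 1)
  refine ⟨Sheaf.H.equiv₀ S.X₃ Limits.isTerminalTop y, ?_⟩
  rw [connecting_apply, AddEquiv.symm_apply_apply, hy]

/-- Applied to multiplication by scalars, this makes the connecting homomorphism `ℂ`-linear. -/
lemma connecting_naturality (hS : S.ShortExact) (α : S ⟶ S) (s : S.X₃.obj.obj (op ⊤)) :
    connecting hS (α.τ₃.hom.app (op ⊤) s) = Sheaf.H.map α.τ₁ 1 (connecting hS s) := by
  rw [connecting_apply, connecting_apply, ← Sheaf.H.equiv₀_symm_naturality, Sheaf.H.map_apply,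
    Sheaf.H.map_apply]
  rw [Ext.comp_assoc_of_second_deg_zero, Ext.comp_assoc_of_third_deg_zero,
    hS.extClass_naturality hS α]

/-- A sheaf on a compact space which splits overlaps has no first cohomology. -/
lemma subsingleton_H_one [CompactSpace X]
    (F : Sheaf (Opens.grothendieckTopology X) AddCommGrpCat.{0})
    (hF : SplitsOverlaps (X := X) F) : Subsingleton (Sheaf.H F 1) := by
  -- Dimension shifting: `F` is embedded in an injective sheaf, whose `H¹` vanishes, so every class
  -- of `H¹(F)` comes from a global section of the quotient, and that section lifts.
  let S : ShortComplex (Sheaf (Opens.grothendieckTopology X) AddCommGrpCat.{0}) :=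
    ShortComplex.mk (Injective.ι F) (Limits.cokernel.π (Injective.ι F)) (by simp)
  have hS : S.ShortExact :=
    { exact := ShortComplex.exact_cokernel _ }
  have h1 : Subsingleton (Sheaf.H S.X₂ 1) :=
    inferInstanceAs (Subsingleton (Sheaf.H (Injective.under F) (0 + 1)))
  refine subsingleton_of_forall_eq 0 fun x => ?_
  obtain ⟨s, rfl⟩ := connecting_surjective hS h1 x
  exact (connecting_eq_zero_iff hS s).mpr (surjective_of_splitsOverlaps (X := X) hS hF s)

end Cohomology

/-! ## Rational functions on the projective line -/

section RationalFunctions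

open Polynomial

lemma polynomial_eq_of_eventually {A B : ℂ[X]} (h : ∀ᶠ s in cofinite, A.eval s = B.eval s) :
    A = B :=
  Polynomial.eq_of_infinite_eval_eq A B (frequently_cofinite_iff_infinite.mp h.frequently)

lemma eventually_eval_ne_zero {B : ℂ[X]} (hB : B ≠ 0) : ∀ᶠ s in cofinite, B.eval s ≠ 0 := by
  rw [Filter.eventually_cofinite]
  simpa [Polynomial.IsRoot] using Polynomial.finite_setOfPred_isRoot hB

/-- The function `g` is near `0`, up to finitely many values, a rational function which is regular
at `0` with value `v`. -/
def RegZero (g : ℂ → ℂ) (v : ℂ) : Prop :=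
  ∃ A B : ℂ[X], B.eval 0 ≠ 0 ∧ v = A.eval 0 / B.eval 0 ∧
    ∀ᶠ s in cofinite, g s = A.eval s / B.eval s

lemma RegZero.congr {g g' : ℂ → ℂ} {v : ℂ} (h : RegZero g v) (e : ∀ᶠ s in cofinite, g s = g' s) :
    RegZero g' v := by
  obtain ⟨A, B, hB, hv, hg⟩ := h
  refine ⟨A, B, hB, hv, ?_⟩
  filter_upwards [hg, e] with s h1 h2
  rw [← h2, h1]

/-- If the quotient `N / M` is regular at `0` and the multiplicity of `0` as a root of `M` is not
compensated by `N`, then it is determined by cross multiplication. -/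
lemma RegZero.cross {g : ℂ → ℂ} {v : ℂ} {N M : ℂ[X]} (h : RegZero g v) (hM : M ≠ 0)
    (hg : ∀ᶠ s in cofinite, g s = N.eval s / M.eval s) : N.eval 0 = v * M.eval 0 := by
  obtain ⟨A, B, hB, hv, hg'⟩ := h
  have : N * B = A * M := by
    apply polynomial_eq_of_eventually
    filter_upwards [hg, hg', eventually_eval_ne hB, eventually_eval_ne_zero hM] with s h1 h2 h3 h4
    rw [h1, div_eq_div_iff h4 h3] at h2
    simpa using h2
  have := congrArg (Polynomial.eval 0) this
  simp only [eval_mul] at this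
  rw [hv]
  field_simp
  exact this

lemma RegZero.unique {g : ℂ → ℂ} {v w : ℂ} (h : RegZero g v) (h' : RegZero g w) : v = w := by
  obtain ⟨A, B, hB, hv, hg⟩ := h'
  have := h.cross (by rintro rfl; simp at hB) hg
  rw [hv, this]
  field_simp

lemma RegZero.of_div {g : ℂ → ℂ} {N M : ℂ[X]} (hM : M.eval 0 ≠ 0)
    (hg : ∀ᶠ s in cofinite, g s = N.eval s / M.eval s) : RegZero g (N.eval 0 / M.eval 0) :=
  ⟨N, M, hM, rfl, hg⟩

/-- Reversing coefficients is the substitution `z = 1 / s` cleared of denominators; it rewrites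
rational functions in the coordinate at infinity. -/
lemma eval_reflect_eq {A : ℂ[X]} {N : ℕ} (hN : A.natDegree ≤ N) {s : ℂ} (hs : s ≠ 0) :
    (A.reflect N).eval s = s ^ N * A.eval s⁻¹ := by
  have : Invertible s⁻¹ := invertibleOfNonzero (inv_ne_zero hs)
  have h := Polynomial.eval₂_reflect_mul_pow (RingHom.id ℂ) s⁻¹ N A hN
  rw [invOf_eq_inv, inv_inv] at h
  simp only [Polynomial.eval₂_id] at h
  rw [← h, mul_left_comm, ← mul_pow, mul_inv_cancel₀ hs, one_pow, mul_one]

lemma eval_zero_reflect (A : ℂ[X]) (N : ℕ) : (A.reflect N).eval 0 = A.coeff N := by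
  rw [← Polynomial.coeff_zero_eq_eval_zero, Polynomial.coeff_reflect, Polynomial.revAt_zero]

lemma eventually_ne_zero : ∀ᶠ s : ℂ in cofinite, s ≠ 0 := by
  simp [Filter.eventually_cofinite]

lemma reflect_ne_zero {A : ℂ[X]} (hA : A ≠ 0) (N : ℕ) : A.reflect N ≠ 0 := by
  rwa [Ne, Polynomial.reflect_eq_zero_iff]

/-- The finite points of the projective line. -/
def P1.fin (a : ℂ) : P1 := CofiniteTopology.of (a : OnePoint ℂ)

/-- The infinite point of the projective line. -/
def P1.inf : P1 := CofiniteTopology.of OnePoint.infty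

lemma P1.cases (p : P1) : p = P1.inf ∨ ∃ a, p = P1.fin a := by
  by_cases h : CofiniteTopology.of.symm p = OnePoint.infty
  · exact Or.inl (by rw [P1.inf, ← h]; rfl)
  · obtain ⟨a, ha⟩ := OnePoint.ne_infty_iff_exists.mp h
    exact Or.inr ⟨a, by rw [P1.fin, ha]; rfl⟩

lemma P1.fin_injective : Function.Injective P1.fin := fun _ _ h =>
  OnePoint.coe_injective (CofiniteTopology.of.injective h)

lemma P1.fin_ne_inf (a : ℂ) : P1.fin a ≠ P1.inf := fun h =>
  OnePoint.coe_ne_infty a (CofiniteTopology.of.injective h)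

lemma coord_fin (a s : ℂ) : coord (P1.fin a) s = P1.fin (a + s) := rfl

lemma coord_inf {s : ℂ} (hs : s ≠ 0) : coord P1.inf s = P1.fin s⁻¹ := by
  unfold coord P1.inf P1.fin
  simp [hs]

lemma coord_inf_zero : coord P1.inf 0 = P1.inf := by
  unfold coord P1.inf
  simp

/-- Lets conditions on almost all points of `ℙ¹` be read as conditions on almost all values of a
local coordinate. -/
lemma coord_injective (p : P1) : Function.Injective (coord p) := by
  rcases P1.cases p with rfl | ⟨a, rfl⟩
  · intro s t h
    by_cases hs : s = 0 <;> by_cases ht : t = 0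
    · rw [hs, ht]
    · subst hs; rw [coord_inf_zero, coord_inf ht] at h; exact (P1.fin_ne_inf _ h.symm).elim
    · subst ht; rw [coord_inf_zero, coord_inf hs] at h; exact (P1.fin_ne_inf _ h).elim
    · rw [coord_inf hs, coord_inf ht] at h
      exact inv_injective (P1.fin_injective h)
  · intro s t h
    exact add_right_injective a (P1.fin_injective h)

lemma isRegularAt_iff {f : P1 → ℂ} {p : P1} :
    IsRegularAt f p ↔ RegZero (fun s => f (coord p s)) (f p) := Iff.rfl

lemma IsRegularAt.congr {f g : P1 → ℂ} {p : P1} (hf : IsRegularAt f p) (hp : f p = g p)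
    (h : ∀ᶠ q in cofinite, f q = g q) : IsRegularAt g p := by
  rw [isRegularAt_iff, ← hp]
  exact RegZero.congr hf ((coord_injective p).tendsto_cofinite.eventually h)

/-- The identity principle: the value of a regular function at a point is forced by its values at
almost all other points. -/
lemma IsRegularAt.eq_of_eventually {f g : P1 → ℂ} {p : P1} (hf : IsRegularAt f p)
    (hg : IsRegularAt g p) (h : ∀ᶠ q in cofinite, f q = g q) : f p = g p :=
  (RegZero.congr hf ((coord_injective p).tendsto_cofinite.eventually h)).unique hg

lemma isRegularAt_const (c : ℂ) (p : P1) : IsRegularAt (fun _ => c) p :=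
  ⟨Polynomial.C c, 1, by simp, by simp, by simp⟩

lemma IsRegularAt.neg {f : P1 → ℂ} {p : P1} (hf : IsRegularAt f p) : IsRegularAt (-f) p := by
  have := (isRegularAt_const (-1) p).mul hf
  convert this using 1
  ext q
  simp

lemma eventually_P1_iff {Q : P1 → Prop} :
    (∀ᶠ q in cofinite, Q q) ↔ ∀ᶠ z in cofinite, Q (P1.fin z) := by
  refine ⟨fun h => P1.fin_injective.tendsto_cofinite.eventually h, fun h => ?_⟩
  rw [Filter.eventually_cofinite] at h ⊢
  refine ((h.image P1.fin).insert P1.inf).subset fun q hq => ?_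
  rcases P1.cases q with rfl | ⟨a, rfl⟩
  · exact Or.inl rfl
  · exact Or.inr ⟨a, hq, rfl⟩

/-- A function which is regular somewhere is a rational function. -/
lemma IsRegularAt.exists_rational {f : P1 → ℂ} {p : P1} (hf : IsRegularAt f p) :
    ∃ A B : ℂ[X], B.Monic ∧ IsCoprime A B ∧
      ∀ᶠ z in cofinite, f (P1.fin z) = A.eval z / B.eval z := by
  have key : ∃ A B : ℂ[X], B ≠ 0 ∧ ∀ᶠ z in cofinite, f (P1.fin z) = A.eval z / B.eval z := by
    obtain ⟨A, B, hB, -, h⟩ := hf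
    have hB0 : B ≠ 0 := by rintro rfl; simp at hB
    rcases P1.cases p with rfl | ⟨a, rfl⟩
    -- Both polynomials are reflected in the same degree, so that the powers of `z` cancel in the
    -- quotient.
    · refine ⟨A.reflect (max A.natDegree B.natDegree), B.reflect (max A.natDegree B.natDegree),
        reflect_ne_zero hB0 _, ?_⟩
      have h' := (inv_injective (G := ℂ)).tendsto_cofinite.eventually h
      filter_upwards [h', eventually_ne_zero] with z hz hz0
      rw [coord_inf (inv_ne_zero hz0), inv_inv] at hz
      rw [hz, eval_reflect_eq (le_max_left _ _) hz0, eval_reflect_eq (le_max_right _ _) hz0]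
      field_simp
    · refine ⟨A.comp (X - C a), B.comp (X - C a), ?_, ?_⟩
      · intro h0
        apply hB
        have := congrArg (Polynomial.eval a) h0
        simpa using this
      · have h' := (sub_left_injective (b := a)).tendsto_cofinite.eventually h
        filter_upwards [h'] with z hz
        rw [coord_fin] at hz
        simpa using hz
  obtain ⟨A, B, hB, h⟩ := key
  -- Reduction to lowest terms, followed by division by the leading coefficient of the denominator.
  obtain ⟨A', ha⟩ := gcd_dvd_left A B
  obtain ⟨B', hb⟩ := gcd_dvd_right A B
  have hcop : IsCoprime A' B' := by
    have hd : gcd A B ≠ 0 := fun h0 => hB (by rw [hb, h0, zero_mul])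
    obtain ⟨u, v, huv⟩ := (gcd_isUnit_iff A' B').mp (by
      have := gcd_mul_left (gcd A B) A' B'
      rw [← ha, ← hb, normalize_gcd] at this
      have h1 : gcd A B * 1 = gcd A B * gcd A' B' := by rw [mul_one]; exact this
      rw [← mul_left_cancel₀ hd h1]
      exact isUnit_one)
    exact ⟨u, v, huv⟩
  have hB' : B' ≠ 0 := fun h0 => hB (by rw [hb, h0, mul_zero])
  have hl : B'.leadingCoeff⁻¹ ≠ 0 := inv_ne_zero (leadingCoeff_ne_zero.mpr hB')
  have hu : IsUnit (C B'.leadingCoeff⁻¹) := isUnit_C.mpr hl.isUnit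
  refine ⟨A' * C B'.leadingCoeff⁻¹, B' * C B'.leadingCoeff⁻¹, monic_mul_leadingCoeff_inv hB', ?_, ?_⟩
  · exact (isCoprime_mul_unit_right hu A' B').mpr hcop
  · filter_upwards [h, eventually_eval_ne_zero hB] with z hz hz0
    have e : B.eval z = (gcd A B).eval z * B'.eval z := by
      conv_lhs => rw [hb]
      rw [eval_mul]
    have e' : A.eval z = (gcd A B).eval z * A'.eval z := by
      conv_lhs => rw [ha]
      rw [eval_mul]
    rw [e] at hz0
    rw [hz, e, e', eval_mul, eval_mul, eval_C, mul_div_mul_left _ _ (left_ne_zero_of_mul hz0),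
      mul_div_mul_right _ _ hl]

/-- The denominator of a rational function does not vanish at a finite point of regularity. -/
lemma IsRegularAt.denom_ne_zero {f : P1 → ℂ} {a : ℂ} (hf : IsRegularAt f (P1.fin a)) {A B : ℂ[X]}
    (hB : B ≠ 0) (hcop : IsCoprime A B)
    (h : ∀ᶠ z in cofinite, f (P1.fin z) = A.eval z / B.eval z) : B.eval a ≠ 0 := by
  intro h0
  have hc : B.comp (X + C a) ≠ 0 := by
    intro h1
    obtain ⟨b, hb⟩ := (eventually_eval_ne_zero hB).exists
    exact hb (by simpa using congrArg (Polynomial.eval (b - a)) h1)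
  -- Cross multiplication at `a` gives `A(a) = f(a) * B(a) = 0`, so `A` and `B` would have a common
  -- root.
  have := RegZero.cross (N := A.comp (X + C a)) hf hc (by
    have h' := (add_right_injective a).tendsto_cofinite.eventually h
    filter_upwards [h'] with s hs
    rw [coord_fin, hs]
    simp [add_comm])
  simp only [eval_comp, eval_add, eval_X, eval_C, zero_add, h0, mul_zero] at this
  obtain ⟨u, v, huv⟩ := hcop
  have h2 := congrArg (Polynomial.eval a) huv
  rw [eval_add, eval_mul, eval_mul, this, h0] at h2
  simp at h2

/-- The degree of a rational function which is regular at infinity is at most zero. -/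
lemma IsRegularAt.natDegree_le {f : P1 → ℂ} (hf : IsRegularAt f P1.inf) {A B : ℂ[X]}
    (hB : B ≠ 0) (h : ∀ᶠ z in cofinite, f (P1.fin z) = A.eval z / B.eval z) :
    A.natDegree ≤ B.natDegree := by
  by_contra! hlt
  -- Both sides are reflected in the degree of `A`, which exceeds that of `B`. At `s = 0` the
  -- numerator becomes the leading coefficient of `A` and the denominator becomes `0`, so that `A =
  -- 0`.
  have := RegZero.cross (N := A.reflect A.natDegree) hf (reflect_ne_zero hB A.natDegree) (by
    have h' := (inv_injective (G := ℂ)).tendsto_cofinite.eventually h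
    filter_upwards [h', eventually_ne_zero] with s hs hs0
    rw [coord_inf hs0, hs, eval_reflect_eq le_rfl hs0, eval_reflect_eq hlt.le hs0]
    field_simp)
  rw [eval_zero_reflect, eval_zero_reflect, coeff_eq_zero_of_natDegree_lt hlt, mul_zero] at this
  have hA : A = 0 := leadingCoeff_eq_zero.mp this
  simp [hA] at hlt

/-- The function on the projective line given by the rational function `A / B`. -/
def ratFn (A B : ℂ[X]) (p : P1) : ℂ :=
  (CofiniteTopology.of.symm p).elim (A.coeff B.natDegree / B.leadingCoeff)
    (fun z => A.eval z / B.eval z)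

lemma ratFn_fin (A B : ℂ[X]) (z : ℂ) : ratFn A B (P1.fin z) = A.eval z / B.eval z := rfl

lemma ratFn_inf (A B : ℂ[X]) : ratFn A B P1.inf = A.coeff B.natDegree / B.leadingCoeff := rfl

lemma isRegularAt_ratFn_fin {A B : ℂ[X]} {a : ℂ} (h : B.eval a ≠ 0) :
    IsRegularAt (ratFn A B) (P1.fin a) := by
  refine ⟨A.comp (X + C a), B.comp (X + C a), by simpa using h, by simp [ratFn_fin], ?_⟩
  refine Eventually.of_forall fun s => ?_
  rw [coord_fin, ratFn_fin]
  simp [add_comm]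

/-- Reflecting both polynomials in the degree of `B` turns the denominator at `s = 0` into the
leading coefficient of `B`, and the numerator into the coefficient of `A` of that degree, which is
the value given to `ratFn` at infinity. -/
lemma isRegularAt_ratFn_inf {A B : ℂ[X]} (hB : B ≠ 0) (h : A.natDegree ≤ B.natDegree) :
    IsRegularAt (ratFn A B) P1.inf := by
  refine ⟨A.reflect B.natDegree, B.reflect B.natDegree, ?_, ?_, ?_⟩
  · rw [eval_zero_reflect]
    exact leadingCoeff_ne_zero.mpr hB
  · rw [eval_zero_reflect, eval_zero_reflect, ratFn_inf]
    rfl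
  · filter_upwards [eventually_ne_zero] with s hs
    rw [coord_inf hs, ratFn_fin, eval_reflect_eq h hs, eval_reflect_eq le_rfl hs]
    field_simp

/-- A regular function on the projective line is constant. -/
lemma eq_of_isRegularAt {f : P1 → ℂ} (hf : ∀ p, IsRegularAt f p) (p q : P1) : f p = f q := by
  obtain ⟨A, B, hB, hcop, h⟩ := (hf P1.inf).exists_rational
  -- A root of `B` would be a finite pole. What remains is a polynomial, and regularity at infinity
  -- bounds its degree by `0`.
  have hB1 : B = 1 := by
    refine eq_one_of_monic_natDegree_zero hB ?_
    by_contra h0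
    obtain ⟨a, ha⟩ := IsAlgClosed.exists_root B (fun h1 => h0 (natDegree_eq_of_degree_eq_some h1))
    exact (hf (P1.fin a)).denom_ne_zero hB.ne_zero hcop h ha
  have hA := (hf P1.inf).natDegree_le hB.ne_zero h
  rw [hB1, natDegree_one, Nat.le_zero] at hA
  have key : ∀ p, f p = A.coeff 0 := fun p => by
    refine (hf p).eq_of_eventually (isRegularAt_const _ p) (eventually_P1_iff.mpr ?_)
    filter_upwards [h] with z hz
    rw [hz, hB1, eq_C_of_natDegree_eq_zero hA]
    simp
  rw [key, key]

/-- Splitting a monic polynomial according to the position of its roots. -/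
lemma exists_factorization {B : ℂ[X]} (hB : B.Monic) (S : Set ℂ) :
    ∃ B₁ B₂ : ℂ[X], B₁.Monic ∧ B₂.Monic ∧ IsCoprime B₁ B₂ ∧ B = B₁ * B₂ ∧
      (∀ z, B₁.eval z = 0 → z ∈ S) ∧ ∀ z, B₂.eval z = 0 → z ∉ S := by
  classical
  have hprod : ∀ m : Multiset ℂ, ∀ z, ((m.map fun a => X - C a).prod).eval z = 0 → z ∈ m := by
    intro m z hz
    rw [eval_multiset_prod, Multiset.prod_eq_zero_iff, Multiset.map_map] at hz
    obtain ⟨a, ha, h⟩ := Multiset.mem_map.mp hz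
    simp only [Function.comp_apply, eval_sub, eval_X, eval_C, sub_eq_zero] at h
    rwa [h]
  refine ⟨((B.roots.filter (· ∈ S)).map fun a => X - C a).prod,
    ((B.roots.filter (¬ · ∈ S)).map fun a => X - C a).prod,
    monic_multiset_prod_of_monic _ _ fun a _ => monic_X_sub_C a,
    monic_multiset_prod_of_monic _ _ fun a _ => monic_X_sub_C a, ?_, ?_, ?_, ?_⟩
  · rw [Polynomial.isCoprime_iff_aeval_ne_zero_of_isAlgClosed ℂ ℂ]
    intro z
    by_contra! h
    simp only [coe_aeval_eq_eval] at h
    exact (Multiset.mem_filter.mp (hprod _ _ h.2)).2 (Multiset.mem_filter.mp (hprod _ _ h.1)).2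
  · rw [← Multiset.prod_add, ← Multiset.map_add, Multiset.filter_add_not]
    exact (IsAlgClosed.splits B).eq_prod_roots_of_monic hB
  · exact fun z hz => (Multiset.mem_filter.mp (hprod _ _ hz)).2
  · exact fun z hz => (Multiset.mem_filter.mp (hprod _ _ hz)).2

/-- A regular function on `U ∩ V` is a difference of regular functions on `U` and on `V`. -/
lemma exists_sub_of_isRegularAt {U V : Set P1} {p₀ : P1} (h₀ : p₀ ∈ U ∩ V) {f : P1 → ℂ}
    (hf : ∀ p ∈ U ∩ V, IsRegularAt f p) :
    ∃ a b : P1 → ℂ, (∀ p ∈ U, IsRegularAt a p) ∧ (∀ p ∈ V, IsRegularAt b p) ∧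
      ∀ p ∈ U ∩ V, f p = a p - b p := by
  obtain ⟨A, B, hB, hcop, h⟩ := (hf p₀ h₀).exists_rational
  -- `B₁` collects the finite poles outside `U`. Those of `B₂` lie in `U`, hence outside `V`, since
  -- `f` is regular on `U ∩ V`.
  obtain ⟨B₁, B₂, hB₁, hB₂, hcop', hBB, hr₁, hr₂⟩ := exists_factorization hB {z | P1.fin z ∉ U}
  obtain ⟨q, r₁, r₂, hd₁, hd₂, he⟩ :=
    Polynomial.div_eq_quo_add_rem_div_add_rem_div (RatFunc ℂ) A hB₁ hB₂ hcop'
  have hpoly : A = q * B + r₁ * B₂ + r₂ * B₁ := by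
    have i : Function.Injective (algebraMap ℂ[X] (RatFunc ℂ)) := RatFunc.algebraMap_injective ℂ
    have n1 : algebraMap ℂ[X] (RatFunc ℂ) B₁ ≠ 0 := by simpa using hB₁.ne_zero
    have n2 : algebraMap ℂ[X] (RatFunc ℂ) B₂ ≠ 0 := by simpa using hB₂.ne_zero
    apply i
    rw [div_eq_iff (mul_ne_zero n1 n2)] at he
    refine he.trans ?_
    change (algebraMap ℂ[X] (RatFunc ℂ) q + algebraMap ℂ[X] (RatFunc ℂ) r₁ /
      algebraMap ℂ[X] (RatFunc ℂ) B₁ + algebraMap ℂ[X] (RatFunc ℂ) r₂ /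
      algebraMap ℂ[X] (RatFunc ℂ) B₂) * _ = _
    rw [hBB]
    simp only [map_add, map_mul]
    field_simp
  have hV₂ : ∀ z, P1.fin z ∈ V → B₂.eval z ≠ 0 := by
    intro z hz h0
    have hzU : P1.fin z ∈ U := not_not.mp (hr₂ z h0)
    exact (hf _ ⟨hzU, hz⟩).denom_ne_zero hB.ne_zero hcop h (by simp [hBB, h0])
  have hU₁ : ∀ z, P1.fin z ∈ U → B₁.eval z ≠ 0 := fun z hz h0 => hr₁ z h0 hz
  have hn₁ : r₁.natDegree ≤ B₁.natDegree := natDegree_le_natDegree hd₁.le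
  have hn₂ : r₂.natDegree ≤ B₂.natDegree := natDegree_le_natDegree hd₂.le
  -- By the identity principle it suffices to compare `f` with `a - b` at almost all finite points.
  have main : ∀ a b : P1 → ℂ, (∀ p ∈ U, IsRegularAt a p) → (∀ p ∈ V, IsRegularAt b p) →
      (∀ᶠ z in cofinite, A.eval z / B.eval z = a (P1.fin z) - b (P1.fin z)) →
      ∀ p ∈ U ∩ V, f p = a p - b p := by
    intro a b ha hb hab p hp
    have hreg : IsRegularAt (a + -b) p := (ha p hp.1).add (hb p hp.2).neg
    have := (hf p hp).eq_of_eventually hreg (eventually_P1_iff.mpr (by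
      filter_upwards [h, hab] with z h1 h2
      rw [h1, h2]
      simp [sub_eq_add_neg]))
    rw [this]
    simp [sub_eq_add_neg]
  have hne : ∀ᶠ z in cofinite, B₁.eval z ≠ 0 ∧ B₂.eval z ≠ 0 :=
    (eventually_eval_ne_zero hB₁.ne_zero).and (eventually_eval_ne_zero hB₂.ne_zero)
  have heval : ∀ z, A.eval z = q.eval z * (B₁.eval z * B₂.eval z) + r₁.eval z * B₂.eval z +
      r₂.eval z * B₁.eval z := by
    intro z
    conv_lhs => rw [hpoly, hBB]
    simp
  -- The fraction with denominator `B₁` goes to `a` and the one with `B₂` to `b`. The polynomial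
  -- part `q` may have a pole at infinity: it goes to `b` if `V` misses infinity, and to `a`
  -- otherwise.
  by_cases hV : P1.inf ∈ V
  · have ha : ∀ p ∈ U, IsRegularAt (ratFn (q * B₁ + r₁) B₁) p := by
      intro p hp
      rcases P1.cases p with rfl | ⟨z, rfl⟩
      · refine isRegularAt_ratFn_inf hB₁.ne_zero (natDegree_add_le_of_degree_le ?_ hn₁)
        have hA := (hf _ ⟨hp, hV⟩).natDegree_le hB.ne_zero h
        -- Here infinity lies in `U ∩ V`, so `f` is regular there and `deg A ≤ deg B`. The remainder
        -- terms have degree below `deg B`, so a nonzero `q` has `deg A = deg q + deg B`, which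
        -- leaves only constants.
        have hq : q.natDegree = 0 := by
          by_contra hq0
          have hq1 : q ≠ 0 := by rintro rfl; simp at hq0
          have hdeg : (r₁ * B₂ + r₂ * B₁).degree < (q * B).degree := by
            have hBd : B.degree ≤ (q * B).degree := degree_le_mul_left B hq1 |>.trans_eq (by rw [mul_comm])
            refine lt_of_lt_of_le ?_ hBd
            rw [hBB]
            refine (degree_add_le _ _).trans_lt (max_lt ?_ ?_)
            · rw [degree_mul, degree_mul]
              exact WithBot.add_lt_add_right (degree_ne_bot.mpr hB₂.ne_zero) hd₁
            · rw [degree_mul, degree_mul, add_comm]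
              exact WithBot.add_lt_add_left (degree_ne_bot.mpr hB₁.ne_zero) hd₂
          have : A.natDegree = (q * B).natDegree := by
            rw [hpoly, add_assoc]
            exact natDegree_add_eq_left_of_degree_lt hdeg
          rw [this, natDegree_mul hq1 hB.ne_zero] at hA
          omega
        refine natDegree_mul_le.trans ?_
        omega
      · exact isRegularAt_ratFn_fin (hU₁ z hp)
    have hb : ∀ p ∈ V, IsRegularAt (ratFn (-r₂) B₂) p := by
      intro p hp
      rcases P1.cases p with rfl | ⟨z, rfl⟩
      · exact isRegularAt_ratFn_inf hB₂.ne_zero (by rwa [natDegree_neg])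
      · exact isRegularAt_ratFn_fin (hV₂ z hp)
    refine ⟨_, _, ha, hb, main _ _ ha hb ?_⟩
    filter_upwards [hne] with z hz
    obtain ⟨h1, h2⟩ := hz
    rw [ratFn_fin, ratFn_fin, heval, hBB]
    simp only [eval_mul, eval_add, eval_neg]
    field_simp
    ring
  · have ha : ∀ p ∈ U, IsRegularAt (ratFn r₁ B₁) p := by
      intro p hp
      rcases P1.cases p with rfl | ⟨z, rfl⟩
      · exact isRegularAt_ratFn_inf hB₁.ne_zero hn₁
      · exact isRegularAt_ratFn_fin (hU₁ z hp)
    have hb : ∀ p ∈ V, IsRegularAt (ratFn (-(q * B₂ + r₂)) B₂) p := by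
      intro p hp
      rcases P1.cases p with rfl | ⟨z, rfl⟩
      · exact absurd hp hV
      · exact isRegularAt_ratFn_fin (hV₂ z hp)
    refine ⟨_, _, ha, hb, main _ _ ha hb ?_⟩
    filter_upwards [hne] with z hz
    obtain ⟨h1, h2⟩ := hz
    rw [ratFn_fin, ratFn_fin, heval, hBB]
    simp only [eval_mul, eval_add, eval_neg]
    field_simp
    ring

/-- Interpolation at finitely many points by functions with only one pole. -/
lemma exists_interpolation (D : Finset P1) :
    ∃ a : ℂ, P1.fin a ∉ D ∧ ∀ y : P1 → ℂ, ∃ f : P1 → ℂ,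
      (∀ p, p ≠ P1.fin a → IsRegularAt f p) ∧ ∀ p ∈ D, f p = y p := by
  classical
  let E : Finset ℂ := D.preimage P1.fin P1.fin_injective.injOn
  obtain ⟨a, ha⟩ := Infinite.exists_notMem_finset E
  refine ⟨a, fun h => ha (Finset.mem_preimage.mpr h), fun y => ?_⟩
  -- All poles are concentrated at `a`, with order the number of finite nodes. The product `M` has
  -- the same degree as `B` and vanishes at those nodes, so its coefficient controls the value at
  -- infinity alone; the interpolating polynomial `I` has smaller degree and controls the nodes
  -- alone.
  let B : ℂ[X] := (X - C a) ^ E.card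
  have hB : B.Monic := (monic_X_sub_C a).pow _
  have hBd : B.natDegree = E.card := by simp [B]
  let M : ℂ[X] := ∏ z ∈ E, (X - C z)
  have hM : M.Monic := monic_prod_of_monic _ _ fun z _ => monic_X_sub_C z
  have hMd : M.natDegree = E.card := by
    rw [natDegree_prod_of_monic _ _ fun z _ => monic_X_sub_C z]
    simp
  let I : ℂ[X] := Lagrange.interpolate E id fun z => y (P1.fin z) * B.eval z
  have hI : I.degree < E.card := Lagrange.degree_interpolate_lt _ Function.injective_id.injOn
  let A : ℂ[X] := C (y P1.inf) * M + I
  refine ⟨ratFn A B, ?_, ?_⟩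
  · intro p hp
    rcases P1.cases p with rfl | ⟨z, rfl⟩
    · refine isRegularAt_ratFn_inf hB.ne_zero (natDegree_add_le_of_degree_le ?_ ?_)
      · refine (natDegree_C_mul_le _ _).trans ?_
        rw [hMd, hBd]
      · rw [hBd]
        exact natDegree_le_of_degree_le hI.le
    · refine isRegularAt_ratFn_fin ?_
      simp only [B, eval_pow, eval_sub, eval_X, eval_C]
      exact pow_ne_zero _ (sub_ne_zero.mpr fun h => hp (by rw [h]))
  · intro p hp
    rcases P1.cases p with rfl | ⟨z, rfl⟩
    · rw [ratFn_inf, hB.leadingCoeff, div_one, hBd, coeff_add, coeff_C_mul,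
        coeff_eq_zero_of_degree_lt hI, ← hMd]
      have : M.coeff M.natDegree = 1 := hM
      rw [this]
      ring
    · have hz : z ∈ E := Finset.mem_preimage.mpr hp
      have hBz : B.eval z ≠ 0 := by
        simp only [B, eval_pow, eval_sub, eval_X, eval_C]
        exact pow_ne_zero _ (sub_ne_zero.mpr fun h => ha (h ▸ hz))
      have hMz : M.eval z = 0 := by
        simp only [M, eval_prod]
        exact Finset.prod_eq_zero hz (by simp)
      have hIz : I.eval z = y (P1.fin z) * B.eval z :=
        Lagrange.eval_interpolate_at_node _ Function.injective_id.injOn hz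
      rw [ratFn_fin, eval_add, eval_mul, hMz, mul_zero, zero_add, hIz, mul_div_cancel_right₀ _ hBz]

end RationalFunctions

/-! ## Sheaves of functions along a map -/

/-- A local condition on functions on `Y` with values in the vector space `A`, over the open
subsets of `X`. -/
structure LocalFunctions {X Y : Type} [TopologicalSpace X] (π : Y → X) (A : Type) [AddCommGroup A]
    [Module ℂ A] where
  sec : (W : Opens X) → Submodule ℂ ({y // π y ∈ W} → A)
  res : ∀ {W W' : Opens X} (h : W' ≤ W) {f : {y // π y ∈ W} → A}, f ∈ sec W →
    (fun y => f ⟨y.1, h y.2⟩) ∈ sec W'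
  isLocal : ∀ {W : Opens X} {f : {y // π y ∈ W} → A}, (∀ x ∈ W, ∃ (W' : Opens X) (h : W' ≤ W),
    x ∈ W' ∧ (fun y : {y // π y ∈ W'} => f ⟨y.1, h y.2⟩) ∈ sec W') → f ∈ sec W

namespace LocalFunctions

variable {X Y : Type} [TopologicalSpace X] {π : Y → X} {A : Type} [AddCommGroup A] [Module ℂ A]
  (K : LocalFunctions π A)

/-- The presheaf of functions satisfying the local condition. -/
def presheaf : TopCat.Presheaf AddCommGrpCat.{0} (TopCat.of X) where
  obj W := AddCommGrpCat.of (K.sec W.unop)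
  map i := AddCommGrpCat.ofHom
    { toFun := fun f => ⟨fun y => f.1 ⟨y.1, i.unop.le y.2⟩, K.res i.unop.le f.2⟩
      map_zero' := rfl
      map_add' := fun _ _ => rfl }
  map_id _ := rfl
  map_comp _ _ := rfl

/-- Functions on the preimages glue pointwise, and `isLocal` keeps the glued function in `sec`.
Allowing a map `π` treats direct images from the normalization and from the set of nodes at once. -/
lemma presheaf_isSheaf : K.presheaf.IsSheaf := by
  rw [TopCat.Presheaf.isSheaf_iff_isSheaf_comp (forget AddCommGrpCat.{0})]
  apply TopCat.Presheaf.isSheaf_of_isSheafUniqueGluing_types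
  intro ι U sf hsf
  have hsf' : ∀ i j (y : Y) (hi : π y ∈ U i) (hj : π y ∈ U j),
      (sf i : K.sec (U i)).1 ⟨y, hi⟩ = (sf j : K.sec (U j)).1 ⟨y, hj⟩ := by
    intro i j y hi hj
    exact congrFun (congrArg Subtype.val (hsf i j)) ⟨y, ⟨hi, hj⟩⟩
  have hex : ∀ y : {y // π y ∈ iSup U}, ∃ i, π y.1 ∈ U i := fun y => Opens.mem_iSup.mp y.2
  choose i hi using hex
  let f : {y // π y ∈ iSup U} → A := fun y => (sf (i y) : K.sec (U (i y))).1 ⟨y.1, hi y⟩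
  have hf : f ∈ K.sec (iSup U) := by
    refine K.isLocal fun x hx => ?_
    obtain ⟨j, hj⟩ := Opens.mem_iSup.mp hx
    refine ⟨U j, le_iSup U j, hj, ?_⟩
    convert (sf j : K.sec (U j)).2 using 1
    funext y
    exact hsf' _ _ _ _ _
  refine ⟨(⟨f, hf⟩ : K.sec (iSup U)), ?_, ?_⟩
  · intro j
    apply Subtype.ext
    funext y
    exact hsf' _ _ _ _ _
  · intro g hg
    apply Subtype.ext
    funext y
    exact congrFun (congrArg Subtype.val (hg (i y))) ⟨y.1, hi y⟩

/-- The sheaf of functions satisfying the local condition. -/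
def sheaf : Sheaf (Opens.grothendieckTopology X) AddCommGrpCat.{0} :=
  ⟨K.presheaf, K.presheaf_isSheaf⟩

/-- Multiplication by a complex number. -/
def scalar (a : ℂ) : K.sheaf ⟶ K.sheaf :=
  ⟨{ app := fun W => AddCommGrpCat.ofHom
      { toFun := fun s => (⟨a • s.1, (K.sec W.unop).smul_mem a s.2⟩ : K.sec W.unop)
        map_zero' := Subtype.ext (smul_zero _)
        map_add' := fun _ _ => Subtype.ext (smul_add _ _ _) }
     naturality := fun _ _ _ => rfl }⟩

end LocalFunctions

/-! ## The normalization of a nodal curve -/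

namespace NodalCurve

variable (C : NodalCurve)

/-- The normalization. -/
abbrev Norm : Type := Σ _ : C.Comp, P1

/-- The normalization map. -/
def proj (x : C.Norm) : C.Point := Quot.mk _ x

lemma continuous_proj : Continuous C.proj := continuous_quot_mk

lemma proj_surjective : Function.Surjective C.proj := Quot.mk_surjective

instance : CompactSpace C.Point := inferInstanceAs (CompactSpace (Quot _))

lemma proj_branch (ν : C.Node) : C.proj (C.branch ν false) = C.proj (C.branch ν true) :=
  Quot.sound ⟨ν, rfl, rfl⟩

open Classical in
/-- The fibre of the normalization over a point which is not a node is a single point. -/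
lemma eq_of_proj_eq {x y : C.Norm} (hx : ∀ ν b, C.branch ν b ≠ x) (h : C.proj y = C.proj x) :
    y = x := by
  let g : C.Point → Prop := Quot.lift (fun z => z = x) (by
    rintro a b ⟨ν, rfl, rfl⟩
    simp [hx])
  have : g (C.proj y) := by
    rw [h]
    exact rfl
  exact this

/-- The open set where the complement consists of finitely many points of the normalization
which are not branches of nodes. -/
def compl (S : Finset C.Norm) (hS : ∀ x ∈ S, ∀ ν b, C.branch ν b ≠ x) : Opens C.Point where
  carrier := {c | ∀ x ∈ S, C.proj x ≠ c}
  is_open' := by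
    -- The points of `S` are alone in their fibres, so the preimage removes from the normalization
    -- nothing but the finite set `S`.
    have h : C.proj ⁻¹' {c | ∀ x ∈ S, C.proj x ≠ c} = (S : Set C.Norm)ᶜ := by
      ext y
      constructor
      · intro h hy
        exact h y hy rfl
      · intro hy x hx h
        exact hy ((C.eq_of_proj_eq (hS x hx) h.symm) ▸ hx)
    have hopen : IsOpen (C.proj ⁻¹' {c | ∀ x ∈ S, C.proj x ≠ c}) := by
      rw [h, isOpen_sigma_iff]
      intro i
      refine CofiniteTopology.isOpen_iff.mpr fun _ => ?_
      rw [← Set.preimage_compl, compl_compl]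
      exact S.finite_toSet.preimage sigma_mk_injective.injOn
    exact isOpen_coinduced.mpr hopen

/-- In a component which meets an open set, almost all points belong to it. -/
lemma eventually_mem {W : Opens C.Point} {x : C.Norm} (hx : C.proj x ∈ W) :
    ∀ᶠ q in cofinite, C.proj ⟨x.1, q⟩ ∈ W := by
  have hopen : IsOpen ((fun q : P1 => C.proj ⟨x.1, q⟩) ⁻¹' W) :=
    W.isOpen.preimage (C.continuous_proj.comp continuous_sigmaMk)
  exact CofiniteTopology.isOpen_iff.mp hopen ⟨x.2, hx⟩

variable {C}

open Classical in
/-- Extension by zero of a function on the part of the normalization over `W`. -/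
def extend {W : Opens C.Point} {A : Type} [Zero A] (f : {y // C.proj y ∈ W} → A) (y : C.Norm) : A :=
  if h : C.proj y ∈ W then f ⟨y, h⟩ else 0

lemma extend_of_mem {W : Opens C.Point} {A : Type} [Zero A] (f : {y // C.proj y ∈ W} → A)
    {y : C.Norm} (h : C.proj y ∈ W) : extend f y = f ⟨y, h⟩ := dif_pos h

variable (C)

/-- `f` is regular at the point `x` of the normalization. -/
def IsRegularNorm {n : ℕ} (f : C.Norm → Fin n → ℂ) (x : C.Norm) : Prop :=
  ∀ j, IsRegularAt (fun q => f ⟨x.1, q⟩ j) x.2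

-- An open set meeting a component contains almost all of it, so regularity depends only on the
-- values over `W`. In particular extension by zero outside `W` is harmless.
variable {C} in
lemma IsRegularNorm.congr {n : ℕ} {f g : C.Norm → Fin n → ℂ} {W : Opens C.Point} {x : C.Norm}
    (hx : C.proj x ∈ W) (hf : C.IsRegularNorm f x) (h : ∀ y, C.proj y ∈ W → f y = g y) :
    C.IsRegularNorm g x := fun j => by
  refine (hf j).congr ?_ ?_
  · exact congrFun (h x hx) j
  · filter_upwards [C.eventually_mem hx] with q hq
    rw [h _ hq]

/-- Vectors of `n` functions on the normalization, regular over an open subset of the curve. -/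
def normFunctions (n : ℕ) : LocalFunctions C.proj (Fin n → ℂ) where
  sec W :=
    { carrier := {f | ∀ x, C.proj x ∈ W → C.IsRegularNorm (extend f) x}
      add_mem' := by
        intro f g hf hg x hx j
        have := ((hf x hx j).add (hg x hx j))
        refine this.congr ?_ ?_
        · change extend f x j + extend g x j = extend (f + g) x j
          simp [extend_of_mem _ hx]
        · filter_upwards [C.eventually_mem hx] with q hq
          simp [extend_of_mem _ hq]
      zero_mem' := by
        intro x hx j
        refine (isRegularAt_const 0 _).congr ?_ ?_
        · change 0 = extend (0 : {y // C.proj y ∈ W} → Fin n → ℂ) x j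
          simp [extend_of_mem _ hx]
        · filter_upwards [C.eventually_mem hx] with q hq
          simp [extend_of_mem _ hq]
      smul_mem' := by
        intro a f hf x hx j
        refine ((isRegularAt_const a _).mul (hf x hx j)).congr ?_ ?_
        · change a * extend f x j = extend (a • f) x j
          simp [extend_of_mem _ hx]
        · filter_upwards [C.eventually_mem hx] with q hq
          simp [extend_of_mem _ hq] }
  res {W W'} h f hf x hx := (hf x (h hx)).congr hx fun y hy => by
    rw [extend_of_mem _ hy, extend_of_mem _ (h hy)]
  isLocal {W f} hf x hx := by
    obtain ⟨W', h, hxW', hf'⟩ := hf (C.proj x) hx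
    exact (hf' x hxW').congr hxW' fun y hy => by
      rw [extend_of_mem _ hy, extend_of_mem _ (h hy)]

/-- Vectors attached to the nodes. -/
def nodeFunctions (n : ℕ) : LocalFunctions (fun ν => C.proj (C.branch ν false)) (Fin n → ℂ) where
  sec _ := ⊤
  res _ _ _ := trivial
  isLocal _ := trivial

/-- The difference of the values at the two branches of the nodes. -/
def nodeDifference (n : ℕ) : (C.normFunctions n).sheaf ⟶ (C.nodeFunctions n).sheaf :=
  ⟨{ app := fun W => AddCommGrpCat.ofHom
      { toFun := fun f => (⟨fun ν => f.1 ⟨C.branch ν.1 true, by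
            have h := ν.2
            rwa [proj_branch] at h⟩ - f.1 ⟨C.branch ν.1 false, ν.2⟩, trivial⟩ :
          (C.nodeFunctions n).sec W.unop)
        map_zero' := Subtype.ext (funext fun _ => sub_zero _)
        map_add' := fun f g => Subtype.ext (funext fun _ => add_sub_add_comm _ _ _ _) }
     naturality := fun _ _ _ => rfl }⟩

/-- On each component one interpolates the given vectors at the `true` branches and zero at the
`false` branches, allowing a single pole. Removing these poles, which avoid the nodes and the given
point, leaves a neighbourhood of that point. -/
lemma nodeDifference_locallySurjective (n : ℕ) :
    TopCat.Presheaf.IsLocallySurjective (X := TopCat.of C.Point) (C.nodeDifference n).hom := by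
  classical
  rw [TopCat.Presheaf.isLocallySurjective_iff]
  intro W t c hc
  obtain ⟨x, rfl⟩ := C.proj_surjective c
  -- The point `x` is included only to keep the poles away from it.
  let D : Finset C.Norm := insert x (Finset.univ.image fun y : C.Node × Bool => C.branch y.1 y.2)
  have hD : ∀ i : C.Comp, ∃ a : ℂ, (⟨i, P1.fin a⟩ : C.Norm) ∉ D ∧ ∀ y : P1 → ℂ, ∃ f : P1 → ℂ,
      (∀ p, p ≠ P1.fin a → IsRegularAt f p) ∧ ∀ p, (⟨i, p⟩ : C.Norm) ∈ D → f p = y p := by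
    intro i
    obtain ⟨a, ha, h⟩ := exists_interpolation (D.preimage (fun p => (⟨i, p⟩ : C.Norm))
      fun p _ q _ h => eq_of_heq (Sigma.mk.inj h).2)
    refine ⟨a, fun h' => ha (Finset.mem_preimage.mpr h'), fun y => ?_⟩
    obtain ⟨f, hf, hf'⟩ := h y
    exact ⟨f, hf, fun p hp => hf' p (Finset.mem_preimage.mpr hp)⟩
  choose a ha hint using hD
  let S : Finset C.Norm := Finset.univ.image fun i => ⟨i, P1.fin (a i)⟩
  have hS : ∀ y ∈ S, y ∉ D := by
    intro y hy
    obtain ⟨i, -, rfl⟩ := Finset.mem_image.mp hy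
    exact ha i
  have hSb : ∀ y ∈ S, ∀ ν b, C.branch ν b ≠ y := by
    intro y hy ν b h
    exact hS y hy (Finset.mem_insert_of_mem (Finset.mem_image.mpr ⟨(ν, b), Finset.mem_univ _, h⟩))
  let t' : C.Node → Fin n → ℂ := fun ν => if h : C.proj (C.branch ν false) ∈ W then
    (t : (C.nodeFunctions n).sec W).1 ⟨ν, h⟩ else 0
  let y : C.Norm → Fin n → ℂ := fun z => if h : ∃ ν, C.branch ν true = z then t' h.choose else 0
  have hyt : ∀ ν, y (C.branch ν true) = t' ν := by
    intro ν
    have h : ∃ ν', C.branch ν' true = C.branch ν true := ⟨ν, rfl⟩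
    have h2 : h.choose = ν := by
      have := C.branch_injective (a₁ := (h.choose, true)) (a₂ := (ν, true)) h.choose_spec
      exact congrArg Prod.fst this
    simp only [y, dif_pos h, h2]
  have hyf : ∀ ν, y (C.branch ν false) = 0 := by
    intro ν
    refine dif_neg ?_
    rintro ⟨ν', h'⟩
    have := C.branch_injective (a₁ := (ν', true)) (a₂ := (ν, false)) h'
    simp at this
  choose f hf hfD using fun i (j : Fin n) => hint i fun p => y ⟨i, p⟩ j
  let F : C.Norm → Fin n → ℂ := fun z j => f z.1 j z.2
  have hFD : ∀ z ∈ D, F z = y z := fun z hz => funext fun j => hfD z.1 j z.2 hz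
  have hbD : ∀ ν b, C.branch ν b ∈ D := fun ν b =>
    Finset.mem_insert_of_mem (Finset.mem_image.mpr ⟨(ν, b), Finset.mem_univ _, rfl⟩)
  let W' : Opens C.Point := W ⊓ C.compl S hSb
  have hF : (fun z : {z // C.proj z ∈ W'} => F z.1) ∈ (C.normFunctions n).sec W' := by
    intro z hz
    have hreg : C.IsRegularNorm F z := fun j => hf z.1 j z.2 fun h => hz.2 z (by
      refine Finset.mem_image.mpr ⟨z.1, Finset.mem_univ _, ?_⟩
      exact Sigma.ext rfl (heq_of_eq h.symm)) rfl
    exact hreg.congr hz fun z' hz' => by rw [extend_of_mem _ hz']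
  refine ⟨W', inf_le_left, ⟨(⟨_, hF⟩ : (C.normFunctions n).sec W'), ?_⟩, hc, ?_⟩
  · apply Subtype.ext
    funext ν
    change F (C.branch ν.1 true) - F (C.branch ν.1 false) =
      (t : (C.nodeFunctions n).sec W).1 ⟨ν.1, ν.2.1⟩
    rw [hFD _ (hbD _ _), hFD _ (hbD _ _), hyt, hyf, sub_zero]
    exact dif_pos ν.2.1
  · intro z hz h
    have := C.eq_of_proj_eq (hSb z hz) h.symm
    exact hS z hz (this ▸ Finset.mem_insert_self _ _)

lemma normFunctions_splitsOverlaps (n : ℕ) :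
    SplitsOverlaps (X := TopCat.of C.Point) (C.normFunctions n).sheaf := by
  intro U V s
  change (C.normFunctions n).sec (U ⊓ V) at s
  have key : ∀ (i : C.Comp) (j : Fin n), ∃ a b : P1 → ℂ,
      (∀ p, C.proj ⟨i, p⟩ ∈ U → IsRegularAt a p) ∧ (∀ p, C.proj ⟨i, p⟩ ∈ V → IsRegularAt b p) ∧
      ∀ p, C.proj ⟨i, p⟩ ∈ U ⊓ V → extend s.1 ⟨i, p⟩ j = a p - b p := by
    intro i j
    -- If `U ⊓ V` misses the component there is no condition, and zero serves on both sides.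
    by_cases h : ∃ p₀, C.proj ⟨i, p₀⟩ ∈ U ⊓ V
    · obtain ⟨p₀, hp₀⟩ := h
      exact exists_sub_of_isRegularAt (U := {p | C.proj ⟨i, p⟩ ∈ U})
        (V := {p | C.proj ⟨i, p⟩ ∈ V}) hp₀ (f := fun p => extend s.1 ⟨i, p⟩ j)
        fun p hp => s.2 ⟨i, p⟩ hp j
    · push Not at h
      exact ⟨0, 0, fun p _ => isRegularAt_const 0 p, fun p _ => isRegularAt_const 0 p,
        fun p hp => (h p hp).elim⟩
  choose a b ha hb hab using key
  refine ⟨(⟨fun z j => a z.1.1 j z.1.2, fun z hz => ?_⟩ : (C.normFunctions n).sec U),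
    (⟨fun z j => b z.1.1 j z.1.2, fun z hz => ?_⟩ : (C.normFunctions n).sec V), ?_⟩
  · have : C.IsRegularNorm (fun z j => a z.1 j z.2) z := fun j => ha z.1 j z.2 hz
    exact this.congr hz fun z' hz' => by rw [extend_of_mem _ hz']
  · have : C.IsRegularNorm (fun z j => b z.1 j z.2) z := fun j => hb z.1 j z.2 hz
    exact this.congr hz fun z' hz' => by rw [extend_of_mem _ hz']
  · apply Subtype.ext
    funext z j
    have := hab z.1.1 j z.1.2 z.2
    rw [extend_of_mem _ z.2] at this
    exact this

lemma subsingleton_H_one_normFunctions (n : ℕ) :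
    Subsingleton (Sheaf.H (C.normFunctions n).sheaf 1) :=
  subsingleton_H_one (X := TopCat.of C.Point) _ (C.normFunctions_splitsOverlaps n)

/-- A global regular function on the normalization is constant on each component. -/
lemma normFunctions_const {n : ℕ} (f : (C.normFunctions n).sec ⊤) (i : C.Comp) (p q : P1) :
    f.1 ⟨⟨i, p⟩, trivial⟩ = f.1 ⟨⟨i, q⟩, trivial⟩ := by
  funext j
  have := eq_of_isRegularAt (f := fun p => extend f.1 ⟨i, p⟩ j) (fun p => f.2 ⟨i, p⟩ trivial j) p q
  rwa [extend_of_mem _ (W := ⊤) trivial, extend_of_mem _ (W := ⊤) trivial] at this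

end NodalCurve

/-! ## The cones of the degeneration -/

section Cones

variable {n : ℕ}

/-- The pairing with a character, as a continuous linear form. -/
def pairingL (m : Char n) : (Fin n → ℝ) × ℝ →L[ℝ] ℝ :=
  LinearMap.toContinuousLinearMap
    { toFun := pairing m
      map_add' := fun x y => by
        simp only [pairing, Prod.fst_add, Prod.snd_add, Pi.add_apply, mul_add,
          Finset.sum_add_distrib]
        ring
      map_smul' := fun c x => by
        simp only [pairing, Prod.smul_fst, Prod.smul_snd, Pi.smul_apply, smul_eq_mul,
          RingHom.id_apply, mul_add, Finset.mul_sum]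
        congr 1
        · exact Finset.sum_congr rfl fun i _ => by ring
        · ring }

lemma pairingL_apply (m : Char n) (x : (Fin n → ℝ) × ℝ) : pairingL m x = pairing m x := rfl

lemma pairing_nsmul (k : ℕ) (m : Char n) (x : (Fin n → ℝ) × ℝ) :
    pairing (k • m) x = k * pairing m x := by
  induction k with
  | zero => simp [pairing_zero]
  | succ k ih =>
    rw [succ_nsmul, pairing_add, ih]
    push_cast
    ring

/-- Finitely many vectors in an open half space lie in an open half space with an integral
normal vector. -/
lemma exists_integral_pos (G : Finset ((Fin n → ℝ) × ℝ)) (w : Fin n → ℝ) (c : ℝ)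
    (h : ∀ g ∈ G, 0 < ∑ i, w i * g.1 i + c * g.2) : ∃ m : Char n, ∀ g ∈ G, 0 < pairing m g := by
  -- Positivity on a finite set is an open condition on the linear form, so a rational form
  -- satisfies it too.
  let O : Set ((Fin n → ℝ) × ℝ) := ⋂ g ∈ G, {u | 0 < ∑ i, u.1 i * g.1 i + u.2 * g.2}
  have hO : IsOpen O := by
    refine isOpen_biInter_finset fun g _ => isOpen_lt continuous_const ?_
    fun_prop
  have hd : DenseRange (Prod.map (Pi.map fun (_ : Fin n) (q : ℚ) => (q : ℝ)) fun q : ℚ => (q : ℝ)) :=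
    (DenseRange.piMap fun _ => Rat.denseRange_cast).prodMap Rat.denseRange_cast
  obtain ⟨⟨q, r⟩, hq⟩ := hd.exists_mem_open hO ⟨(w, c), by simpa [O] using h⟩
  -- A common denominator, which makes the rational form integral.
  let d : ℕ := (∏ i, (q i).den) * r.den
  have hd0 : 0 < d := Nat.mul_pos (Finset.prod_pos fun i _ => (q i).den_pos) r.den_pos
  have hint : ∀ s : ℚ, s.den ∣ d → ∃ k : ℤ, (k : ℝ) = d * (s : ℝ) := by
    rintro s ⟨e, he⟩
    refine ⟨e * s.num, ?_⟩
    have : (s : ℝ) * s.den = s.num := by exact_mod_cast Rat.mul_den_eq_num s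
    rw [he]
    push_cast
    rw [← this]
    ring
  choose k hk using fun i => hint (q i)
    ((Finset.dvd_prod_of_mem (fun i => (q i).den) (Finset.mem_univ i)).trans (Dvd.intro _ rfl))
  obtain ⟨l, hl⟩ := hint r (Dvd.intro_left _ rfl)
  refine ⟨(k, l), fun g hg => ?_⟩
  have hpos := Set.mem_iInter₂.mp hq g hg
  have : pairing (k, l) g = d * (∑ i, (q i : ℝ) * g.1 i + (r : ℝ) * g.2) := by
    simp only [pairing, hk, hl, mul_add, Finset.mul_sum]
    congr 1
    · exact Finset.sum_congr rfl fun i _ => by ring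
    · ring
  rw [this]
  exact mul_pos (by exact_mod_cast hd0) hpos

/-- Strict positivity is put in the form `ε * ‖g‖ ≤ φ g` because, for linear `φ`, this inequality
survives sums, nonnegative multiples and closures, and so passes from generators to the closed cone.
-/
lemma exists_bound {E : Type} [NormedAddCommGroup E] (G : Finset E) (φ : E → ℝ)
    (h : ∀ g ∈ G, 0 < φ g) : ∃ ε : ℝ, 0 < ε ∧ ∀ g ∈ G, ε * ‖g‖ ≤ φ g := by
  classical
  induction G using Finset.induction_on with
  | empty => exact ⟨1, one_pos, by simp⟩
  | insert g G _ ih =>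
    obtain ⟨ε, hε, hG⟩ := ih fun g hg => h g (Finset.mem_insert_of_mem hg)
    have hg := h g (Finset.mem_insert_self _ _)
    refine ⟨min ε (φ g / (‖g‖ + 1)), lt_min hε (by positivity), ?_⟩
    intro g' hg'
    rcases Finset.mem_insert.mp hg' with rfl | hg'
    · calc min ε (φ g' / (‖g'‖ + 1)) * ‖g'‖ ≤ φ g' / (‖g'‖ + 1) * (‖g'‖ + 1) :=
            mul_le_mul (min_le_right _ _) (by linarith) (norm_nonneg _) (by positivity)
        _ = φ g' := by field_simp
    · exact (mul_le_mul_of_nonneg_right (min_le_left _ _) (norm_nonneg _)).trans (hG g' hg')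

lemma subset_coneOver {Ξ : Set (Fin n → ℝ)} {Z : Set ((Fin n → ℝ) × ℝ)} (hZ : IsClosed Z)
    (h : ∀ a : ℝ, 0 ≤ a → ∀ x ∈ Ξ, (a • x, a) ∈ Z) : coneOver Ξ ⊆ Z :=
  closure_minimal (by rintro _ ⟨a, ha, x, hx, rfl⟩; exact h a ha x hx) hZ

lemma smul_mem_coneOver {Ξ : Set (Fin n → ℝ)} {y : (Fin n → ℝ) × ℝ} (hy : y ∈ coneOver Ξ) {c : ℝ}
    (hc : 0 ≤ c) : c • y ∈ coneOver Ξ := by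
  have : coneOver Ξ ⊆ (fun y => c • y) ⁻¹' coneOver Ξ := by
    refine subset_coneOver (isClosed_closure.preimage (continuous_const_smul c)) ?_
    intro a ha x hx
    refine subset_closure ⟨c * a, mul_nonneg hc ha, x, hx, ?_⟩
    simp [smul_smul]
  exact this hy

lemma snd_nonneg {Ξ : Set (Fin n → ℝ)} {y : (Fin n → ℝ) × ℝ} (hy : y ∈ coneOver Ξ) : 0 ≤ y.2 := by
  have : coneOver Ξ ⊆ {y | 0 ≤ y.2} :=
    subset_coneOver (isClosed_le continuous_const continuous_snd) fun a ha x _ => ha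
  exact this hy

/-- The cone over a cell is strictly positive with respect to some character. -/
lemma PolyDecomp.exists_pos (P : PolyDecomp n) {Ξ : Set (Fin n → ℝ)} (hΞ : Ξ ∈ P.cells) :
    ∃ (m : Char n) (ε : ℝ), 0 < ε ∧ ∀ y ∈ coneOver Ξ, ε * ‖y‖ ≤ pairing m y := by
  classical
  obtain ⟨A, B, hA, rfl⟩ := P.polyhedral Ξ hΞ
  obtain ⟨v, hv⟩ := P.vertex _ hΞ
  obtain ⟨l, hl⟩ := hv (Set.singleton_nonempty v)
  set Ξ := {x | ∃ a ∈ convexHull ℝ ((fun q : Fin n → ℚ => fun i => (q i : ℝ)) '' (A : Set (Fin n → ℚ))),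
      ∃ b : (Fin n → ℚ) → ℝ, (∀ q, 0 ≤ b q) ∧ x = a + ∑ q ∈ B, b q • fun i => (q i : ℝ)} with hΞ'
  have hvΞ : v ∈ Ξ ∧ ∀ y ∈ Ξ, l y ≤ l v := by
    have : v ∈ ({v} : Set (Fin n → ℝ)) := rfl
    rw [hl] at this
    exact this
  have hvu : ∀ x ∈ Ξ, l v ≤ l x → x = v := by
    intro x hx h
    have : x ∈ ({v} : Set (Fin n → ℝ)) := by
      rw [hl]
      exact ⟨hx, fun y hy => (hvΞ.2 y hy).trans h⟩
    exact this
  -- Generators of the cone: points spanning the polytope part at height `1`, and nonzero recession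
  -- directions at height `0`.
  let G₁ : Finset ((Fin n → ℝ) × ℝ) := A.image fun q => ((fun i => (q i : ℝ)), 1)
  let G₂ : Finset ((Fin n → ℝ) × ℝ) := (B.filter (· ≠ 0)).image fun q => ((fun i => (q i : ℝ)), 0)
  have hlsum : ∀ x : Fin n → ℝ, l x = ∑ i, l (Pi.single i 1) * x i := by
    intro x
    have := LinearMap.pi_apply_eq_sum_univ (l : (Fin n → ℝ) →ₗ[ℝ] ℝ) x
    simp only [ContinuousLinearMap.coe_coe] at this
    rw [this]
    refine Finset.sum_congr rfl fun i _ => ?_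
    rw [smul_eq_mul, mul_comm]
    congr 2
    ext j
    simp [Pi.single_apply, eq_comm]
  have hAΞ : ∀ q ∈ A, (fun i => (q i : ℝ)) ∈ Ξ := fun q hq =>
    ⟨_, subset_convexHull ℝ _ ⟨q, hq, rfl⟩, 0, fun _ => le_rfl, by simp⟩
  -- Otherwise `v + q` would be a second point of the cell where `l` is maximal, while `l` exposes
  -- the vertex `v` alone.
  have hBneg : ∀ q ∈ B, q ≠ 0 → l (fun i => (q i : ℝ)) < 0 := by
    intro q hq hq0
    by_contra! hge
    obtain ⟨a, ha, b, hb, hvab⟩ := hvΞ.1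
    have hmem : v + (fun i => (q i : ℝ)) ∈ Ξ := by
      refine ⟨a, ha, b + Pi.single q 1, fun p => ?_, ?_⟩
      · by_cases hp : p = q
        · subst hp
          simpa using add_nonneg (hb p) zero_le_one
        · simpa [Pi.single_apply, hp] using hb p
      · simp only [Pi.add_apply, add_smul, Finset.sum_add_distrib]
        rw [hvab, add_assoc]
        congr 2
        rw [Finset.sum_eq_single q]
        · simp
        · intro p _ hp
          simp [hp]
        · exact fun h => (h hq).elim
    have := hvu _ hmem (by rw [map_add]; linarith)
    rw [add_eq_left] at this
    apply hq0
    ext i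
    have := congrFun this i
    simpa using this
  -- The form `-l + (l v + 1) * height` is at least `1` on `G₁`, since `l ≤ l v` on the cell, and
  -- positive on `G₂`.
  obtain ⟨m, hm⟩ := exists_integral_pos (G₁ ∪ G₂) (fun i => -l (Pi.single i 1)) (l v + 1) (by
    intro g hg
    rcases Finset.mem_union.mp hg with hg | hg
    · obtain ⟨q, hq, rfl⟩ := Finset.mem_image.mp hg
      have := hvΞ.2 _ (hAΞ q hq)
      rw [hlsum] at this
      simp only [neg_mul, Finset.sum_neg_distrib, mul_one]
      linarith
    · obtain ⟨q, hq, rfl⟩ := Finset.mem_image.mp hg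
      obtain ⟨hqB, hq0⟩ := Finset.mem_filter.mp hq
      have := hBneg q hqB hq0
      rw [hlsum] at this
      simp only [neg_mul, Finset.sum_neg_distrib, mul_zero, add_zero]
      linarith)
  obtain ⟨ε, hε, hG⟩ := exists_bound (G₁ ∪ G₂) (pairing m) hm
  refine ⟨m, ε, hε, ?_⟩
  have hadd : ∀ y z : (Fin n → ℝ) × ℝ, ε * ‖y‖ ≤ pairing m y → ε * ‖z‖ ≤ pairing m z →
      ε * ‖y + z‖ ≤ pairing m (y + z) := by
    intro y z hy hz
    have : pairing m (y + z) = pairing m y + pairing m z := map_add (pairingL m) y z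
    rw [this]
    have := mul_le_mul_of_nonneg_left (norm_add_le y z) hε.le
    linarith
  have hsmul : ∀ (c : ℝ) (y : (Fin n → ℝ) × ℝ), 0 ≤ c → ε * ‖y‖ ≤ pairing m y →
      ε * ‖c • y‖ ≤ pairing m (c • y) := by
    intro c y hc hy
    have : pairing m (c • y) = c * pairing m y := map_smul (pairingL m) c y
    rw [this, norm_smul, Real.norm_of_nonneg hc]
    have := mul_le_mul_of_nonneg_left hy hc
    linarith
  have hzero : ε * ‖(0 : (Fin n → ℝ) × ℝ)‖ ≤ pairing m 0 := by
    have : pairing m 0 = 0 := map_zero (pairingL m)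
    simp [this]
  have hhull : convexHull ℝ ((fun q : Fin n → ℚ => fun i => (q i : ℝ)) '' (A : Set (Fin n → ℚ))) ⊆
      {a | ε * ‖((a, 1) : (Fin n → ℝ) × ℝ)‖ ≤ pairing m (a, 1)} := by
    refine convexHull_min ?_ ?_
    · rintro _ ⟨q, hq, rfl⟩
      exact hG _ (Finset.mem_union_left _ (Finset.mem_image_of_mem _ hq))
    · intro x hx y hy s t hs ht hst
      have := hadd _ _ (hsmul s _ hs hx) (hsmul t _ ht hy)
      have e : s • ((x, 1) : (Fin n → ℝ) × ℝ) + t • ((y, 1) : (Fin n → ℝ) × ℝ) =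
          (s • x + t • y, 1) := by
        ext <;> simp [hst]
      rw [e] at this
      exact this
  refine subset_coneOver (Z := {y | ε * ‖y‖ ≤ pairing m y}) (isClosed_le (by fun_prop)
    (pairingL m).continuous) ?_
  rintro s hs x ⟨a, ha, b, hb, rfl⟩
  have h1 := hsmul s _ hs (hhull ha)
  have h2 : ∀ B' ⊆ B, ε * ‖((∑ q ∈ B', b q • fun i => (q i : ℝ), 0) : (Fin n → ℝ) × ℝ)‖ ≤
      pairing m (∑ q ∈ B', b q • fun i => (q i : ℝ), 0) := by
    intro B'
    induction B' using Finset.induction_on with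
    | empty => exact fun _ => hzero
    | insert q B' hq ih =>
      intro hB'
      rw [Finset.sum_insert hq]
      have hq' : ε * ‖(((fun i => (q i : ℝ)), 0) : (Fin n → ℝ) × ℝ)‖ ≤
          pairing m ((fun i => (q i : ℝ)), 0) := by
        by_cases hq0 : q = 0
        · subst hq0
          have : (((fun i => ((0 : Fin n → ℚ) i : ℝ)), 0) : (Fin n → ℝ) × ℝ) = 0 := by
            ext <;> simp
          rw [this]
          exact hzero
        · exact hG _ (Finset.mem_union_right _ (Finset.mem_image_of_mem _
            (Finset.mem_filter.mpr ⟨hB' (Finset.mem_insert_self _ _), hq0⟩)))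
      have := hadd _ _ (hsmul (b q) _ (hb q) hq')
        (ih ((Finset.subset_insert _ _).trans hB'))
      simpa using this
  have h3 := hadd _ _ h1 (hsmul s _ hs (h2 B subset_rfl))
  have e : s • ((a, 1) : (Fin n → ℝ) × ℝ) +
      s • ((∑ q ∈ B, b q • fun i => (q i : ℝ), 0) : (Fin n → ℝ) × ℝ) =
      (s • (a + ∑ q ∈ B, b q • fun i => (q i : ℝ)), s) := by
    ext <;> simp [mul_add]
  rw [e] at h3
  exact h3

namespace PolyDecomp

variable (P : PolyDecomp n)

/-- The cones of the fan are strictly positive with respect to some character. -/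
lemma exists_pos_of_mem_fan {σ : Set ((Fin n → ℝ) × ℝ)} (hσ : σ ∈ P.fan) :
    ∃ (m : Char n) (ε : ℝ), 0 < ε ∧ ∀ y ∈ σ, ε * ‖y‖ ≤ pairing m y := by
  obtain ⟨Ξ, hΞ, -, hexp⟩ := hσ
  obtain ⟨m, ε, hε, h⟩ := P.exists_pos hΞ
  exact ⟨m, ε, hε, fun y hy => h y (hexp.subset hy)⟩

lemma zero_mem {σ : Set ((Fin n → ℝ) × ℝ)} (hσ : σ ∈ P.fan) : 0 ∈ σ := by
  obtain ⟨Ξ, hΞ, ⟨y, hy⟩, hexp⟩ := hσ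
  obtain ⟨l, hl⟩ := hexp ⟨y, hy⟩
  have hy' := hy
  rw [hl] at hy'
  have h0 : (0 : (Fin n → ℝ) × ℝ) ∈ coneOver Ξ := by
    simpa using smul_mem_coneOver hy'.1 le_rfl
  -- Comparing `y` with `2 • y` shows that the maximum `l y` of the exposing form is at most `0 = l
  -- 0`, so the maximum is attained at the origin.
  have h2 := hy'.2 _ (smul_mem_coneOver hy'.1 zero_le_two)
  rw [map_smul, smul_eq_mul] at h2
  rw [hl]
  refine ⟨h0, fun z hz => (hy'.2 z hz).trans ?_⟩
  rw [map_zero]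
  linarith

/-- The cones of the fan are pointed. -/
lemma isExposed_zero {σ : Set ((Fin n → ℝ) × ℝ)} (hσ : σ ∈ P.fan) : IsExposed ℝ σ {0} := by
  obtain ⟨m, ε, hε, h⟩ := P.exists_pos_of_mem_fan hσ
  intro _
  refine ⟨-pairingL m, ?_⟩
  have hm0 : pairing m 0 = 0 := map_zero (pairingL m)
  ext y
  simp only [Set.mem_singleton_iff, Set.mem_ofPred_eq, neg_apply,
    pairingL_apply, neg_le_neg_iff]
  constructor
  · rintro rfl
    refine ⟨P.zero_mem hσ, fun z hz => ?_⟩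
    rw [hm0]
    exact (mul_nonneg hε.le (norm_nonneg z)).trans (h z hz)
  · rintro ⟨hy, hy'⟩
    have h1 := hy' 0 (P.zero_mem hσ)
    have h2 := h y hy
    rw [hm0] at h1
    have h3 : ‖y‖ ≤ 0 := by
      by_contra! h4
      have := mul_pos hε h4
      linarith
    exact norm_le_zero_iff.mp h3

/-- Provides the open torus orbit of the total space. -/
lemma zero_mem_fan : {0} ∈ P.fan := by
  have h : (0 : Fin n → ℝ) ∈ ⋃₀ P.cells := by rw [P.cover]; trivial
  obtain ⟨Ξ, hΞ, h0⟩ := h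
  have hσ : coneOver Ξ ∈ P.fan := ⟨Ξ, hΞ, ⟨_, subset_closure ⟨1, zero_le_one, 0, h0, rfl⟩⟩,
    IsExposed.refl _⟩
  exact ⟨Ξ, hΞ, Set.singleton_nonempty 0, P.isExposed_zero hσ⟩

/-- Every character becomes nonnegative on a given cone of the fan after adding a multiple of some
character which is nonnegative on the cone. -/
lemma exists_add_mem_dualMonoid {σ : Set ((Fin n → ℝ) × ℝ)} (hσ : σ ∈ P.fan) :
    ∃ m₀ ∈ dualMonoid σ, ∀ m : Char n, ∃ k : ℕ, m + k • m₀ ∈ dualMonoid σ := by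
  obtain ⟨m₀, ε, hε, h⟩ := P.exists_pos_of_mem_fan hσ
  refine ⟨m₀, fun y hy => (mul_nonneg hε.le (norm_nonneg y)).trans (h y hy), fun m => ?_⟩
  -- With `k * ε ≥ ‖m‖`, the term `k * pairing m₀ y ≥ k * ε * ‖y‖` outweighs `pairing m y ≥ -‖m‖ *
  -- ‖y‖`.
  obtain ⟨k, hk⟩ := exists_nat_ge (‖pairingL m‖ / ε)
  refine ⟨k, fun y hy => ?_⟩
  rw [pairing_add, pairing_nsmul]
  have h1 : -(‖pairingL m‖ * ‖y‖) ≤ pairing m y :=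
    neg_le_of_abs_le ((pairingL m).le_opNorm y)
  have h2 := mul_le_mul_of_nonneg_left (h y hy) (Nat.cast_nonneg (α := ℝ) k)
  rw [div_le_iff₀ hε] at hk
  have h3 := mul_le_mul_of_nonneg_right hk (norm_nonneg y)
  nlinarith

lemma t_mem_dualMonoid {σ : Set ((Fin n → ℝ) × ℝ)} (hσ : σ ∈ P.fan) :
    ((0, 1) : Char n) ∈ dualMonoid σ := by
  obtain ⟨Ξ, -, -, hexp⟩ := hσ
  intro y hy
  simpa [pairing] using snd_nonneg (hexp.subset hy)

end PolyDecomp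

end Cones

/-! ## Laurent polynomials and logarithmic derivatives -/

section Laurent

variable {n : ℕ}

/-- Evaluation of a Laurent polynomial at a point of the torus. -/
def evalTorus (t : Multiplicative (Char n) →* ℂˣ) : AddMonoidAlgebra ℂ (Char n) →ₐ[ℂ] ℂ :=
  AddMonoidAlgebra.lift ℂ ℂ (Char n) ((Units.coeHom ℂ).comp t)

/-- The character of the torus given by an element of the character lattice. -/
def torusChar (m : Char n) : (Multiplicative (Char n) →* ℂˣ) →* ℂ where
  toFun t := t (Multiplicative.ofAdd m)
  map_one' := rfl
  map_mul' _ _ := rfl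

lemma exists_torus_ne_one {m : Char n} (hm : m ≠ 0) :
    ∃ t : Multiplicative (Char n) →* ℂˣ, t (Multiplicative.ofAdd m) ≠ 1 := by
  have key : ∀ c : Char n →+ ℤ, c m ≠ 0 →
      ∃ t : Multiplicative (Char n) →* ℂˣ, t (Multiplicative.ofAdd m) ≠ 1 := by
    intro c hc
    -- The number `2` is not a root of unity, so it separates a nonzero exponent from `0`.
    let u : ℂˣ := Units.mk0 2 two_ne_zero
    refine ⟨(zpowersHom ℂˣ u).comp (AddMonoidHom.toMultiplicative c), ?_⟩
    intro h
    have h1 : u ^ (c m) = 1 := h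
    have h2 : (2 : ℂ) ^ (c m) = 1 := by
      have := congrArg Units.val h1
      simpa [u] using this
    have h3 : (2 : ℝ) ^ (c m) = 1 := by
      have := congrArg (fun z : ℂ => ‖z‖) h2
      simpa using this
    rcases (zpow_eq_one_iff_of_ne_zero₀ hc).mp h3 with h | h <;> norm_num at h
  by_cases h : m.2 = 0
  · have : ∃ i, m.1 i ≠ 0 := by
      by_contra! h'
      exact hm (Prod.ext (funext h') h)
    obtain ⟨i, hi⟩ := this
    exact key ((Pi.evalAddMonoidHom (fun _ : Fin n => ℤ) i).comp (AddMonoidHom.fst _ _)) hi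
  · exact key (AddMonoidHom.snd _ _) h

lemma torusChar_injective : Function.Injective (torusChar (n := n)) := by
  intro m m' h
  by_contra hne
  obtain ⟨t, ht⟩ := exists_torus_ne_one (sub_ne_zero.mpr hne)
  apply ht
  have h1 : t (Multiplicative.ofAdd m) = t (Multiplicative.ofAdd m') :=
    Units.ext (DFunLike.congr_fun h t)
  rw [ofAdd_sub, map_div, h1, div_self']

/-- A Laurent polynomial which vanishes on the torus is zero. -/
lemma laurent_eq_zero {f : AddMonoidAlgebra ℂ (Char n)} (h : ∀ t, evalTorus t f = 0) : f = 0 := by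
  -- Dedekind's independence of characters: distinct `m` give distinct, hence linearly independent,
  -- characters of the torus.
  have hli := (linearIndependent_monoidHom (Multiplicative (Char n) →* ℂˣ) ℂ).comp _
    torusChar_injective
  rw [← AddMonoidAlgebra.coeff_eq_zero]
  refine (linearIndependent_iff.mp hli) f.coeff ?_
  funext t
  have := h t
  rw [evalTorus, AddMonoidAlgebra.lift_apply] at this
  rw [Finsupp.linearCombination_apply, Finsupp.sum_apply']
  exact this

/-- The derivation `χ^m ↦ c(m) χ^m`. -/
def logDeriv {M : Type} [AddCommMonoid M] (c : M →+ ℂ) :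
    AddMonoidAlgebra ℂ M →ₗ[ℂ] AddMonoidAlgebra ℂ M where
  toFun f := f.coeff.sum fun m a => AddMonoidAlgebra.single m (c m * a)
  map_add' f g := by
    rw [AddMonoidAlgebra.coeff_add, Finsupp.sum_add_index']
    · simp
    · intro m a b
      rw [mul_add, AddMonoidAlgebra.single_add]
  map_smul' r f := by
    rw [AddMonoidAlgebra.coeff_smul, Finsupp.sum_smul_index (by simp), RingHom.id_apply,
      Finsupp.smul_sum]
    refine Finsupp.sum_congr fun m _ => ?_
    rw [AddMonoidAlgebra.smul_single, smul_eq_mul]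
    ring_nf

lemma logDeriv_single {M : Type} [AddCommMonoid M] (c : M →+ ℂ) (m : M) (a : ℂ) :
    logDeriv c (AddMonoidAlgebra.single m a) = AddMonoidAlgebra.single m (c m * a) := by
  change (AddMonoidAlgebra.single m a).coeff.sum
    (fun m a => AddMonoidAlgebra.single m (c m * a)) = _
  rw [AddMonoidAlgebra.coeff_single, Finsupp.sum_single_index (by simp)]

lemma logDeriv_mul {M : Type} [AddCommMonoid M] (c : M →+ ℂ) (f g : AddMonoidAlgebra ℂ M) :
    logDeriv c (f * g) = f * logDeriv c g + g * logDeriv c f := by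
  induction f using AddMonoidAlgebra.induction_linear with
  | zero => simp
  | add f f' h h' => rw [add_mul, map_add, h, h', map_add]; ring
  | single m a =>
    induction g using AddMonoidAlgebra.induction_linear with
    | zero => simp
    | add g g' h h' => rw [mul_add, map_add, h, h', map_add]; ring
    | single m' a' =>
      simp only [AddMonoidAlgebra.single_mul_single, logDeriv_single, map_add]
      rw [add_comm m' m, ← AddMonoidAlgebra.single_add]
      congr 1
      ring

lemma logDeriv_mapDomain {M N : Type} [AddCommMonoid M] [AddCommMonoid N] (c : N →+ ℂ) (i : M →+ N)
    (f : AddMonoidAlgebra ℂ M) :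
    logDeriv c (AddMonoidAlgebra.mapDomainAlgHom ℂ ℂ i f) =
      AddMonoidAlgebra.mapDomainAlgHom ℂ ℂ i (logDeriv (c.comp i) f) := by
  induction f using AddMonoidAlgebra.induction_linear with
  | zero => simp
  | add f f' h h' => simp only [map_add, h, h']
  | single m a => simp [logDeriv_single]

end Laurent

/-! ## Local rings of the toric variety -/

namespace PolyDecomp.Total

variable {n : ℕ} {P : PolyDecomp n}

/-- The inclusion of the coordinate ring of a chart in the Laurent polynomials. -/
def toLaurent (σ : Set ((Fin n → ℝ) × ℝ)) :
    AddMonoidAlgebra ℂ (dualMonoid σ) →ₐ[ℂ] AddMonoidAlgebra ℂ (Char n) :=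
  AddMonoidAlgebra.mapDomainAlgHom ℂ ℂ (dualMonoid σ).subtype

lemma toLaurent_injective (σ : Set ((Fin n → ℝ) × ℝ)) : Function.Injective (toLaurent σ) :=
  AddMonoidAlgebra.mapDomain_injective Subtype.val_injective

instance (σ : Set ((Fin n → ℝ) × ℝ)) : NoZeroDivisors (AddMonoidAlgebra ℂ (dualMonoid σ)) :=
  (toLaurent_injective σ).noZeroDivisors _ (map_zero _) (map_mul _)

variable (P) in
/-- The points of the big torus. -/
def torus (t : Multiplicative (Char n) →* ℂˣ) : P.Total where
  cone := {0}
  mem := P.zero_mem_fan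
  char := t.comp (AddMonoidHom.toMultiplicative (perp {0}).subtype)

lemma torus_mem_chart {σ : Set ((Fin n → ℝ) × ℝ)} (hσ : σ ∈ P.fan)
    (t : Multiplicative (Char n) →* ℂˣ) : torus P t ∈ chart σ := P.isExposed_zero hσ

lemma mem_perp_zero (m : Char n) : m ∈ perp ({0} : Set ((Fin n → ℝ) × ℝ)) := by
  rintro x rfl
  exact map_zero (pairingL m)

lemma monomial_torus (t : Multiplicative (Char n) →* ℂˣ) (m : Char n) :
    monomial m (torus P t) = t (Multiplicative.ofAdd m) := dif_pos (mem_perp_zero m)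

lemma evalFun_single {σ : Set ((Fin n → ℝ) × ℝ)} {y : P.Total} (hy : y ∈ chart σ)
    (m : dualMonoid σ) (a : ℂ) :
    evalFun (AddMonoidAlgebra.single m a) y = a * monomial (m : Char n) y := by
  rw [evalFun, dif_pos hy, evalHom, AddMonoidAlgebra.lift_single]
  rfl

lemma evalFun_torus {σ : Set ((Fin n → ℝ) × ℝ)} (hσ : σ ∈ P.fan)
    (f : AddMonoidAlgebra ℂ (dualMonoid σ)) (t : Multiplicative (Char n) →* ℂˣ) :
    evalFun f (torus P t) = evalTorus t (toLaurent σ f) := by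
  induction f using AddMonoidAlgebra.induction_linear with
  | zero => simp [evalFun]
  | add f g hf hg => rw [evalFun_add (torus_mem_chart hσ t), hf, hg, map_add, map_add]
  | single m a =>
    rw [evalFun_single (torus_mem_chart hσ t), monomial_torus]
    simp [toLaurent, evalTorus]

variable (P) in
/-- The neighbourhoods of the generic point: the sets which contain the complement in the torus of
the zeros of some nonzero Laurent polynomial. -/
def generic : Filter P.Total where
  sets := {O | ∃ h : AddMonoidAlgebra ℂ (Char n), h ≠ 0 ∧ ∀ t, evalTorus t h ≠ 0 → torus P t ∈ O}
  univ_sets := ⟨1, one_ne_zero, fun _ _ => trivial⟩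
  sets_of_superset := by
    rintro O O' ⟨h, h0, hO⟩ hOO'
    exact ⟨h, h0, fun t ht => hOO' (hO t ht)⟩
  inter_sets := by
    rintro O O' ⟨h, h0, hO⟩ ⟨h', h0', hO'⟩
    refine ⟨h * h', mul_ne_zero h0 h0', fun t ht => ?_⟩
    rw [map_mul] at ht
    exact ⟨hO t (left_ne_zero_of_mul ht), hO' t (right_ne_zero_of_mul ht)⟩

/-- A basic open set around a point is the nonvanishing locus of some nonzero `f` in a chart, so it
contains the torus points where `f` does not vanish. Thus every neighbourhood contains a dense part
of the torus, and germs are tested there. -/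
lemma generic_le_nhds (x : P.Total) : generic P ≤ 𝓝 x := by
  rw [nhds_generateFrom]
  refine le_iInf₂ fun U hU => le_principal_iff.mpr ?_
  obtain ⟨hx, σ, hσ, f, rfl⟩ := hU
  refine ⟨toLaurent σ f, ?_, fun t ht => ⟨torus_mem_chart hσ t, ?_⟩⟩
  · intro h0
    have : f = 0 := toLaurent_injective σ (by rw [h0, map_zero])
    apply hx.2
    simp [this, evalFun]
  · rwa [evalFun_torus hσ]

/-- An element of a coordinate ring which vanishes near some point is zero. -/
lemma eq_zero_of_eventually {σ : Set ((Fin n → ℝ) × ℝ)} (hσ : σ ∈ P.fan)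
    {f : AddMonoidAlgebra ℂ (dualMonoid σ)} {x : P.Total} (h : ∀ᶠ y in 𝓝 x, evalFun f y = 0) :
    f = 0 := by
  obtain ⟨g, hg0, hg⟩ := generic_le_nhds x h
  apply toLaurent_injective σ
  rw [map_zero]
  -- The product `g * f` vanishes on the whole torus, and the Laurent polynomials have no zero
  -- divisors.
  refine (mul_eq_zero.mp (laurent_eq_zero (f := g * toLaurent σ f) fun t => ?_)).resolve_left hg0
  rw [map_mul]
  by_cases ht : evalTorus t g = 0
  · rw [ht, zero_mul]
  · have : evalFun f (torus P t) = 0 := hg t ht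
    rw [← evalFun_torus hσ, this, mul_zero]

lemma isOpen_principal {σ : Set ((Fin n → ℝ) × ℝ)} (hσ : σ ∈ P.fan)
    (f : AddMonoidAlgebra ℂ (dualMonoid σ)) : IsOpen {y : P.Total | y ∈ chart σ ∧ evalFun f y ≠ 0} :=
  isOpen_generateFrom_of_mem ⟨σ, hσ, f, rfl⟩

lemma evalFun_one {σ : Set ((Fin n → ℝ) × ℝ)} {y : P.Total} (hy : y ∈ chart σ) :
    evalFun (1 : AddMonoidAlgebra ℂ (dualMonoid σ)) y = 1 := by
  simp [evalFun, hy]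

lemma isOpen_chart {σ : Set ((Fin n → ℝ) × ℝ)} (hσ : σ ∈ P.fan) :
    IsOpen (chart σ : Set P.Total) := by
  convert isOpen_principal (P := P) hσ 1 using 1
  ext y
  constructor
  · intro hy
    exact ⟨hy, by rw [evalFun_one hy]; exact one_ne_zero⟩
  · exact fun h => h.1

lemma dualMonoid_le {σ : Set ((Fin n → ℝ) × ℝ)} {x : P.Total} (hx : x ∈ chart σ) :
    dualMonoid σ ≤ dualMonoid x.cone := fun _ hm y hy => hm y (cone_subset hx hy)

/-- Restriction of functions to a smaller chart. -/
def restrict {σ : Set ((Fin n → ℝ) × ℝ)} {x : P.Total} (hx : x ∈ chart σ) :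
    AddMonoidAlgebra ℂ (dualMonoid σ) →ₐ[ℂ] AddMonoidAlgebra ℂ (dualMonoid x.cone) :=
  AddMonoidAlgebra.mapDomainAlgHom ℂ ℂ (AddSubmonoid.inclusion (dualMonoid_le hx))

lemma evalFun_restrict {σ : Set ((Fin n → ℝ) × ℝ)} {x y : P.Total} (hx : x ∈ chart σ)
    (hy : y ∈ chart σ) (hy' : y ∈ chart x.cone) (f : AddMonoidAlgebra ℂ (dualMonoid σ)) :
    evalFun (restrict hx f) y = evalFun f y := by
  induction f using AddMonoidAlgebra.induction_linear with
  | zero => simp [evalFun]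
  | add f g hf hg => rw [map_add, evalFun_add hy', evalFun_add hy, hf, hg]
  | single m a =>
    have : restrict hx (AddMonoidAlgebra.single m a) =
        AddMonoidAlgebra.single (AddSubmonoid.inclusion (dualMonoid_le hx) m) a := by
      simp [restrict]
    rw [this, evalFun_single hy, evalFun_single hy']
    rfl

lemma eventually_chart {σ : Set ((Fin n → ℝ) × ℝ)} (hσ : σ ∈ P.fan) {x : P.Total}
    (hx : x ∈ chart σ) : ∀ᶠ y in 𝓝 x, y ∈ chart σ := (isOpen_chart hσ).mem_nhds hx

/-- A quotient of elements of the coordinate ring of a chart is regular at the points of the chart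
where the denominator does not vanish. -/
lemma div_mem_stalk {σ : Set ((Fin n → ℝ) × ℝ)} (hσ : σ ∈ P.fan) {x : P.Total} (hx : x ∈ chart σ)
    (f h : AddMonoidAlgebra ℂ (dualMonoid σ)) (hh : evalFun h x ≠ 0) :
    ((fun y => evalFun f y / evalFun h y : P.Total → ℂ) : (𝓝 x).Germ ℂ) ∈ Stalk x := by
  refine ⟨restrict hx f, restrict hx h, ?_, ?_⟩
  · rwa [evalFun_restrict hx hx (mem_chart_self x)]
  · apply Filter.Germ.coe_eq.mpr
    filter_upwards [eventually_chart hσ hx, eventually_chart x.mem (mem_chart_self x)] with y hy hy'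
    rw [evalFun_restrict hx hy hy', evalFun_restrict hx hy hy']

lemma evalFun_mem_stalk {σ : Set ((Fin n → ℝ) × ℝ)} (hσ : σ ∈ P.fan) {x : P.Total}
    (hx : x ∈ chart σ) (f : AddMonoidAlgebra ℂ (dualMonoid σ)) :
    ((evalFun f : P.Total → ℂ) : (𝓝 x).Germ ℂ) ∈ Stalk x := by
  have := div_mem_stalk hσ hx f 1 (by rw [evalFun_one hx]; exact one_ne_zero)
  convert this using 1
  apply Filter.Germ.coe_eq.mpr
  filter_upwards [eventually_chart hσ hx] with y hy
  rw [evalFun_one hy, div_one]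

/-- The germ at `x` of a function on a chart. -/
def toStalk {σ : Set ((Fin n → ℝ) × ℝ)} (hσ : σ ∈ P.fan) {x : P.Total} (hx : x ∈ chart σ) :
    AddMonoidAlgebra ℂ (dualMonoid σ) →ₐ[ℂ] Stalk x where
  toFun f := ⟨_, evalFun_mem_stalk hσ hx f⟩
  map_one' := by
    apply Subtype.ext
    apply Filter.Germ.coe_eq.mpr
    filter_upwards [eventually_chart hσ hx] with y hy
    exact evalFun_one hy
  map_mul' f g := by
    apply Subtype.ext
    apply Filter.Germ.coe_eq.mpr
    filter_upwards [eventually_chart hσ hx] with y hy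
    exact evalFun_mul hy f g
  map_zero' := by
    apply Subtype.ext
    apply Filter.Germ.coe_eq.mpr
    filter_upwards [eventually_chart hσ hx] with y hy
    simp [evalFun]
  map_add' f g := by
    apply Subtype.ext
    apply Filter.Germ.coe_eq.mpr
    filter_upwards [eventually_chart hσ hx] with y hy
    exact evalFun_add hy f g
  commutes' r := by
    apply Subtype.ext
    change _ = algebraMap ℂ ((𝓝 x).Germ ℂ) r
    rw [Algebra.algebraMap_eq_smul_one]
    apply Filter.Germ.coe_eq.mpr
    filter_upwards [eventually_chart hσ hx] with y hy
    simp [evalFun, hy]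

lemma toStalk_injective {σ : Set ((Fin n → ℝ) × ℝ)} (hσ : σ ∈ P.fan) {x : P.Total}
    (hx : x ∈ chart σ) : Function.Injective (toStalk hσ hx) := by
  rw [injective_iff_map_eq_zero]
  intro f hf
  refine eq_zero_of_eventually hσ (x := x) ?_
  exact Filter.Germ.coe_eq.mp (congrArg Subtype.val hf)

lemma isUnit_toStalk {σ : Set ((Fin n → ℝ) × ℝ)} (hσ : σ ∈ P.fan) {x : P.Total} (hx : x ∈ chart σ)
    {f : AddMonoidAlgebra ℂ (dualMonoid σ)} (hf : evalFun f x ≠ 0) : IsUnit (toStalk hσ hx f) := by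
  refine IsUnit.of_mul_eq_one ⟨_, div_mem_stalk hσ hx 1 f hf⟩ ?_
  apply Subtype.ext
  apply Filter.Germ.coe_eq.mpr
  filter_upwards [(isOpen_principal hσ f).mem_nhds ⟨hx, hf⟩] with y hy
  change evalFun f y * (evalFun 1 y / evalFun f y) = 1
  rw [evalFun_one hy.1, mul_one_div_cancel hy.2]

lemma toStalk_restrict {σ : Set ((Fin n → ℝ) × ℝ)} (hσ : σ ∈ P.fan) {x : P.Total}
    (hx : x ∈ chart σ) (f : AddMonoidAlgebra ℂ (dualMonoid σ)) :
    toStalk x.mem (mem_chart_self x) (restrict hx f) = toStalk hσ hx f := by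
  apply Subtype.ext
  apply Filter.Germ.coe_eq.mpr
  filter_upwards [eventually_chart hσ hx, eventually_chart x.mem (mem_chart_self x)] with y hy hy'
  exact evalFun_restrict hx hy hy' f

/-- The coordinate functions at `x`. -/
abbrev coordStalk (x : P.Total) : AddMonoidAlgebra ℂ (dualMonoid x.cone) →ₐ[ℂ] Stalk x :=
  toStalk x.mem (mem_chart_self x)

/-- The cross multiplied form keeps later computations inside the local ring, where the germ of `B`
is a unit. -/
lemma exists_fraction {x : P.Total} (g : Stalk x) :
    ∃ A B : AddMonoidAlgebra ℂ (dualMonoid x.cone), evalFun B x ≠ 0 ∧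
      g * coordStalk x B = coordStalk x A := by
  obtain ⟨g, A, B, hB, rfl⟩ := g
  refine ⟨A, B, hB, ?_⟩
  apply Subtype.ext
  apply Filter.Germ.coe_eq.mpr
  filter_upwards [nhds_principal hB] with y hy
  exact div_mul_cancel₀ _ hy.2

/-- The germ of the monomial `χ^m`. -/
def monomialGerm {x : P.Total} {m : Char n} (hm : m ∈ dualMonoid x.cone) : Stalk x :=
  coordStalk x (AddMonoidAlgebra.single ⟨m, hm⟩ 1)

lemma coe_monomialGerm {x : P.Total} {m : Char n} (hm : m ∈ dualMonoid x.cone) :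
    ((monomialGerm hm : Stalk x) : (𝓝 x).Germ ℂ) = (monomial m : P.Total → ℂ) := by
  apply Filter.Germ.coe_eq.mpr
  filter_upwards [eventually_chart x.mem (mem_chart_self x)] with y hy
  rw [evalFun_single hy, one_mul]

lemma monomialGerm_add {x : P.Total} {m m' : Char n} (hm : m ∈ dualMonoid x.cone)
    (hm' : m' ∈ dualMonoid x.cone) :
    monomialGerm (add_mem hm hm') = monomialGerm hm * monomialGerm hm' := by
  rw [monomialGerm, monomialGerm, monomialGerm, ← map_mul, AddMonoidAlgebra.single_mul_single,
    one_mul]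
  rfl

/-- The monomials are not zero divisors. -/
lemma monomialGerm_mul_cancel {x : P.Total} {m : Char n} (hm : m ∈ dualMonoid x.cone) {g h : Stalk x}
    (e : monomialGerm hm * g = monomialGerm hm * h) : g = h := by
  rw [← sub_eq_zero]
  have e' : monomialGerm hm * (g - h) = 0 := by rw [mul_sub, e, sub_self]
  obtain ⟨A, B, hB, hAB⟩ := exists_fraction (g - h)
  have h1 : coordStalk x (AddMonoidAlgebra.single ⟨m, hm⟩ 1 * A) = 0 := by
    rw [map_mul, ← hAB, ← mul_assoc]
    change monomialGerm hm * (g - h) * _ = 0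
    rw [e', zero_mul]
  have h2 := toStalk_injective x.mem (mem_chart_self x) (h1.trans (map_zero _).symm)
  have h3 : A = 0 := (mul_eq_zero.mp h2).resolve_left (by simp)
  rw [h3, map_zero] at hAB
  exact (isUnit_toStalk x.mem (mem_chart_self x) hB).mul_left_eq_zero.mp hAB

end PolyDecomp.Total

/-! ### Extension of homomorphisms and bases from unique expansions -/

/-- A homomorphism on a submonoid which generates a group in a strong sense extends. -/
lemma exists_extension {G A : Type} [AddCommGroup G] [AddCommGroup A] {S : AddSubmonoid G} {m₀ : G}
    (h₀ : m₀ ∈ S) (h : ∀ m, ∃ k : ℕ, m + k • m₀ ∈ S) (q : S →+ A) :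
    ∃ Q : G →+ A, ∀ m : S, Q m = q m := by
  choose k hk using h
  have hk0 : ∀ l : ℕ, l • m₀ ∈ S := fun l => S.nsmul_mem h₀ l
  have hq0 : ∀ l : ℕ, q ⟨l • m₀, hk0 l⟩ = l • q ⟨m₀, h₀⟩ := fun l => by
    rw [← map_nsmul]
    rfl
  -- The value `q (m + l • m₀) - l • q m₀` does not depend on `l`; hence the chosen `k m` may be
  -- replaced by any admissible multiple.
  have key : ∀ (m : G) (l : ℕ) (hl : m + l • m₀ ∈ S),
      q ⟨m + k m • m₀, hk m⟩ - k m • q ⟨m₀, h₀⟩ = q ⟨m + l • m₀, hl⟩ - l • q ⟨m₀, h₀⟩ := by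
    intro m l hl
    rw [sub_eq_sub_iff_add_eq_add, ← hq0, ← hq0, ← map_add, ← map_add]
    congr 1
    apply Subtype.ext
    change m + k m • m₀ + l • m₀ = m + l • m₀ + k m • m₀
    abel
  refine ⟨AddMonoidHom.mk' (fun m => q ⟨m + k m • m₀, hk m⟩ - k m • q ⟨m₀, h₀⟩) ?_, ?_⟩
  · intro m m'
    have hmem : (m + m') + (k m + k m') • m₀ ∈ S := by
      have := S.add_mem (hk m) (hk m')
      convert this using 1
      rw [add_smul]
      abel
    rw [key (m + m') (k m + k m') hmem, sub_add_sub_comm, ← map_add, ← add_smul]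
    congr 2
    apply Subtype.ext
    change m + m' + (k m + k m') • m₀ = m + k m • m₀ + (m' + k m' • m₀)
    rw [add_smul]
    abel
  · intro m
    change q ⟨m + k m • m₀, hk m⟩ - k m • q ⟨m₀, h₀⟩ = q m
    rw [key m 0 (by simp)]
    simp

/-- A family such that every element is uniquely a linear combination is a basis. -/
def basisOfExistsUnique {ι R M : Type} [Fintype ι] [CommSemiring R] [AddCommMonoid M] [Module R M]
    (v : ι → M) (h : ∀ q q' : ι → R, ∑ j, q j • v j = ∑ j, q' j • v j → q = q')
    (h' : ∀ x, ∃ q : ι → R, x = ∑ j, q j • v j) : Module.Basis ι R M :=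
  Module.Basis.ofEquivFun (LinearEquiv.ofBijective (Fintype.linearCombination R v)
    ⟨fun q q' e => h q q' (by simpa [Fintype.linearCombination_apply] using e), fun x => by
      obtain ⟨q, hq⟩ := h' x
      exact ⟨q, by rw [hq, Fintype.linearCombination_apply]⟩⟩).symm

lemma basisOfExistsUnique_apply {ι R M : Type} [Fintype ι] [CommSemiring R] [AddCommMonoid M]
    [Module R M] (v : ι → M) (h : ∀ q q' : ι → R, ∑ j, q j • v j = ∑ j, q' j • v j → q = q')
    (h' : ∀ x, ∃ q : ι → R, x = ∑ j, q j • v j) (j : ι) : basisOfExistsUnique v h h' j = v j := by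
  classical
  simp only [basisOfExistsUnique, Module.Basis.coe_ofEquivFun, LinearEquiv.symm_symm]
  exact (Fintype.linearCombination_apply_single R v j 1).trans (one_smul R _)

lemma eq_sum_single_smul {ι R M : Type} [Fintype ι] [DecidableEq ι] [CommSemiring R]
    [AddCommMonoid M] [Module R M] (v : ι → M) (k : ι) :
    v k = ∑ i, (Pi.single k 1 : ι → R) i • v i := by
  simp [Pi.single_apply, ite_smul]

/-! ### Logarithmic derivations of the local rings -/

namespace PolyDecomp.Total

variable {n : ℕ} {P : PolyDecomp n}

/-- The derivation of the coordinate ring given by a homomorphism on the characters. -/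
abbrev coordDeriv (σ : Set ((Fin n → ℝ) × ℝ)) (c : Char n →+ ℂ) :
    AddMonoidAlgebra ℂ (dualMonoid σ) →ₗ[ℂ] AddMonoidAlgebra ℂ (dualMonoid σ) :=
  logDeriv (c.comp (dualMonoid σ).subtype)

/-- The quotient rule `d = (A' - g * B') / B` for `g = A / B`. One `d` serves all representations,
as differentiating `A * B' = A' * B` for two of them shows; here the primes denote the second
representation. -/
lemma exists_stalkDeriv (x : P.Total) (c : Char n →+ ℂ) (g : Stalk x) :
    ∃ d : Stalk x, ∀ A B : AddMonoidAlgebra ℂ (dualMonoid x.cone), evalFun B x ≠ 0 →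
      g * coordStalk x B = coordStalk x A →
      d * coordStalk x B = coordStalk x (coordDeriv x.cone c A) -
        g * coordStalk x (coordDeriv x.cone c B) := by
  obtain ⟨A, B, hB, h⟩ := exists_fraction g
  obtain ⟨u, hu⟩ := isUnit_toStalk x.mem (mem_chart_self x) hB
  refine ⟨(coordStalk x (coordDeriv x.cone c A) - g * coordStalk x (coordDeriv x.cone c B)) *
    ((u⁻¹ : (Stalk x)ˣ) : Stalk x), fun A' B' hB' h' => ?_⟩
  have hc : A * B' = A' * B := by
    apply toStalk_injective x.mem (mem_chart_self x)
    rw [map_mul, map_mul, ← h, ← h']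
    ring
  have hd := congrArg (fun f => coordStalk x (coordDeriv x.cone c f)) hc
  simp only [logDeriv_mul, map_add, map_mul] at hd
  rw [← h, ← h'] at hd
  rw [← hu] at hd
  have hu' : (u : Stalk x) * ((u⁻¹ : (Stalk x)ˣ) : Stalk x) = 1 := u.mul_inv
  linear_combination ((u⁻¹ : (Stalk x)ˣ) : Stalk x) * hd + (coordStalk x (coordDeriv x.cone c A') -
    g * coordStalk x (coordDeriv x.cone c B')) * hu'

/-- The derivation `χ^m ↦ c(m) χ^m` of the local ring, as a function. -/
def stalkDerivFun (x : P.Total) (c : Char n →+ ℂ) (g : Stalk x) : Stalk x :=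
  (exists_stalkDeriv x c g).choose

lemma stalkDerivFun_spec {x : P.Total} (c : Char n →+ ℂ) {g : Stalk x}
    {A B : AddMonoidAlgebra ℂ (dualMonoid x.cone)} (hB : evalFun B x ≠ 0)
    (h : g * coordStalk x B = coordStalk x A) :
    stalkDerivFun x c g * coordStalk x B = coordStalk x (coordDeriv x.cone c A) -
      g * coordStalk x (coordDeriv x.cone c B) :=
  (exists_stalkDeriv x c g).choose_spec A B hB h

lemma evalFun_mul_ne_zero {x : P.Total} {B B' : AddMonoidAlgebra ℂ (dualMonoid x.cone)}
    (hB : evalFun B x ≠ 0) (hB' : evalFun B' x ≠ 0) : evalFun (B * B') x ≠ 0 := by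
  rw [evalFun_mul (mem_chart_self x)]
  exact mul_ne_zero hB hB'

lemma cancel_coordStalk {x : P.Total} {B : AddMonoidAlgebra ℂ (dualMonoid x.cone)}
    (hB : evalFun B x ≠ 0) {g h : Stalk x} (e : g * coordStalk x B = h * coordStalk x B) : g = h :=
  (isUnit_toStalk x.mem (mem_chart_self x) hB).mul_right_cancel e

/-- The derivation `χ^m ↦ c(m) χ^m` of the local ring. -/
def stalkDeriv (x : P.Total) (c : Char n →+ ℂ) : Derivation ℂ (Stalk x) (Stalk x) :=
  Derivation.mk'
    { toFun := stalkDerivFun x c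
      map_add' := by
        intro g g'
        obtain ⟨A, B, hB, h⟩ := exists_fraction g
        obtain ⟨A', B', hB', h'⟩ := exists_fraction g'
        apply cancel_coordStalk (evalFun_mul_ne_zero hB hB')
        rw [stalkDerivFun_spec (A := A * B' + A' * B) c (evalFun_mul_ne_zero hB hB') (by
          rw [map_mul, map_add, map_mul, map_mul, ← h, ← h']
          ring)]
        have e := stalkDerivFun_spec c hB h
        have e' := stalkDerivFun_spec c hB' h'
        simp only [logDeriv_mul, map_add, map_mul]
        rw [← h, ← h']
        linear_combination (-coordStalk x B') * e - coordStalk x B * e'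
      map_smul' := by
        intro r g
        obtain ⟨A, B, hB, h⟩ := exists_fraction g
        apply cancel_coordStalk hB
        rw [stalkDerivFun_spec (A := r • A) c hB (by rw [map_smul, ← h, smul_mul_assoc])]
        rw [RingHom.id_apply, smul_mul_assoc r (stalkDerivFun x c g), stalkDerivFun_spec c hB h,
          map_smul, map_smul, smul_mul_assoc, smul_sub] }
    (by
      intro g g'
      change stalkDerivFun x c (g * g') = g * stalkDerivFun x c g' + g' * stalkDerivFun x c g
      obtain ⟨A, B, hB, h⟩ := exists_fraction g
      obtain ⟨A', B', hB', h'⟩ := exists_fraction g'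
      apply cancel_coordStalk (evalFun_mul_ne_zero hB hB')
      rw [stalkDerivFun_spec (A := A * A') c (evalFun_mul_ne_zero hB hB') (by
        rw [map_mul, map_mul, ← h, ← h']
        ring)]
      have e := stalkDerivFun_spec c hB h
      have e' := stalkDerivFun_spec c hB' h'
      simp only [logDeriv_mul, map_add, map_mul]
      rw [← h, ← h']
      linear_combination (-(g' * coordStalk x B')) * e - g * coordStalk x B * e')

lemma stalkDeriv_coordStalk (x : P.Total) (c : Char n →+ ℂ)
    (A : AddMonoidAlgebra ℂ (dualMonoid x.cone)) :
    stalkDeriv x c (coordStalk x A) = coordStalk x (coordDeriv x.cone c A) := by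
  have h1 : evalFun (1 : AddMonoidAlgebra ℂ (dualMonoid x.cone)) x ≠ 0 := by
    rw [evalFun_one (mem_chart_self x)]
    exact one_ne_zero
  have h := stalkDerivFun_spec (A := A) (g := coordStalk x A) c h1 (by rw [map_one, mul_one])
  have h2 : coordDeriv x.cone c 1 = 0 := by
    rw [AddMonoidAlgebra.one_def, logDeriv_single, map_zero, zero_mul, AddMonoidAlgebra.single_zero]
  rw [map_one, mul_one, h2, map_zero, mul_zero, sub_zero] at h
  exact h

lemma stalkDeriv_toStalk {σ : Set ((Fin n → ℝ) × ℝ)} (hσ : σ ∈ P.fan) {x : P.Total}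
    (hx : x ∈ chart σ) (c : Char n →+ ℂ) (A : AddMonoidAlgebra ℂ (dualMonoid σ)) :
    stalkDeriv x c (toStalk hσ hx A) = toStalk hσ hx (coordDeriv σ c A) := by
  rw [← toStalk_restrict, stalkDeriv_coordStalk]
  refine Eq.trans ?_ (toStalk_restrict hσ hx (coordDeriv σ c A))
  exact congrArg (coordStalk x) (logDeriv_mapDomain (c.comp (dualMonoid x.cone).subtype)
    (AddSubmonoid.inclusion (dualMonoid_le hx)) A)

lemma stalkDeriv_monomialGerm {x : P.Total} (c : Char n →+ ℂ) {m : Char n}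
    (hm : m ∈ dualMonoid x.cone) :
    stalkDeriv x c (monomialGerm hm) = algebraMap ℂ (Stalk x) (c m) * monomialGerm hm := by
  rw [monomialGerm, stalkDeriv_coordStalk, logDeriv_single, ← Algebra.smul_def, ← map_smul,
    AddMonoidAlgebra.smul_single, smul_eq_mul]
  rfl

/-- The monomials span the coordinate ring, and the Leibniz rule forces the value on a fraction with
invertible denominator. -/
lemma derivation_ext {x : P.Total} {D D' : Derivation ℂ (Stalk x) (Stalk x)}
    (h : ∀ (m : Char n) (hm : m ∈ dualMonoid x.cone), D (monomialGerm hm) = D' (monomialGerm hm)) :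
    D = D' := by
  have key : ∀ A, D (coordStalk x A) = D' (coordStalk x A) := by
    intro A
    induction A using AddMonoidAlgebra.induction_linear with
    | zero => simp
    | add f g hf hg => rw [map_add, map_add, map_add, hf, hg]
    | single m a =>
      have : AddMonoidAlgebra.single m a = a • AddMonoidAlgebra.single m (1 : ℂ) := by
        rw [AddMonoidAlgebra.smul_single, smul_eq_mul, mul_one]
      rw [this, map_smul, Derivation.map_smul, Derivation.map_smul]
      exact congrArg _ (h m.1 m.2)
  ext1 g
  obtain ⟨A, B, hB, hAB⟩ := exists_fraction g
  apply cancel_coordStalk hB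
  have e := key A
  rw [← hAB, Derivation.leibniz, Derivation.leibniz, key B] at e
  simp only [smul_eq_mul] at e
  linear_combination e

/-- The `j`-th coordinate of a character. -/
def charCoord (j : Fin n) : Char n →+ ℂ :=
  (Int.castAddHom ℂ).comp ((Pi.evalAddMonoidHom (fun _ : Fin n => ℤ) j).comp (AddMonoidHom.fst _ _))

lemma charCoord_apply (j : Fin n) (m : Char n) : charCoord j m = (m.1 j : ℂ) := rfl

instance moduleLogTangentStalk (x : P.Total) : Module (Stalk x) (logTangentStalk x) :=
  Submodule.module (logTangentStalk x)

instance smulLogTangentStalk (x : P.Total) : SMul (Stalk x) (logTangentStalk x) :=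
  (moduleLogTangentStalk x).toSMul

lemma t_eq (x : P.Total) (f : Stalk x)
    (hf : (f : (𝓝 x).Germ ℂ) = ((t : P.Total → ℂ) : (𝓝 x).Germ ℂ)) :
    f = monomialGerm (P.t_mem_dualMonoid x.mem) :=
  Subtype.ext (hf.trans (coe_monomialGerm _).symm)

/-- The logarithmic vector field `χ^m ↦ m_j χ^m`. -/
def coordField (x : P.Total) (j : Fin n) : logTangentStalk x :=
  ⟨stalkDeriv x (charCoord j), by
    constructor
    · rintro f ⟨m, hm, u, hu⟩
      have hf : f = monomialGerm hm * u := Subtype.ext (by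
        rw [hu, ← coe_monomialGerm hm]
        rfl)
      rw [hf, Derivation.leibniz, stalkDeriv_monomialGerm]
      simp only [smul_eq_mul]
      have hu : (u : Stalk x) * ((u⁻¹ : (Stalk x)ˣ) : Stalk x) = 1 := u.mul_inv
      -- The logarithmic derivative of `χ^m * u`, namely `u⁻¹ * D u + m_j`.
      refine ⟨((u⁻¹ : (Stalk x)ˣ) : Stalk x) * stalkDeriv x (charCoord j) u +
        algebraMap ℂ (Stalk x) (charCoord j m), ?_⟩
      linear_combination (-monomialGerm hm * stalkDeriv x (charCoord j) u) * hu
    · intro f hf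
      -- The character of `t` is `(0, 1)`, whose `j`-th coordinate in `M` is zero.
      rw [t_eq x f hf, stalkDeriv_monomialGerm, charCoord_apply]
      simp⟩

lemma coordField_monomialGerm {x : P.Total} (j : Fin n) {m : Char n} (hm : m ∈ dualMonoid x.cone) :
    (coordField x j).1 (monomialGerm hm) = algebraMap ℂ (Stalk x) (m.1 j) * monomialGerm hm :=
  stalkDeriv_monomialGerm _ hm

lemma sum_coordField_monomialGerm {x : P.Total} (q : Fin n → Stalk x) {m : Char n}
    (hm : m ∈ dualMonoid x.cone) :
    (∑ j, q j • coordField x j).1 (monomialGerm hm) =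
      monomialGerm hm * ∑ j, algebraMap ℂ (Stalk x) (m.1 j) * q j := by
  have hsum : ∀ D : Fin n → Derivation ℂ (Stalk x) (Stalk x),
      (∑ j, D j) (monomialGerm hm) = ∑ j, D j (monomialGerm hm) := fun D =>
    (congrFun (map_sum Derivation.coeFnAddMonoidHom D Finset.univ) _).trans
      (Finset.sum_apply _ _ _)
  rw [Submodule.coe_sum, hsum, Finset.mul_sum]
  refine Finset.sum_congr rfl fun j _ => ?_
  change q j * (coordField x j).1 (monomialGerm hm) = _
  rw [coordField_monomialGerm]
  ring

/-- Two vectors which have the same pairing with sufficiently many characters are equal. -/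
lemma eq_of_pairing_eq {x : P.Total} {q q' : Fin n → Stalk x} {m₀ : Char n} {k : Fin n → ℕ}
    (h₀ : ∑ j, algebraMap ℂ (Stalk x) (m₀.1 j) * q j = ∑ j, algebraMap ℂ (Stalk x) (m₀.1 j) * q' j)
    (h : ∀ i, ∑ j, algebraMap ℂ (Stalk x) ((((Pi.single i 1, 0) : Char n) + k i • m₀).1 j) * q j =
      ∑ j, algebraMap ℂ (Stalk x) ((((Pi.single i 1, 0) : Char n) + k i • m₀).1 j) * q' j) :
    q = q' := by
  classical
  funext i
  -- Pairing with the shifted character yields the `i`-th entry plus `k i` times the pairing with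
  -- `m₀`, which is already known.
  have expand : ∀ r : Fin n → Stalk x,
      ∑ j, algebraMap ℂ (Stalk x) ((((Pi.single i 1, 0) : Char n) + k i • m₀).1 j) * r j =
      r i + k i * ∑ j, algebraMap ℂ (Stalk x) (m₀.1 j) * r j := by
    intro r
    have : ∀ j, algebraMap ℂ (Stalk x) ((((Pi.single i 1, 0) : Char n) + k i • m₀).1 j) * r j =
        (if j = i then r j else 0) + k i * (algebraMap ℂ (Stalk x) (m₀.1 j) * r j) := by
      intro j
      have e : (((Pi.single i 1, 0) : Char n) + k i • m₀).1 j =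
          (if j = i then 1 else 0) + k i * m₀.1 j := by
        rw [← Pi.single_apply, ← nsmul_eq_mul]
        rfl
      rw [e, Int.cast_add, Int.cast_mul, Int.cast_natCast, map_add, map_mul, map_natCast]
      split_ifs
      · rw [Int.cast_one, map_one]
        ring
      · rw [Int.cast_zero, map_zero]
        ring
    simp only [this, Finset.sum_add_distrib, Finset.sum_ite_eq', Finset.mem_univ, if_true,
      Finset.mul_sum]
  have := h i
  rw [expand, expand, h₀] at this
  exact add_right_cancel this

/-- The basis characters of `M` need not be regular at `x`, but become so after adding multiples of
`m₀`. With `m₀` they are finitely many regular monomials which detect all coefficients. -/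
lemma exists_generators (x : P.Total) : ∃ m₀ ∈ dualMonoid x.cone, ∃ k : Fin n → ℕ,
    ∀ i, ((Pi.single i 1, 0) : Char n) + k i • m₀ ∈ dualMonoid x.cone := by
  obtain ⟨m₀, h₀, h⟩ := P.exists_add_mem_dualMonoid x.mem
  exact ⟨m₀, h₀, fun i => (h (Pi.single i 1, 0)).choose, fun i => (h _).choose_spec⟩

lemma coordField_injective (x : P.Total) {q q' : Fin n → Stalk x}
    (h : ∑ j, q j • coordField x j = ∑ j, q' j • coordField x j) : q = q' := by
  obtain ⟨m₀, h₀, k, hk⟩ := exists_generators x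
  have key : ∀ (m : Char n) (hm : m ∈ dualMonoid x.cone),
      ∑ j, algebraMap ℂ (Stalk x) (m.1 j) * q j = ∑ j, algebraMap ℂ (Stalk x) (m.1 j) * q' j := by
    intro m hm
    apply monomialGerm_mul_cancel hm
    rw [← sum_coordField_monomialGerm, ← sum_coordField_monomialGerm, h]
  exact eq_of_pairing_eq (key m₀ h₀) fun i => key _ (hk i)

lemma monomialGerm_mem_logStructure {x : P.Total} {m : Char n} (hm : m ∈ dualMonoid x.cone) :
    monomialGerm hm ∈ logStructure x := by
  refine ⟨m, hm, 1, ?_⟩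
  rw [coe_monomialGerm]
  exact (mul_one _).symm

/-- The quotients `q m = D χ^m / χ^m` are additive on the dual monoid by the Leibniz rule. The dual
monoid generates the character lattice, so they extend to a homomorphism `Q` on `M × ℤ`. Since `Q`
kills the character of `t`, its values on the `n` basis characters of `M` are the coefficients of
`D`. -/
lemma exists_coordField_sum (x : P.Total) (D : logTangentStalk x) :
    ∃ q : Fin n → Stalk x, D = ∑ j, q j • coordField x j := by
  classical
  obtain ⟨m₀, h₀, hk⟩ := P.exists_add_mem_dualMonoid x.mem
  choose q hq using fun m : dualMonoid x.cone =>
    D.2.1 (monomialGerm m.2) (monomialGerm_mem_logStructure m.2)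
  have hadd : ∀ m m', q (m + m') = q m + q m' := by
    intro m m'
    apply monomialGerm_mul_cancel (m + m').2
    have h1 := hq (m + m')
    have h2 : monomialGerm (m + m').2 = monomialGerm m.2 * monomialGerm m'.2 :=
      monomialGerm_add m.2 m'.2
    rw [← h1, h2, Derivation.leibniz, hq m, hq m']
    simp only [smul_eq_mul]
    ring
  obtain ⟨Q, hQ⟩ := exists_extension h₀ hk (AddMonoidHom.mk' q hadd)
  have hQt : Q (0, 1) = 0 := by
    have ht := P.t_mem_dualMonoid x.mem
    refine (hQ ⟨(0, 1), ht⟩).trans ?_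
    apply monomialGerm_mul_cancel ht
    rw [mul_zero]
    refine (hq ⟨(0, 1), ht⟩).symm.trans ?_
    exact D.2.2 _ (coe_monomialGerm ht)
  have hQm : ∀ m : Char n, Q m = ∑ j, algebraMap ℂ (Stalk x) (m.1 j) * Q (Pi.single j 1, 0) := by
    intro m
    have e : m = ∑ j, m.1 j • ((Pi.single j 1, 0) : Char n) + m.2 • ((0, 1) : Char n) := by
      ext i
      · simp [Prod.fst_sum, Finset.sum_apply, Pi.single_apply]
      · simp [Prod.snd_sum]
    conv_lhs => rw [e]
    rw [map_add, map_zsmul, hQt, zsmul_zero, add_zero, map_sum]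
    refine Finset.sum_congr rfl fun j _ => ?_
    rw [map_zsmul, map_intCast, zsmul_eq_mul]
  refine ⟨fun j => Q (Pi.single j 1, 0), Subtype.ext (derivation_ext fun m hm => ?_)⟩
  rw [sum_coordField_monomialGerm, ← hQm]
  refine (hq ⟨m, hm⟩).trans ?_
  rw [← show q ⟨m, hm⟩ = Q m from (hQ ⟨m, hm⟩).symm]

/-- The logarithmic tangent sheaf is free. -/
def logBasis (x : P.Total) : Module.Basis (Fin n) (Stalk x) (logTangentStalk x) :=
  basisOfExistsUnique (coordField x) (fun _ _ h => coordField_injective x h)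
    (exists_coordField_sum x)

lemma logBasis_apply (x : P.Total) (j : Fin n) : logBasis x j = coordField x j :=
  basisOfExistsUnique_apply _ _ _ _

/-- The coordinate vector fields are global sections of the logarithmic tangent sheaf. -/
lemma isLogField_coordField (U : Opens P.Total) (j : Fin n) :
    IsLogField U fun x => coordField x.1 j := by
  classical
  intro V hV f hf
  let d : (x : P.Total) → x ∈ V → Stalk x := fun x hx =>
    stalkDeriv x (charCoord j) ⟨(f : (𝓝 x).Germ ℂ), hf x hx⟩
  -- The pointwise value of the derivative; the task is to show that its germs are the derivatives
  -- themselves.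
  let g : P.Total → ℂ := fun x => if hx : x ∈ V then (d x hx : (𝓝 x).Germ ℂ).value else 0
  have key : ∀ (x : P.Total) (hx : x ∈ V), ((d x hx : Stalk x) : (𝓝 x).Germ ℂ) = g := by
    intro x hx
    obtain ⟨A, B, hB, hAB⟩ := exists_fraction (⟨(f : (𝓝 x).Germ ℂ), hf x hx⟩ : Stalk x)
    have hev : ∀ᶠ y in 𝓝 x, f y * evalFun B y = evalFun A y :=
      Filter.Germ.coe_eq.mp (congrArg Subtype.val hAB)
    -- The fraction `A / B` represents `f` at all points `y` near `x`, and the derivations on both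
    -- stalks come from the same formula on the chart. Evaluating the quotient rule at `y` gives the
    -- identity of functions.
    have hval : ∀ᶠ y in 𝓝 x, g y * evalFun B y = evalFun (coordDeriv x.cone (charCoord j) A) y -
        f y * evalFun (coordDeriv x.cone (charCoord j) B) y := by
      filter_upwards [hev.eventually_nhds, nhds_principal hB, V.isOpen.mem_nhds hx] with y h1 h2 h3
      have e : (⟨(f : (𝓝 y).Germ ℂ), hf y h3⟩ : Stalk y) * toStalk x.mem h2.1 B =
          toStalk x.mem h2.1 A := Subtype.ext (Filter.Germ.coe_eq.mpr h1)
      have e' := congrArg (stalkDeriv y (charCoord j)) e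
      rw [Derivation.leibniz, stalkDeriv_toStalk, stalkDeriv_toStalk] at e'
      have e2 := congrArg (fun s : Stalk y => Filter.Germ.valueRingHom (s : (𝓝 y).Germ ℂ)) e'
      simp only [smul_eq_mul] at e2
      have e3 : f y * evalFun (coordDeriv x.cone (charCoord j) B) y +
          evalFun B y * (d y h3 : (𝓝 y).Germ ℂ).value =
          evalFun (coordDeriv x.cone (charCoord j) A) y := by
        refine Eq.trans ?_ e2
        change _ = Filter.Germ.valueRingHom (_ + _ : (𝓝 y).Germ ℂ)
        rw [map_add]
        change _ = Filter.Germ.valueRingHom (_ * _ : (𝓝 y).Germ ℂ) +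
          Filter.Germ.valueRingHom (_ * _ : (𝓝 y).Germ ℂ)
        rw [map_mul, map_mul]
        rfl
      have hgy : g y = (d y h3 : (𝓝 y).Germ ℂ).value := dif_pos h3
      rw [hgy]
      linear_combination e3
    -- Both germs satisfy the same quotient rule with denominator `B`, which is a unit at `x`.
    have hg : (g : (𝓝 x).Germ ℂ) * (coordStalk x B : (𝓝 x).Germ ℂ) =
        (d x hx : (𝓝 x).Germ ℂ) * (coordStalk x B : (𝓝 x).Germ ℂ) := by
      have h1 := stalkDerivFun_spec (charCoord j) hB hAB
      have h2 : ((d x hx * coordStalk x B : Stalk x) : (𝓝 x).Germ ℂ) = _ := congrArg Subtype.val h1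
      refine Eq.trans ?_ h2.symm
      exact Filter.Germ.coe_eq.mpr hval
    obtain ⟨u, hu⟩ := isUnit_toStalk x.mem (mem_chart_self x) hB
    have hu' : ((coordStalk x B : Stalk x) : (𝓝 x).Germ ℂ) *
        (((u⁻¹ : (Stalk x)ˣ) : Stalk x) : (𝓝 x).Germ ℂ) = 1 := by
      rw [← hu]
      exact congrArg Subtype.val u.mul_inv
    have := congrArg (· * (((u⁻¹ : (Stalk x)ˣ) : Stalk x) : (𝓝 x).Germ ℂ)) hg
    simp only [mul_assoc, hu', mul_one] at this
    exact this.symm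
  refine ⟨g, fun x hx => ?_, key⟩
  rw [← key x hx]
  exact (d x hx).2

/-- A germ of a regular function is represented by a regular function on a neighbourhood. -/
lemma exists_regular_rep {x : P.Total} (q : Stalk x) :
    ∃ (g : P.Total → ℂ) (V : Opens P.Total), x ∈ V ∧ IsRegularOn g (V : Set P.Total) ∧
      (q : (𝓝 x).Germ ℂ) = g := by
  obtain ⟨q, A, B, hB, rfl⟩ := q
  exact ⟨_, ⟨_, isOpen_principal x.mem B⟩, ⟨mem_chart_self x, hB⟩,
    fun y hy => div_mem_stalk x.mem hy.1 A B hy.2, rfl⟩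

/-- A logarithmic vector field is locally a combination of the coordinate vector fields with
regular coefficients. -/
lemma IsLogField.exists_coefficients {U : Opens P.Total} {θ : (x : U) → logTangentStalk x.1}
    (hθ : IsLogField U θ) {x : P.Total} (hx : x ∈ U) :
    ∃ (V : Opens P.Total) (hV : V ≤ U) (g : Fin n → P.Total → ℂ)
      (hg : ∀ j, IsRegularOn (g j) (V : Set P.Total)), x ∈ V ∧
      ∀ (y : P.Total) (hy : y ∈ V), θ ⟨y, hV hy⟩ =
        ∑ j, (⟨(g j : (𝓝 y).Germ ℂ), hg j y hy⟩ : Stalk y) • coordField y j := by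
  obtain ⟨m₀, h₀, k, hk⟩ := exists_generators x
  -- The coefficients at `x` are spread out to functions `g j`; it remains to see that these are the
  -- coefficients of `θ` at nearby points as well.
  obtain ⟨q, hq⟩ := exists_coordField_sum x (θ ⟨x, hx⟩)
  choose g V₁ hxV₁ hg hqg using fun j => exists_regular_rep (q j)
  let V₀ : Opens P.Total := U ⊓ ⟨_, isOpen_chart x.mem⟩
  have hxV₀ : x ∈ V₀ := ⟨hx, mem_chart_self x⟩
  -- The field maps `χ^m` to a single regular function `G`. Its germ at `x` is `χ^m` times the
  -- pairing of `m` with `g`; equality of germs persists nearby, and the monomial cancels.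
  have key : ∀ m ∈ dualMonoid x.cone, ∀ᶠ y in 𝓝 x, ∀ (hyU : y ∈ U) (hy : ∀ j, y ∈ V₁ j),
      ∀ q' : Fin n → Stalk y, θ ⟨y, hyU⟩ = ∑ j, q' j • coordField y j →
      ∑ j, algebraMap ℂ (Stalk y) (m.1 j) * q' j =
        ∑ j, algebraMap ℂ (Stalk y) (m.1 j) * ⟨(g j : (𝓝 y).Germ ℂ), hg j y (hy j)⟩ := by
    intro m hm
    have hmreg : ∀ y ∈ V₀, ((monomial m : P.Total → ℂ) : (𝓝 y).Germ ℂ) ∈ Stalk y := fun y hy => by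
      rw [← coe_monomialGerm (dualMonoid_le hy.2 hm)]
      exact (monomialGerm _).2
    have hmeq : ∀ (y : P.Total) (hy : y ∈ V₀), (⟨_, hmreg y hy⟩ : Stalk y) =
        monomialGerm (dualMonoid_le hy.2 hm) := fun y hy => Subtype.ext (coe_monomialGerm _).symm
    obtain ⟨G, hG, hθG⟩ := hθ V₀ inf_le_left (monomial m) hmreg
    have hcoe : ∀ (y : P.Total) (r : Fin n → Stalk y) (r' : Fin n → P.Total → ℂ),
        (∀ j, (r j : (𝓝 y).Germ ℂ) = r' j) → ∀ (hm' : m ∈ dualMonoid y.cone),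
        ((monomialGerm hm' * ∑ j, algebraMap ℂ (Stalk y) (m.1 j) * r j : Stalk y) : (𝓝 y).Germ ℂ) =
        (fun z => monomial m z * ∑ j, (m.1 j : ℂ) * r' j z : P.Total → ℂ) := by
      intro y r r' hr hm'
      have hsum : ((∑ j, algebraMap ℂ (Stalk y) (m.1 j) * r j : Stalk y) : (𝓝 y).Germ ℂ) =
          (fun z => ∑ j, (m.1 j : ℂ) * r' j z : P.Total → ℂ) := by
        rw [AddSubmonoidClass.coe_finsetSum]
        have : ∀ j, ((algebraMap ℂ (Stalk y) (m.1 j) * r j : Stalk y) : (𝓝 y).Germ ℂ) =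
            ((fun z => (m.1 j : ℂ) * r' j z : P.Total → ℂ) : (𝓝 y).Germ ℂ) := by
          intro j
          rw [← Algebra.smul_def]
          change (m.1 j : ℂ) • ((r j : (𝓝 y).Germ ℂ)) = _
          rw [hr j]
          rfl
        simp only [this]
        have h2 := map_sum (Filter.Germ.coeRingHom (R := ℂ) (𝓝 y))
          (fun j : Fin n => (fun z => (m.1 j : ℂ) * r' j z : P.Total → ℂ)) Finset.univ
        refine h2.symm.trans ?_
        change ((∑ j, (fun z => (m.1 j : ℂ) * r' j z) : P.Total → ℂ) : (𝓝 y).Germ ℂ) = _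
        congr 1
        funext z
        simp
      change (monomialGerm hm' : (𝓝 y).Germ ℂ) * _ = _
      rw [hsum, coe_monomialGerm]
      rfl
    have hx1 := hθG x hxV₀
    rw [hmeq x hxV₀, hq, sum_coordField_monomialGerm, hcoe x q g hqg] at hx1
    have hev := Filter.Germ.coe_eq.mp hx1
    filter_upwards [hev.eventually_nhds, V₀.isOpen.mem_nhds hxV₀] with y h1 h2 hyU hy q' hq'
    apply monomialGerm_mul_cancel (dualMonoid_le h2.2 hm)
    rw [← sum_coordField_monomialGerm, ← hq']
    apply Subtype.ext
    refine Eq.trans ?_ (hcoe y (fun j => ⟨(g j : (𝓝 y).Germ ℂ), hg j y (hy j)⟩) g (fun _ => rfl)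
      (dualMonoid_le h2.2 hm)).symm
    refine (congrArg (fun f => (((θ ⟨y, hyU⟩).1 f : Stalk y) : (𝓝 y).Germ ℂ))
      (hmeq y h2).symm).trans ?_
    exact (hθG y h2).trans (Filter.Germ.coe_eq.mpr h1).symm
  have hall : ∀ᶠ y in 𝓝 x, ∀ (hyU : y ∈ U) (hy : ∀ j, y ∈ V₁ j),
      θ ⟨y, hyU⟩ = ∑ j, (⟨(g j : (𝓝 y).Germ ℂ), hg j y (hy j)⟩ : Stalk y) • coordField y j := by
    -- Finitely many characters determine the coefficients, so one neighbourhood works for all of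
    -- them.
    have hfin : ∀ᶠ y in 𝓝 x, ∀ i, ∀ (hyU : y ∈ U) (hy : ∀ j, y ∈ V₁ j),
        ∀ q' : Fin n → Stalk y, θ ⟨y, hyU⟩ = ∑ j, q' j • coordField y j →
        ∑ j, algebraMap ℂ (Stalk y) ((((Pi.single i 1, 0) : Char n) + k i • m₀).1 j) * q' j =
          ∑ j, algebraMap ℂ (Stalk y) ((((Pi.single i 1, 0) : Char n) + k i • m₀).1 j) *
            ⟨(g j : (𝓝 y).Germ ℂ), hg j y (hy j)⟩ :=
      eventually_all.mpr fun i => key _ (hk i)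
    filter_upwards [key m₀ h₀, hfin] with y h1 h2 hyU hy
    obtain ⟨q', hq'⟩ := exists_coordField_sum y (θ ⟨y, hyU⟩)
    rw [hq']
    congr! with j
    exact congrArg Subtype.val
      (congrFun (eq_of_pairing_eq (h1 hyU hy q' hq') fun i => h2 i hyU hy q' hq') j)
  obtain ⟨O, hO, hOopen, hxO⟩ := eventually_nhds_iff.mp hall
  let V₂ : Opens P.Total := ⟨⋂ j, (V₁ j : Set P.Total), isOpen_iInter_of_finite fun j => (V₁ j).isOpen⟩
  have hV₂ : ∀ y ∈ V₂, ∀ j, y ∈ V₁ j := fun y hy j => Set.mem_iInter.mp hy j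
  refine ⟨U ⊓ (⟨O, hOopen⟩ ⊓ V₂), inf_le_left, g, fun j y hy => hg j y (hV₂ y hy.2.2 j),
    ⟨hx, hxO, Set.mem_iInter.mpr hxV₁⟩, fun y hy => hO y hy.2.1 hy.1 (hV₂ y hy.2.2)⟩

end PolyDecomp.Total

/-! ## The pull back of the logarithmic tangent sheaf in coordinates -/

section PullbackCoordinates

open PolyDecomp.Total

variable {n : ℕ} {P : PolyDecomp n} {C : NodalCurve} (φ : Mor C.Point P.Total)

/-- The basis of the stalk of `φ^*Θ` given by the coordinate vector fields. -/
def pullBasis (c : C.Point) : Module.Basis (Fin n) (StalkAlong φ c) (PullStalk φ c) :=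
  Algebra.TensorProduct.basis (StalkAlong φ c) (logBasis (φ.toFun c))

/-- The coefficients of an element of the stalk of `φ^*Θ`. -/
def coeff (c : C.Point) (j : Fin n) (s : PullStalk φ c) : Stalk c := (pullBasis φ c).repr s j

lemma coeff_add (c : C.Point) (j : Fin n) (s s' : PullStalk φ c) :
    coeff φ c j (s + s') = coeff φ c j s + coeff φ c j s' := by
  rw [coeff, map_add]
  rfl

lemma coeff_zero (c : C.Point) (j : Fin n) : coeff φ c j 0 = 0 := by
  rw [coeff, map_zero]
  rfl

lemma coeff_sum {ι : Type} (S : Finset ι) (c : C.Point) (j : Fin n) (s : ι → PullStalk φ c) :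
    coeff φ c j (∑ k ∈ S, s k) = ∑ k ∈ S, coeff φ c j (s k) :=
  map_sum (AddMonoidHom.mk' (coeff φ c j) (coeff_add φ c j)) s S

lemma coeff_smul (c : C.Point) (j : Fin n) (r : StalkAlong φ c) (s : PullStalk φ c) :
    coeff φ c j (r • s) = (show Stalk c from r) * coeff φ c j s := by
  rw [coeff, map_smul]
  rfl

lemma coeff_injective {c : C.Point} {s s' : PullStalk φ c}
    (h : ∀ j, coeff φ c j s = coeff φ c j s') : s = s' :=
  (pullBasis φ c).repr.injective (Finsupp.ext h)

lemma coeff_tensor (c : C.Point) (j : Fin n) (f : StalkAlong φ c)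
    (q : Fin n → Stalk (φ.toFun c)) :
    coeff φ c j (tensor φ c f (∑ k, q k • coordField (φ.toFun c) k)) =
      (show Stalk c from f) * φ.comap c (q j) := by
  have h : (logBasis (φ.toFun c)).repr (∑ k, q k • coordField (φ.toFun c) k) j = q j := by
    have := (logBasis (φ.toFun c)).repr_sum_self q
    simp only [logBasis_apply] at this
    exact congrFun this j
  refine (congrArg (fun x => x j) (Algebra.TensorProduct.basis_repr_tmul (A := StalkAlong φ c)
    (logBasis (φ.toFun c)) f (∑ k, q k • coordField (φ.toFun c) k))).trans ?_
  change (show Stalk c from f) * φ.comap c _ = _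
  rw [h]

lemma coeff_tensor_coordField (c : C.Point) (j k : Fin n) (f : StalkAlong φ c) :
    coeff φ c j (tensor φ c f (coordField (φ.toFun c) k)) =
      if k = j then (show Stalk c from f) else 0 := by
  classical
  have h : coordField (φ.toFun c) k = ∑ i, (Pi.single k 1 : Fin n → Stalk (φ.toFun c)) i •
      coordField (φ.toFun c) i := eq_sum_single_smul _ _
  rw [h, coeff_tensor]
  split_ifs with hkj
  · subst hkj
    rw [Pi.single_eq_same, map_one, mul_one]
  · rw [Pi.single_eq_of_ne (Ne.symm hkj), map_zero, mul_zero]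

/-- The germ of a finite sum of functions. -/
lemma coe_sum_germ {X ι : Type} [Fintype ι] (l : Filter X) (f : ι → X → ℂ) :
    ((fun x => ∑ k, f k x : X → ℂ) : l.Germ ℂ) = ∑ k, (f k : l.Germ ℂ) := by
  refine Eq.trans ?_ (map_sum (Filter.Germ.coeRingHom (R := ℂ) l) f Finset.univ)
  change _ = ((∑ k, f k : X → ℂ) : l.Germ ℂ)
  congr 1
  funext x
  simp

/-- If `s = ∑ f_k ⊗ θ_k` and `θ_k` has coefficients `g_{kj}`, the `j`-th coefficient of `s` is `∑
f_k * (g_{kj} ∘ φ)`. -/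
lemma IsPreSection.exists_coefficients {W : Opens C.Point} {s : (c : W) → PullStalk φ c.1}
    (hs : IsPreSection φ W s) {c : C.Point} (hc : c ∈ W) :
    ∃ (W' : Opens C.Point) (hW : W' ≤ W) (F : Fin n → C.Point → ℂ), c ∈ W' ∧
      (∀ j, IsRegularOn (F j) (W' : Set C.Point)) ∧ ∀ (c' : C.Point) (hc' : c' ∈ W') (j : Fin n),
        (coeff φ c' j (s ⟨c', hW hc'⟩) : (𝓝 c').Germ ℂ) = F j := by
  obtain ⟨U, hU, ι, hι, f, hf, θ, hθ, e⟩ := hs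
  choose V hV g hg hcV hgθ using fun k => (hθ k).exists_coefficients (hU c hc)
  let W' : Opens C.Point := W ⊓ ⟨⋂ k, φ.toFun ⁻¹' (V k : Set P.Total),
    isOpen_iInter_of_finite fun k => (V k).isOpen.preimage φ.cont⟩
  have hW' : ∀ c' ∈ W', ∀ k, φ.toFun c' ∈ V k := fun c' hc' k => Set.mem_iInter.mp hc'.2 k
  let F : Fin n → C.Point → ℂ := fun j c' => ∑ k, f k c' * g k j (φ.toFun c')
  have key : ∀ (c' : C.Point) (hc' : c' ∈ W') (j : Fin n),
      (coeff φ c' j (s ⟨c', hc'.1⟩) : (𝓝 c').Germ ℂ) = F j := by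
    intro c' hc' j
    rw [e, coeff_sum, AddSubmonoidClass.coe_finsetSum, coe_sum_germ]
    refine Finset.sum_congr rfl fun k _ => ?_
    rw [hgθ k _ (hW' c' hc' k), coeff_tensor]
    rfl
  refine ⟨W', inf_le_left, F, ⟨hc, Set.mem_iInter.mpr hcV⟩, fun j c' hc' => ?_, key⟩
  rw [← key c' hc' j]
  exact (coeff φ c' j (s ⟨c', hc'.1⟩)).2

lemma IsSection.exists_coefficients {W : Opens C.Point} {s : (c : W) → PullStalk φ c.1}
    (hs : IsSection φ W s) {c : C.Point} (hc : c ∈ W) :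
    ∃ (W' : Opens C.Point) (hW : W' ≤ W) (F : Fin n → C.Point → ℂ), c ∈ W' ∧
      (∀ j, IsRegularOn (F j) (W' : Set C.Point)) ∧ ∀ (c' : C.Point) (hc' : c' ∈ W') (j : Fin n),
        (coeff φ c' j (s ⟨c', hW hc'⟩) : (𝓝 c').Germ ℂ) = F j := by
  obtain ⟨W₁, hW₁, hc₁, h₁⟩ := hs ⟨c, hc⟩
  obtain ⟨W₂, hW₂, F, hc₂, hF, h₂⟩ := h₁.exists_coefficients φ hc₁
  exact ⟨W₂, hW₂.trans hW₁, F, hc₂, hF, h₂⟩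

/-- The value of a regular germ. -/
def stalkValue {X : Type} [TopologicalSpace X] [HasRegularGerms X] (x : X) : Stalk x →+* ℂ :=
  (Filter.Germ.valueRingHom : (𝓝 x).Germ ℂ →+* ℂ).comp (Stalk x).val.toRingHom

lemma stalkValue_algebraMap {X : Type} [TopologicalSpace X] [HasRegularGerms X] (x : X) (a : ℂ) :
    stalkValue x (algebraMap ℂ (Stalk x) a) = a := by
  rw [Algebra.algebraMap_eq_smul_one]
  exact mul_one a

/-- The value of a coefficient of a section of `φ^*Θ`. -/
def coeffAt {W : Opens C.Point} (s : (c : W) → PullStalk φ c.1) (j : Fin n) (c : W) : ℂ :=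
  stalkValue c.1 (coeff φ c.1 j (s c))

/-- The values of the coefficients of a section of `φ^*Θ`, as functions on the normalization. -/
def coeffValue {W : Opens C.Point} (s : (c : W) → PullStalk φ c.1)
    (y : {y // C.proj y ∈ W}) (j : Fin n) : ℂ :=
  coeffAt φ s j ⟨C.proj y.1, y.2⟩

lemma coeffValue_add {W : Opens C.Point} (s s' : (c : W) → PullStalk φ c.1) :
    coeffValue φ (s + s') = coeffValue φ s + coeffValue φ s' := by
  funext y j
  exact (congrArg (stalkValue _) (coeff_add φ _ j _ _)).trans (map_add _ _ _)

lemma coeffValue_zero {W : Opens C.Point} :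
    coeffValue φ (0 : (c : W) → PullStalk φ c.1) = 0 := by
  funext y j
  exact (congrArg (stalkValue _) (coeff_zero φ _ j)).trans (map_zero _)

lemma coeffValue_smul {W : Opens C.Point} (a : ℂ) (s : (c : W) → PullStalk φ c.1) :
    coeffValue φ (fun c => constAlong φ a c.1 • s c) = a • coeffValue φ s := by
  funext y j
  refine (congrArg (stalkValue _) (coeff_smul φ _ j _ _)).trans ?_
  refine (map_mul (stalkValue (C.proj y.1)) (algebraMap ℂ (Stalk (C.proj y.1)) a) _).trans ?_
  rw [stalkValue_algebraMap]
  rfl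

lemma coeffValue_congr {W : Opens C.Point} (s : (c : W) → PullStalk φ c.1)
    {y y' : {y // C.proj y ∈ W}} (h : C.proj y.1 = C.proj y'.1) :
    coeffValue φ s y = coeffValue φ s y' := by
  funext j
  exact congrArg (coeffAt φ s j) (Subtype.ext h)

/-- A function whose germ at a point of the curve is regular is regular on the branches of the
curve at this point. -/
lemma isRegularAt_of_mem_stalk {F : C.Point → ℂ} {x : C.Norm}
    (hF : (F : (𝓝 (C.proj x)).Germ ℂ) ∈ Stalk (C.proj x)) :
    IsRegularAt (fun q => F (C.proj ⟨x.1, q⟩)) x.2 := by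
  obtain ⟨f, hf, h⟩ := hF
  have hev : ∀ᶠ c in 𝓝 (C.proj x), f c = F c := Filter.Germ.coe_eq.mp hf
  obtain ⟨O, hO, hOopen, hxO⟩ := eventually_nhds_iff.mp hev
  refine (h x.1 x.2 rfl).congr (hO _ hxO) ?_
  filter_upwards [C.eventually_mem (W := ⟨O, hOopen⟩) hxO] with q hq
  exact hO _ hq

lemma IsSection.coeffValue_mem {W : Opens C.Point} {s : (c : W) → PullStalk φ c.1}
    (hs : IsSection φ W s) : coeffValue φ s ∈ (C.normFunctions n).sec W := by
  intro x hx
  obtain ⟨W', hW, F, hc, hF, h⟩ := hs.exists_coefficients φ hx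
  have hreg : C.IsRegularNorm (fun y j => F j (C.proj y)) x :=
    fun j => isRegularAt_of_mem_stalk (hF j _ hc)
  refine hreg.congr hc fun y hy => ?_
  rw [NodalCurve.extend_of_mem _ (hW hy)]
  funext j
  exact (congrArg Filter.Germ.value (h _ hy j)).symm

/-- The sections of `φ^*Θ` as functions on the normalization. -/
def toNormFunctions : pullbackSheaf φ ⟶ (C.normFunctions n).sheaf :=
  ⟨{ app := fun W => AddCommGrpCat.ofHom
      { toFun := fun s => (⟨coeffValue φ s.1, IsSection.coeffValue_mem φ s.2⟩ :
          (C.normFunctions n).sec W.unop)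
        map_zero' := Subtype.ext (coeffValue_zero φ)
        map_add' := fun s s' => Subtype.ext (coeffValue_add φ s.1 s'.1) }
     naturality := fun _ _ _ => rfl }⟩

/-- The coefficient germs are represented near each point by genuine functions on the curve. Every
point lifts to the normalization, so equal values there force equal functions and hence equal germs.
-/
lemma toNormFunctions_injective (W : Opens C.Point) :
    Function.Injective ((toNormFunctions φ).hom.app (Opposite.op W)) := by
  intro s s' h
  change sections φ W at s s'
  have h' : coeffValue φ s.1 = coeffValue φ s'.1 := congrArg Subtype.val h
  apply Subtype.ext
  funext c
  refine coeff_injective φ fun j => Subtype.ext ?_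
  obtain ⟨W₁, hW₁, F, hc₁, hF, h₁⟩ := IsSection.exists_coefficients φ s.2 c.2
  obtain ⟨W₂, hW₂, G, hc₂, hG, h₂⟩ := IsSection.exists_coefficients φ s'.2 c.2
  refine (h₁ c.1 hc₁ j).trans (Eq.trans ?_ (h₂ c.1 hc₂ j).symm)
  refine Filter.Germ.coe_eq.mpr ?_
  filter_upwards [W₁.isOpen.mem_nhds hc₁, W₂.isOpen.mem_nhds hc₂] with c' hc₁' hc₂'
  obtain ⟨y, rfl⟩ := C.proj_surjective c'
  have e := congrFun (congrFun h' ⟨y, hW₁ hc₁'⟩) j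
  have e₁ := congrArg Filter.Germ.value (h₁ _ hc₁' j)
  have e₂ := congrArg Filter.Germ.value (h₂ _ hc₂' j)
  exact e₁.symm.trans (e.trans e₂)

/-- Functions agreeing on the two branches of each node descend to the curve, and the descended
functions are regular by the definition of its local rings. They serve as coefficients of the
coordinate fields. -/
lemma exists_section {W : Opens C.Point} (f : (C.normFunctions n).sec W)
    (hf : ∀ (ν : C.Node) (h₁ : C.proj (C.branch ν true) ∈ W) (h₀ : C.proj (C.branch ν false) ∈ W),
      f.1 ⟨C.branch ν true, h₁⟩ = f.1 ⟨C.branch ν false, h₀⟩) :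
    ∃ s : sections φ W, coeffValue φ s.1 = f.1 := by
  classical
  -- Off `W` the extension by zero descends too: the two branches of a node lie over the same point,
  -- so both lie over `W` or neither does.
  let F : Fin n → C.Point → ℂ := fun j => Quot.lift (fun y => NodalCurve.extend f.1 y j) (by
    rintro a b ⟨ν, rfl, rfl⟩
    by_cases h : C.proj (C.branch ν false) ∈ W
    · have h' : C.proj (C.branch ν true) ∈ W := by rwa [← C.proj_branch]
      rw [NodalCurve.extend_of_mem _ h, NodalCurve.extend_of_mem _ h', hf ν h' h]
    · have h' : C.proj (C.branch ν true) ∉ W := by rwa [← C.proj_branch]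
      rw [NodalCurve.extend, NodalCurve.extend, dif_neg h, dif_neg h'])
  have hF : ∀ j, IsRegularOn (F j) (W : Set C.Point) := by
    rintro j c hc
    refine ⟨F j, rfl, ?_⟩
    rintro i p rfl
    exact f.2 ⟨i, p⟩ hc j
  let s : (c : W) → PullStalk φ c.1 := fun c =>
    ∑ j, tensor φ c.1 (germAlong φ W (F j) (hF j) c) (coordField (φ.toFun c.1) j)
  have hs : IsSection φ W s := fun c => ⟨W, le_rfl, c.2, ⊤, fun _ _ => trivial, Fin n,
    inferInstance, F, hF, fun j x => coordField x.1 j, fun j => isLogField_coordField ⊤ j,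
    fun _ => rfl⟩
  refine ⟨⟨s, hs⟩, ?_⟩
  funext y j
  have e : coeff φ (C.proj y.1) j (s ⟨C.proj y.1, y.2⟩) =
      germAlong φ W (F j) (hF j) ⟨C.proj y.1, y.2⟩ := by
    refine (coeff_sum φ _ _ _ _).trans ?_
    refine (Finset.sum_congr rfl fun k _ => coeff_tensor_coordField φ _ j k _).trans ?_
    exact (Finset.sum_ite_eq' Finset.univ j fun k =>
      (⟨(F k : (𝓝 (C.proj y.1)).Germ ℂ), hF k _ y.2⟩ : Stalk (C.proj y.1))).trans
        (if_pos (Finset.mem_univ j))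
  refine (congrArg (stalkValue (C.proj y.1)) e).trans ?_
  change NodalCurve.extend f.1 y.1 j = _
  rw [NodalCurve.extend_of_mem _ y.2]

/-- The normalization sequence of `φ^*Θ`. -/
def normalizationSequence :
    ShortComplex (Sheaf (Opens.grothendieckTopology C.Point) AddCommGrpCat.{0}) where
  X₁ := pullbackSheaf φ
  X₂ := (C.normFunctions n).sheaf
  X₃ := (C.nodeFunctions n).sheaf
  f := toNormFunctions φ
  g := C.nodeDifference n
  zero := by
    apply Sheaf.hom_ext
    ext W s
    apply Subtype.ext
    funext ν j
    change sections φ W.unop at s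
    exact congrFun (sub_eq_zero.mpr (coeffValue_congr φ s.1 (C.proj_branch ν.1).symm)) j

lemma normalizationSequence_shortExact : (normalizationSequence φ).ShortExact := by
  refine shortExact_of_sections (X := TopCat.of C.Point) (S := normalizationSequence φ)
    (toNormFunctions_injective φ) ?_ (C.nodeDifference_locallySurjective n)
  intro W f hf
  change (C.normFunctions n).sec W at f
  obtain ⟨s, hs⟩ := exists_section φ f (by
    intro ν h₁ h₀
    have := congrFun (congrArg Subtype.val hf) ⟨ν, h₀⟩
    exact sub_eq_zero.mp this)
  exact ⟨s, Subtype.ext hs⟩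

/-- Multiplication by a complex number on the normalization sequence. -/
def normalizationSequenceScalar (a : ℂ) : normalizationSequence φ ⟶ normalizationSequence φ where
  τ₁ := scalar φ a
  τ₂ := (C.normFunctions n).scalar a
  τ₃ := (C.nodeFunctions n).scalar a
  comm₁₂ := by
    apply Sheaf.hom_ext
    ext W s
    apply Subtype.ext
    funext y j
    change sections φ W.unop at s
    exact congrFun (congrFun (coeffValue_smul φ a s.1) y) j
  comm₂₃ := by
    apply Sheaf.hom_ext
    ext W s
    apply Subtype.ext
    funext ν
    exact (smul_sub a _ _).symm

end PullbackCoordinates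

/-! ## Cycles of graphs -/

section Graph

variable {V E k : Type} [Field k] (a b : E → V)

/-- The set of connected components of the graph with edges from `a e` to `b e`. -/
abbrev Components : Type := Quot fun v w => ∃ e, a e = v ∧ b e = w

variable (k) in
/-- The coboundary map of a graph with coefficients `kᵐ`. -/
def coboundary (m : ℕ) : (V → Fin m → k) →ₗ[k] (E → Fin m → k) where
  toFun u e := u (b e) - u (a e)
  map_add' u w := by
    funext e
    exact add_sub_add_comm _ _ _ _
  map_smul' r u := by
    funext e
    exact (smul_sub r _ _).symm

/-- The kernel consists of the functions which are constant on connected components. -/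
lemma finrank_ker_coboundary [Fintype V] (m : ℕ) :
    Module.finrank k (LinearMap.ker (coboundary k a b m)) = Nat.card (Components a b) * m := by
  classical
  have : Fintype (Components a b) := Fintype.ofFinite _
  let Φ : (Components a b → Fin m → k) →ₗ[k] LinearMap.ker (coboundary k a b m) :=
    { toFun := fun u => ⟨fun v => u (Quot.mk _ v), by
        refine LinearMap.mem_ker.mpr (funext fun e => sub_eq_zero.mpr ?_)
        exact congrArg u (Quot.sound ⟨e, rfl, rfl⟩).symm⟩
      map_add' := fun _ _ => rfl
      map_smul' := fun _ _ => rfl }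
  have hΦ : Function.Bijective Φ := by
    constructor
    · intro u u' h
      funext q
      obtain ⟨v, rfl⟩ := Quot.mk_surjective q
      exact congrFun (congrArg Subtype.val h) v
    · rintro ⟨u, hu⟩
      refine ⟨Quot.lift u ?_, rfl⟩
      rintro _ _ ⟨e, rfl, rfl⟩
      exact (sub_eq_zero.mp (congrFun (LinearMap.mem_ker.mp hu) e)).symm
  rw [← (LinearEquiv.ofBijective Φ hΦ).finrank_eq]
  simp [Module.finrank_pi_fintype]

lemma finrank_range_coboundary [Fintype V] (m : ℕ) :
    Module.finrank k (LinearMap.range (coboundary k a b m)) + Nat.card (Components a b) * m =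
      Fintype.card V * m := by
  rw [← finrank_ker_coboundary (k := k) a b m, LinearMap.finrank_range_add_finrank_ker]
  simp [Module.finrank_pi_fintype]

variable (k) in
/-- The incidence matrix of a graph. -/
def incidence [DecidableEq V] : Matrix V E k :=
  Matrix.of fun v e => (if b e = v then 1 else 0) - (if a e = v then 1 else 0)

/-- The transposed incidence matrix is the coboundary map for `m = 1`, and a matrix has the rank of
its transpose. -/
lemma rank_incidence [Fintype V] [Fintype E] [DecidableEq V] :
    (incidence k a b).rank + Nat.card (Components a b) = Fintype.card V := by
  have h : ∀ u : V → k, ((incidence k a b).transpose.mulVecLin u) = fun e => u (b e) - u (a e) := by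
    intro u
    funext e
    simp [Matrix.vecMul, dotProduct, incidence, mul_sub, Finset.sum_sub_distrib]
  let ι (X : Type) : (X → k) ≃ₗ[k] (X → Fin 1 → k) :=
    LinearEquiv.piCongrRight fun _ => (LinearEquiv.funUnique (Fin 1) k k).symm
  have hr : Module.finrank k (LinearMap.range (coboundary k a b 1)) =
      Module.finrank k (LinearMap.range (incidence k a b).transpose.mulVecLin) := by
    have e : coboundary k a b 1 =
        ((ι E).toLinearMap ∘ₗ (incidence k a b).transpose.mulVecLin) ∘ₗ (ι V).symm.toLinearMap := by
      apply LinearMap.ext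
      intro u
      funext e i
      obtain rfl := Subsingleton.elim i 0
      simp only [LinearMap.comp_apply, h]
      rfl
    rw [e, LinearMap.range_comp_of_range_eq_top _ (LinearEquiv.range _), LinearMap.range_comp]
    exact LinearEquiv.finrank_map_eq (ι E) _
  have := finrank_range_coboundary (k := k) a b 1
  rw [mul_one, mul_one, hr] at this
  rw [← Matrix.rank_transpose]
  exact this

/-- The Euler characteristic of a graph. -/
lemma finrank_ker_incidence [Fintype V] [Fintype E] [DecidableEq V] :
    Module.finrank k (LinearMap.ker (incidence k a b).mulVecLin) + Fintype.card V =
      Fintype.card E + Nat.card (Components a b) := by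
  have h := LinearMap.finrank_range_add_finrank_ker (incidence k a b).mulVecLin
  have h' := rank_incidence (k := k) a b
  rw [Matrix.rank] at h'
  rw [Module.finrank_fintype_fun_eq_card] at h
  omega

lemma card_components_eq_one [Nonempty V]
    (h : ∀ v w : V, Relation.EqvGen (fun v w => ∃ e, a e = v ∧ b e = w) v w) :
    Nat.card (Components a b) = 1 := by
  have : Subsingleton (Components a b) := ⟨by
    rintro ⟨v⟩ ⟨w⟩
    exact Quot.eqvGen_sound (h v w)⟩
  have : Nonempty (Components a b) := ⟨Quot.mk _ (Classical.arbitrary V)⟩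
  exact Nat.card_of_subsingleton (Classical.arbitrary _)

end Graph

/-! ### The genus after contraction of a forest -/

namespace TropicalCurve

variable {n : ℕ} {T : TropicalCurve n}

lemma ker_boundary_eq [DecidableEq T.V] :
    LinearMap.ker T.boundary = LinearMap.ker (incidence ℚ (fun e => T.ends e false)
      fun e => T.ends e true).mulVecLin := by
  have h : T.boundary = (incidence ℚ (fun e => T.ends e false)
      fun e => T.ends e true).mulVecLin := by
    apply LinearMap.ext
    intro c
    funext v
    change ∑ e, _ = ∑ e, _
    refine Finset.sum_congr rfl fun e _ => ?_
    rw [mul_comm]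
    refine congrArg (· * c e) ?_
    change _ = ((if _ then 1 else 0) - (if _ then 1 else 0) : ℚ)
    congr!
  rw [h]

/-- The genus of the graph obtained by contracting a forest. -/
lemma Admissible.genus_add_card (hT : T.Admissible) :
    T.genus + Nat.card T.Cluster = Nat.card T.EdgeNC + 1 := by
  classical
  -- The Euler characteristic is taken twice on the same vertices. The connected graph `Γ` gives `g
  -- + #V = #E + 1`; the forest of contracted edges gives `#V = #contracted + #clusters`. The claim
  -- is the difference.
  have h1 := finrank_ker_incidence (k := ℚ) (fun e => T.ends e false) (fun e => T.ends e true)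
  have := T.nonempty
  rw [card_components_eq_one _ _ T.connected, ← ker_boundary_eq] at h1
  let a : {e // T.Contracted e} → T.V := fun e => T.ends e.1 false
  let b : {e // T.Contracted e} → T.V := fun e => T.ends e.1 true
  have h2 := finrank_ker_incidence (k := ℚ) a b
  have hker : LinearMap.ker (incidence ℚ a b).mulVecLin = ⊥ := by
    refine LinearMap.ker_eq_bot'.mpr fun c hc => ?_
    -- Extension by zero turns a cycle of contracted edges into a cycle of `Γ`, which vanishes by
    -- the absence of contracted loops.
    let c' : T.E → ℚ := fun e => if h : T.Contracted e then c ⟨e, h⟩ else 0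
    have hc' : c' ∈ LinearMap.ker T.boundary := by
      rw [ker_boundary_eq, LinearMap.mem_ker]
      funext v
      refine Eq.trans ?_ (congrFun hc v)
      change ∑ e, (incidence ℚ (fun e => T.ends e false) fun e => T.ends e true) v e * c' e =
        ∑ e : {e // T.Contracted e}, (incidence ℚ a b) v e * c e
      rw [← Finset.sum_filter_of_ne (p := T.Contracted) (by
        intro e _ he
        by_contra h
        exact he (by rw [show c' e = 0 from dif_neg h, mul_zero])),
        Finset.sum_subtype (p := T.Contracted) _ (by simp)]
      refine Finset.sum_congr rfl fun e _ => ?_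
      rw [show c' e.1 = c e from dif_pos e.2]
      rfl
    have := hT.noContractedLoop c' hc' fun e he => by
      by_contra h
      exact he (dif_neg h)
    funext e
    have := congrFun this e.1
    rwa [show c' e.1 = c e from dif_pos e.2] at this
  have hcl : Nat.card T.Cluster = Nat.card (Components a b) := by
    have : (fun v w : T.V => ∃ e, T.Contracted e ∧ T.ends e false = v ∧ T.ends e true = w) =
        fun v w => ∃ e, a e = v ∧ b e = w := by
      funext v w
      simp [a, b, and_left_comm]
    unfold Cluster Components
    rw [this]
  rw [hker, finrank_bot, ← hcl] at h2
  have h3 := Fintype.card_subtype_compl T.Contracted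
  have h4 := Fintype.card_subtype_le T.Contracted
  have h5 : Nat.card T.EdgeNC = Fintype.card {e // ¬ T.Contracted e} := Nat.card_eq_fintype_card
  change T.genus + _ = _ at h1
  omega

end TropicalCurve

/-! ## The first cohomology of the pull back of the logarithmic tangent sheaf -/

namespace NodalCurve

variable (C : NodalCurve)

/-- The difference map of the dual graph. -/
abbrev dualCoboundary (n : ℕ) : (C.Comp → Fin n → ℂ) →ₗ[ℂ] (C.Node → Fin n → ℂ) :=
  coboundary ℂ (fun ν => (C.branch ν false).1) (fun ν => (C.branch ν true).1) n

lemma card_components : Nat.card (Components (fun ν => (C.branch ν false).1)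
    (fun ν => (C.branch ν true).1)) = 1 :=
  have := C.nonempty
  card_components_eq_one _ _ C.connected

end NodalCurve

section Cohomology

variable {n : ℕ} {P : PolyDecomp n} {C : NodalCurve} (φ : Mor C.Point P.Total)

/-- The connecting homomorphism of the normalization sequence. -/
def nodeConnecting : (C.Node → Fin n → ℂ) →ₗ[ℂ] PullbackH1 φ where
  toFun u := connecting (X := TopCat.of C.Point) (normalizationSequence_shortExact φ)
    (⟨fun ν => u ν.1, trivial⟩ : (C.nodeFunctions n).sec ⊤)
  map_add' u u' := map_add (connecting (X := TopCat.of C.Point)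
    (normalizationSequence_shortExact φ)) (⟨fun ν => u ν.1, trivial⟩ : (C.nodeFunctions n).sec ⊤)
    (⟨fun ν => u' ν.1, trivial⟩ : (C.nodeFunctions n).sec ⊤)
  map_smul' r u := connecting_naturality (X := TopCat.of C.Point)
    (normalizationSequence_shortExact φ) (normalizationSequenceScalar φ r)
    (⟨fun ν => u ν.1, trivial⟩ : (C.nodeFunctions n).sec ⊤)

lemma nodeConnecting_surjective : Function.Surjective (nodeConnecting φ) := by
  intro x
  obtain ⟨u, hu⟩ := connecting_surjective (X := TopCat.of C.Point)
    (normalizationSequence_shortExact φ) (C.subsingleton_H_one_normFunctions n) x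
  change (C.nodeFunctions n).sec ⊤ at u
  exact ⟨fun ν => u.1 ⟨ν, trivial⟩, hu⟩

/-- A node vector is killed exactly when it is the difference of a global function on the
normalization. Such a function is constant on each component, so its differences are the coboundary
of a function on the vertices of the dual graph. -/
lemma ker_nodeConnecting :
    LinearMap.ker (nodeConnecting φ) = LinearMap.range (C.dualCoboundary n) := by
  ext u
  rw [LinearMap.mem_ker]
  refine (connecting_eq_zero_iff (X := TopCat.of C.Point) (normalizationSequence_shortExact φ)
    (⟨fun ν => u ν.1, trivial⟩ : (C.nodeFunctions n).sec ⊤)).trans ?_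
  constructor
  · rintro ⟨f, hf⟩
    change (C.normFunctions n).sec ⊤ at f
    -- Any point of the component would do, the function being constant.
    refine ⟨fun i => f.1 ⟨⟨i, P1.inf⟩, trivial⟩, funext fun ν => ?_⟩
    refine Eq.trans ?_ (congrFun (congrArg Subtype.val hf) ⟨ν, trivial⟩)
    exact congrArg₂ (· - ·) (C.normFunctions_const f _ _ _) (C.normFunctions_const f _ _ _)
  · rintro ⟨w, rfl⟩
    refine ⟨(⟨fun y => w y.1.1, fun x hx j => ?_⟩ : (C.normFunctions n).sec ⊤), rfl⟩
    refine (isRegularAt_const (w x.1 j) x.2).congr ?_ ?_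
    · exact (congrFun (NodalCurve.extend_of_mem (W := ⊤) (fun y => w y.1.1) (y := x) trivial)
        j).symm
    · exact Eventually.of_forall fun q =>
        (congrFun (NodalCurve.extend_of_mem (W := ⊤) (fun y => w y.1.1) (y := ⟨x.1, q⟩) trivial)
          j).symm

instance : Module.Finite ℂ (PullbackH1 φ) :=
  Module.Finite.of_surjective (nodeConnecting φ) (nodeConnecting_surjective φ)

/-- The cohomology is the cokernel of the coboundary map, whose kernel has dimension `n` because the
dual graph is connected. -/
lemma finrank_pullbackH1 :
    Module.finrank ℂ (PullbackH1 φ) + Fintype.card C.Comp * n = Fintype.card C.Node * n + n := by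
  have h1 := LinearMap.finrank_range_add_finrank_ker (nodeConnecting φ)
  rw [LinearMap.range_eq_top.mpr (nodeConnecting_surjective φ), finrank_top, ker_nodeConnecting]
    at h1
  have h2 : Module.finrank ℂ (LinearMap.range (C.dualCoboundary n)) + _ = _ :=
    finrank_range_coboundary (fun ν => (C.branch ν false).1) (fun ν => (C.branch ν true).1) n
  rw [C.card_components, one_mul] at h2
  have h3 : Module.finrank ℂ (C.Node → Fin n → ℂ) = Fintype.card C.Node * n := by
    simp [Module.finrank_pi_fintype]
  omega

end Cohomology

/-! ## Sections of the dualizing sheaf -/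

-- `RatFunc.eval` uses the reduced fraction, so the two sides may differ at common roots of `A` and
-- `B`; hence the restriction to almost all `z`.
open Polynomial in
lemma eval_algebraMap_div (A B : ℂ[X]) (hB : B ≠ 0) :
    ∀ᶠ z in cofinite, (algebraMap ℂ[X] (RatFunc ℂ) A / algebraMap ℂ[X] (RatFunc ℂ) B).eval
      (RingHom.id ℂ) z = A.eval z / B.eval z := by
  have hB' : algebraMap ℂ[X] (RatFunc ℂ) B ≠ 0 := by simpa using hB
  filter_upwards [eventually_eval_ne_zero hB, NodalCurve.eventually_denom
    (algebraMap ℂ[X] (RatFunc ℂ) A / algebraMap ℂ[X] (RatFunc ℂ) B)] with z hz hz'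
  have h := RatFunc.eval_mul (y := algebraMap ℂ[X] (RatFunc ℂ) B) (RingHom.id ℂ) z hz' (by simp)
  rw [div_mul_cancel₀ _ hB', RatFunc.eval_algebraMap, RatFunc.eval_algebraMap] at h
  rw [eq_div_iff hz]
  simpa using h.symm

namespace NodalCurve

open Polynomial

lemma HasResidue.regZero {η : RatFunc ℂ} {p : P1} {r : ℂ} (h : HasResidue η p r) :
    RegZero (fun s => s * formCoeff η p s) r := by
  obtain ⟨A, B, hB, hr, h⟩ := h
  exact ⟨A, B, hB, hr.symm, h⟩

lemma HasResidue.unique {η : RatFunc ℂ} {p : P1} {r t : ℂ} (h : HasResidue η p r)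
    (h' : HasResidue η p t) : r = t :=
  h.regZero.unique h'.regZero

lemma HasResidue.sub {η θ : RatFunc ℂ} {p : P1} {r t : ℂ} (hη : HasResidue η p r)
    (hθ : HasResidue θ p t) : HasResidue (η - θ) p (r - t) := by
  have := hη.add (hθ.smul (-1))
  rwa [neg_one_mul, neg_one_smul, ← sub_eq_add_neg, ← sub_eq_add_neg] at this

lemma hasResidue_sum {ι : Type} (S : Finset ι) {η : ι → RatFunc ℂ} {p : P1} {r : ι → ℂ}
    (h : ∀ k, HasResidue (η k) p (r k)) : HasResidue (∑ k ∈ S, η k) p (∑ k ∈ S, r k) := by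
  classical
  induction S using Finset.induction_on with
  | empty => simpa using hasResidue_zero p
  | insert k S hk ih =>
    rw [Finset.sum_insert hk, Finset.sum_insert hk]
    exact (h k).add ih

lemma formCoeff_fin (η : RatFunc ℂ) (a s : ℂ) :
    formCoeff η (P1.fin a) s = η.eval (RingHom.id ℂ) (a + s) := rfl

lemma formCoeff_inf (η : RatFunc ℂ) (s : ℂ) :
    formCoeff η P1.inf s = -(η.eval (RingHom.id ℂ) s⁻¹) / s ^ 2 := rfl

/-- A form which is regular at a finite point has no pole there. -/
lemma HasResidue.denom_ne_zero {η : RatFunc ℂ} {a : ℂ} (h : HasResidue η (P1.fin a) 0) :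
    η.denom.eval a ≠ 0 := by
  intro h0
  obtain ⟨A, B, hB, hr, h⟩ := h
  -- Residue zero makes the numerator of `s * η` divisible by `s`; cancelling `s` shows that `η` is
  -- regular at `a`.
  have hA : A.eval 0 = 0 := by
    rcases div_eq_zero_iff.mp hr with h | h
    · exact h
    · exact (hB h).elim
  obtain ⟨A', rfl⟩ := Polynomial.X_dvd_iff.mpr ((Polynomial.coeff_zero_eq_eval_zero A).trans hA)
  have hreg : RegZero (fun s => η.eval (RingHom.id ℂ) (a + s)) (A'.eval 0 / B.eval 0) := by
    refine RegZero.of_div hB ?_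
    filter_upwards [h, eventually_ne_zero] with s hs hs0
    rw [formCoeff_fin, eval_mul, eval_X, mul_div_assoc] at hs
    exact mul_left_cancel₀ hs0 hs
  have hM : η.denom.comp (X + C a) ≠ 0 := by
    intro h1
    have := congrArg (fun q => Polynomial.comp q (X - C a)) h1
    simp only [Polynomial.comp_assoc] at this
    exact RatFunc.denom_ne_zero η (by simpa using this)
  have := hreg.cross (N := η.num.comp (X + C a)) hM (Eventually.of_forall fun s => by
    simp [RatFunc.eval, add_comm])
  simp only [eval_comp, eval_add, eval_X, eval_C, zero_add, h0, mul_zero] at this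
  obtain ⟨u, v, huv⟩ := RatFunc.isCoprime_num_denom η
  have huv' := congrArg (Polynomial.eval a) huv
  rw [eval_add, eval_mul, eval_mul, this, h0, mul_zero, mul_zero, add_zero, eval_one] at huv'
  exact zero_ne_one huv'

/-- A form which has at most a simple pole at infinity and no other poles vanishes. -/
lemma eq_zero_of_hasResidue {η : RatFunc ℂ} {r : ℂ} (h : ∀ a, HasResidue η (P1.fin a) 0)
    (h' : HasResidue η P1.inf r) : η = 0 := by
  have hden : η.denom = 1 := by
    have hdeg : η.denom.degree = 0 := by
      by_contra hd
      obtain ⟨a, ha⟩ := IsAlgClosed.exists_root η.denom hd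
      exact (h a).denom_ne_zero ha
    rw [Polynomial.eq_C_of_degree_eq_zero hdeg]
    have := RatFunc.monic_denom η
    rw [Polynomial.Monic, Polynomial.leadingCoeff, Polynomial.natDegree_eq_of_degree_eq_some hdeg]
      at this
    exact (congrArg C this).trans (map_one C)
  have hev : ∀ z, η.eval (RingHom.id ℂ) z = η.num.eval z := fun z => by
    simp [RatFunc.eval, hden]
  -- For a polynomial `η` of degree `d`, `s` times the coefficient of `η dz` at infinity is the
  -- reflected polynomial, up to sign, over `s ^ (d + 1)`. The denominator vanishes at `0`, so
  -- regularity forces the leading coefficient of `η` to be zero.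
  have := h'.regZero.cross (N := -η.num.reflect η.num.natDegree)
    (M := X ^ (η.num.natDegree + 1)) (pow_ne_zero _ X_ne_zero) (by
      filter_upwards [eventually_ne_zero] with s hs
      rw [formCoeff_inf, hev, eval_neg, eval_reflect_eq le_rfl hs, eval_pow, eval_X]
      field_simp
      ring)
  rw [eval_neg, eval_zero_reflect] at this
  simp only [eval_pow, eval_X, ne_eq, Nat.add_eq_zero_iff, one_ne_zero, and_false,
    not_false_eq_true, zero_pow, mul_zero, neg_eq_zero] at this
  exact RatFunc.num_eq_zero_iff.mp (Polynomial.leadingCoeff_eq_zero.mp this)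

/-- The form `dz / (z - a)` for a finite point `a`, and zero at infinity. -/
def simplePole (q : P1) : RatFunc ℂ :=
  (CofiniteTopology.of.symm q).elim 0 fun a =>
    algebraMap ℂ[X] (RatFunc ℂ) 1 / algebraMap ℂ[X] (RatFunc ℂ) (X - C a)

lemma simplePole_fin (a : ℂ) : simplePole (P1.fin a) =
    algebraMap ℂ[X] (RatFunc ℂ) 1 / algebraMap ℂ[X] (RatFunc ℂ) (X - C a) := rfl

lemma simplePole_inf : simplePole P1.inf = 0 := rfl

-- The form `dz / (z - a)` has residue `1` at `a` and `-1` at infinity. The convention that the form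
-- attached to infinity is zero fits the same formula, since the two terms cancel.
open Classical in
lemma hasResidue_simplePole (q p : P1) : HasResidue (simplePole q) p
    ((if q = p then 1 else 0) - (if p = P1.inf then 1 else 0)) := by
  rcases P1.cases q with rfl | ⟨a, rfl⟩
  · rw [simplePole_inf]
    convert hasResidue_zero p using 1
    simp [eq_comm]
  have hev := eval_algebraMap_div 1 (X - C a) (X_sub_C_ne_zero a)
  rw [← simplePole_fin] at hev
  simp only [eval_one, eval_sub, eval_X, eval_C] at hev
  rcases P1.cases p with rfl | ⟨b, rfl⟩
  · rw [if_neg (P1.fin_ne_inf a), if_pos rfl]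
    refine ⟨-1, 1 - C a * X, by simp, by simp, ?_⟩
    filter_upwards [(inv_injective (G := ℂ)).tendsto_cofinite.eventually hev, eventually_ne_zero]
      with s hs hs0
    rw [formCoeff_inf, hs]
    -- At `s = 1 / a` both sides are quotients by zero and take the default value `0`.
    by_cases h : s⁻¹ - a = 0
    · have : 1 - a * s = 0 := by
        rw [← sub_eq_zero.mp h, inv_mul_cancel₀ hs0, sub_self]
      simp [h, this]
    · have : 1 - a * s ≠ 0 := by
        intro h'
        apply h
        field_simp
        linear_combination h'
      simp only [eval_neg, eval_one, eval_sub, eval_mul, eval_C, eval_X]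
      field_simp
  · rw [if_neg (P1.fin_ne_inf b), sub_zero]
    have hev' := (add_right_injective b).tendsto_cofinite.eventually hev
    by_cases hab : a = b
    · subst hab
      rw [if_pos rfl]
      refine ⟨1, 1, by simp, by simp, ?_⟩
      filter_upwards [hev', eventually_ne_zero] with s hs hs0
      rw [formCoeff_fin, hs]
      simp [hs0]
    · rw [if_neg fun h => hab (P1.fin_injective h)]
      refine ⟨X, X + C (b - a), by simpa [sub_eq_zero] using Ne.symm hab, by simp, ?_⟩
      filter_upwards [hev'] with s hs
      rw [formCoeff_fin, hs]
      rw [eval_X, eval_add, eval_X, eval_C, mul_one_div,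
        show b + s - a = s + (b - a) by ring]

variable (C : NodalCurve)

/-- The residue at the branch `x` of the form with residue vector `r`. -/
def branchResidue (r : C.Node → ℂ) (x : C.Node × Bool) : ℂ := if x.2 then -r x.1 else r x.1

open Classical in
/-- The forms with given residues at the nodes. -/
def formsOfResidues : (C.Node → ℂ) →ₗ[ℂ] (C.Comp → RatFunc ℂ) where
  toFun r i := ∑ x : C.Node × Bool, if (C.branch x.1 x.2).1 = i then
    C.branchResidue r x • simplePole (C.branch x.1 x.2).2 else 0
  map_add' r t := by
    funext i
    rw [Pi.add_apply, ← Finset.sum_add_distrib]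
    refine Finset.sum_congr rfl fun x _ => ?_
    split_ifs
    · rw [← add_smul]
      congr 1
      simp only [branchResidue, Pi.add_apply]
      split_ifs <;> ring
    · rw [add_zero]
  map_smul' c r := by
    funext i
    rw [RingHom.id_apply, Pi.smul_apply, Finset.smul_sum]
    refine Finset.sum_congr rfl fun x _ => ?_
    split_ifs
    · rw [← mul_smul]
      congr 1
      simp only [branchResidue, Pi.smul_apply, smul_eq_mul]
      split_ifs <;> ring
    · rw [smul_zero]

open Classical in
/-- The residue at a point of the normalization prescribed by a residue vector. -/
def prescribed (r : C.Node → ℂ) (y : C.Norm) : ℂ :=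
  ∑ x : C.Node × Bool, if C.branch x.1 x.2 = y then C.branchResidue r x else 0

lemma prescribed_branch (r : C.Node → ℂ) (x : C.Node × Bool) :
    C.prescribed r (C.branch x.1 x.2) = C.branchResidue r x := by
  classical
  rw [prescribed, Finset.sum_eq_single x]
  · exact if_pos rfl
  · intro y _ hy
    exact if_neg fun h => hy (C.branch_injective h)
  · simp

lemma prescribed_of_ne (r : C.Node → ℂ) {y : C.Norm} (h : ∀ ν b, C.branch ν b ≠ y) :
    C.prescribed r y = 0 :=
  Finset.sum_eq_zero fun x _ => if_neg (h x.1 x.2)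

open Classical in
/-- The incidence matrix of the dual graph. -/
abbrev dualIncidence : Matrix C.Comp C.Node ℂ :=
  incidence ℂ (fun ν => (C.branch ν false).1) (fun ν => (C.branch ν true).1)

-- Each summand has its wanted residue at its branch and the opposite one at infinity. The excess at
-- infinity is therefore minus the sum of the residues on the component, which is the incidence
-- matrix applied to `r`: the obstruction in the residue theorem.
open Classical in
lemma hasResidue_formsOfResidues (r : C.Node → ℂ) (i : C.Comp) (p : P1) :
    HasResidue (C.formsOfResidues r i) p (C.prescribed r ⟨i, p⟩ +
      if p = P1.inf then C.dualIncidence.mulVec r i else 0) := by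
  have h : ∀ x : C.Node × Bool, HasResidue (if (C.branch x.1 x.2).1 = i then
      C.branchResidue r x • simplePole (C.branch x.1 x.2).2 else 0) p
      ((if C.branch x.1 x.2 = ⟨i, p⟩ then C.branchResidue r x else 0) -
        if p = P1.inf then (if (C.branch x.1 x.2).1 = i then C.branchResidue r x else 0)
        else 0) := by
    intro x
    by_cases hi : (C.branch x.1 x.2).1 = i
    · rw [if_pos hi, if_pos hi]
      convert (hasResidue_simplePole (C.branch x.1 x.2).2 p).smul (C.branchResidue r x) using 1
      have : C.branch x.1 x.2 = ⟨i, p⟩ ↔ (C.branch x.1 x.2).2 = p := by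
        constructor
        · intro h
          rw [h]
        · intro h
          exact Sigma.ext hi (heq_of_eq h)
      simp only [this]
      split_ifs <;> ring
    · rw [if_neg hi, if_neg hi, if_neg fun h => hi (by rw [h])]
      simpa using hasResidue_zero p
  have hsum := hasResidue_sum Finset.univ h
  change HasResidue (C.formsOfResidues r i) p _ at hsum
  convert hsum using 1
  rw [Finset.sum_sub_distrib, prescribed, sub_eq_add_neg]
  congr 1
  split_ifs
  -- The signs match because `branchResidue` is `r` on the `false` branch and `-r` on the `true`
  -- one, while the incidence matrix counts them with `-1` and `+1`.
  · rw [Fintype.sum_prod_type, ← Finset.sum_neg_distrib]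
    refine Finset.sum_congr rfl fun ν _ => ?_
    simp only [incidence, Matrix.of_apply, Fintype.sum_bool, branchResidue]
    simp only [if_true, Bool.false_eq_true, if_false]
    split_ifs <;> ring
  · simp

/-- Regularity away from the nodes and opposite residues at the nodes become one condition: the
residue at every point is the prescribed one. -/
lemma mem_dualizingSections_iff (η : C.Comp → RatFunc ℂ) :
    η ∈ C.dualizingSections ↔ ∃ r, ∀ i p, HasResidue (η i) p (C.prescribed r ⟨i, p⟩) := by
  constructor
  · rintro ⟨h1, h2⟩
    choose r hr hr' using h2
    refine ⟨r, fun i p => ?_⟩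
    by_cases h : ∀ ν b, C.branch ν b ≠ ⟨i, p⟩
    · rw [C.prescribed_of_ne r h]
      exact h1 i p h
    · push Not at h
      obtain ⟨ν, b, hb⟩ := h
      rw [← hb, C.prescribed_branch r (ν, b)]
      have e1 : (C.branch ν b).1 = i := by rw [hb]
      have e2 : (C.branch ν b).2 = p := by rw [hb]
      rw [← e1, ← e2]
      cases b
      · exact hr ν
      · exact hr' ν
  · rintro ⟨r, hr⟩
    refine ⟨fun i p h => ?_, fun ν => ⟨r ν, ?_, ?_⟩⟩
    · rw [← C.prescribed_of_ne r h]
      exact hr i p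
    · have := hr (C.branch ν false).1 (C.branch ν false).2
      rwa [Sigma.eta, C.prescribed_branch r (ν, false)] at this
    · have := hr (C.branch ν true).1 (C.branch ν true).2
      rwa [Sigma.eta, C.prescribed_branch r (ν, true)] at this

lemma hasResidue_of_mem_ker {r : C.Node → ℂ} (hr : r ∈ LinearMap.ker C.dualIncidence.mulVecLin)
    (i : C.Comp) (p : P1) : HasResidue (C.formsOfResidues r i) p (C.prescribed r ⟨i, p⟩) := by
  have := C.hasResidue_formsOfResidues r i p
  rw [show C.dualIncidence.mulVec r i = 0 from congrFun hr i, ite_self, add_zero] at this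
  exact this

/-- The sections of the dualizing sheaf are determined by their residues, which form a cycle of
the dual graph. -/
def cyclesEquiv : LinearMap.ker C.dualIncidence.mulVecLin ≃ₗ[ℂ] C.dualizingSections :=
  LinearEquiv.ofBijective ((C.formsOfResidues.domRestrict _).codRestrict _ fun r =>
    (C.mem_dualizingSections_iff _).mpr ⟨r.1, C.hasResidue_of_mem_ker r.2⟩) (by
    constructor
    · intro r t h
      apply Subtype.ext
      funext ν
      have h' : C.formsOfResidues r.1 = C.formsOfResidues t.1 := congrArg Subtype.val h
      have h1 := C.hasResidue_of_mem_ker r.2 (C.branch ν false).1 (C.branch ν false).2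
      have h2 := C.hasResidue_of_mem_ker t.2 (C.branch ν false).1 (C.branch ν false).2
      rw [Sigma.eta, C.prescribed_branch _ (ν, false)] at h1 h2
      rw [h'] at h1
      exact h1.unique h2
    · rintro ⟨η, hη⟩
      obtain ⟨r, hr⟩ := (C.mem_dualizingSections_iff η).mp hη
      -- The difference between `η` and the form built from its residues has no finite poles and at
      -- most a simple pole at infinity, so it is zero.
      have hfin : ∀ i a, HasResidue (η i - C.formsOfResidues r i) (P1.fin a) 0 := by
        intro i a
        convert (hr i (P1.fin a)).sub (C.hasResidue_formsOfResidues r i (P1.fin a)) using 1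
        rw [if_neg (P1.fin_ne_inf a), add_zero, sub_self]
      have hinf := fun i => (hr i P1.inf).sub (C.hasResidue_formsOfResidues r i P1.inf)
      have h0 : ∀ i, η i - C.formsOfResidues r i = 0 := fun i =>
        eq_zero_of_hasResidue (hfin i) (hinf i)
      refine ⟨⟨r, ?_⟩, Subtype.ext (funext fun i => (sub_eq_zero.mp (h0 i)).symm)⟩
      refine LinearMap.mem_ker.mpr (funext fun i => ?_)
      -- The residue of the zero form at infinity equals minus the incidence matrix applied to `r`,
      -- so `r` is a cycle.
      have := hinf i
      rw [h0 i] at this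
      have := this.unique (hasResidue_zero _)
      rw [if_pos rfl, sub_add_cancel_left, neg_eq_zero] at this
      exact this)

lemma finrank_dualizingSections :
    Module.finrank ℂ C.dualizingSections + Fintype.card C.Comp = Fintype.card C.Node + 1 := by
  classical
  rw [← C.cyclesEquiv.finrank_eq, ← C.card_components]
  exact finrank_ker_incidence _ _

instance : Module.Finite ℂ C.dualizingSections := Module.Finite.equiv C.cyclesEquiv

end NodalCurve

/-- The type identifies components with clusters and nodes with edges that are not contracted, which
transfers the count from the contracted graph. -/
lemma IsOfType.genus_add_card {n : ℕ} {P : PolyDecomp n} {C : NodalCurve}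
    {φ : Mor C.Point P.Total} {T : TropicalCurve n} (hT : T.Admissible) (h : IsOfType φ T) :
    T.genus + Fintype.card C.Comp = Fintype.card C.Node + 1 := by
  obtain ⟨comp, node, -⟩ := h
  rw [← Nat.card_eq_fintype_card, ← Nat.card_eq_fintype_card, ← Nat.card_congr comp,
    ← Nat.card_congr node]
  exact hT.genus_add_card

end TropDeg
end

theorem proposition3p2 {n : ℕ} (hn : 2 ≤ n)
    (T : TropDeg.TropicalCurve n) (hT : T.Admissible)
    (P : TropDeg.PolyDecomp n) (hP : P.Respects T)
    (C : TropDeg.NodalCurve) (φ : TropDeg.Mor C.Point P.Total)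
    (hφ : TropDeg.IsPreLog φ) (hφT : TropDeg.IsOfType φ T) :
    Module.rank ℂ (TropDeg.PullbackH1 φ) = ((n * T.genus : ℕ) : Cardinal) ∧
      Module.rank ℂ C.dualizingSections = (T.genus : Cardinal) := by
  have hg := hφT.genus_add_card hT
  constructor
  · have h := TropDeg.finrank_pullbackH1 φ
    -- Both spaces are finite dimensional, so the cardinal ranks reduce to natural numbers; the
    -- formula then follows from `hg`, multiplied by `n`.
    rw [← Module.finrank_eq_rank]
    congr 1
    nlinarith
  · have h := C.finrank_dualizingSections
    rw [← Module.finrank_eq_rank]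
    congr 1
    omega
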